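/- Let $\mathbb T=\mathbb R/2\pi\mathbb Z$ and let $a\in C^\infty(\mathbb T,[0,\infty))$ satisfy $\int_{\mathbb T}a\,dx=1$. For a periodic distribution $u=\sum_{k\in\mathbb Z}\hat u_ke^{ikx}$ put $\widehat{(\mathcal Hu)}_k=-i\,\mathrm{sgn}(k)\hat u_k$, $\widehat{(Du)}_k=|k|\hat u_k$, $Gu=a\,\big(u-\int_{\mathbb T}a u\,dx\big)$ (the integral being a duality pairing) and $\|u\|_\sigma^2=\|(1-\partial_x^2)^{\sigma/2}u\|_{L^2(\mathbb T)}^2=2\pi\sum_k(1+k^2)^\sigma|\hat u_k|^2$, and for $\sigma\in\mathbb R$ let $H^\sigma_0(\mathbb T)$ be the space of all $u$ with $\|u\|_\sigma<\infty$ and $\hat u_0=0$. For $T>0$ let $$Z_{s,T}=C([0,T],H^s_0(\mathbb T))\cap L^2(0,T,H^{s+\frac12}_0(\mathbb T)),\qquad \|v\|_{Z_{s,T}}=\|v\|_{L^\infty(0,T,H^s(\mathbb T))}+\|v\|_{L^2(0,T,H^{s+\frac12}(\mathbb T))}.$$ Let $s\ge 0$. There is a nondecreasing function $T\mapsto C(s,T)\in[0,\infty)$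 on $(0,\infty)$ (depending only on $s$ and $a$) such that, for all $T>0$, $v_0\in H^s_0(\mathbb T)$ and $g\in L^2(0,T,H^{s-\frac12}_0(\mathbb T))$, the problem $$v_t+\mathcal Hv_{xx}+GDGv=g\quad(0<t<T),\qquad v(0)=v_0,$$ has exactly one solution $v$, where a solution is a $v\in C([0,T],H^r_0(\mathbb T))$, for some $r\in\mathbb R$, such that $v(t)=v_0+\int_0^t(g-\mathcal Hv_{xx}-GDGv)\,d\tau$ for all $t\in[0,T]$ in the sense of distributions on $\mathbb T$. This solution satisfies $v\in Z_{s,T}$ and $$\|v\|_{Z_{s,T}}\le C(s,T)\big(\|v_0\|_s+\|g\|_{L^2(0,T,H^{s-\frac12}(\mathbb T))}\big).$$ Here functions may be complex-valued; if $v_0$ and $g$ are real-valued, then so is $v$. -/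

import Mathlib

open Set Filter Topology MeasureTheory
open scoped ENNReal NNReal ContDiff

noncomputable section

namespace BenjaminOno

/-! A periodic distribution `u = ∑ û_k e^{ikx}` on `𝕋 = ℝ / 2πℤ` is represented by the sequence
`k ↦ û_k` of its Fourier coefficients `û_k = (1 / 2π) ∫ u(x) e^{-ikx} dx`. -/

/-- The squared norm `‖u‖_σ² = ‖(1 - ∂ₓ²)^{σ/2} u‖²_{L²(𝕋)} = 2π ∑ (1 + k²)^σ |û_k|²` of `H^σ(𝕋)`,
as an extended nonnegative number; it is finite exactly when `u ∈ H^σ(𝕋)`. -/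
def sobNormSq (σ : ℝ) (u : ℤ → ℂ) : ℝ≥0∞ :=
  ENNReal.ofReal (2 * Real.pi) *
    ∑' k : ℤ, ENNReal.ofReal ((1 + (k : ℝ) ^ 2) ^ σ) * ‖u k‖ₑ ^ 2

/-- The norm `‖u‖_σ` of `H^σ(𝕋)`. -/
def sobNorm (σ : ℝ) (u : ℤ → ℂ) : ℝ≥0∞ := sobNormSq σ u ^ (1 / 2 : ℝ)

/-- `u ∈ H^σ_0(𝕋)`: the `H^σ` norm is finite and the mean value vanishes. -/
def MemH0 (σ : ℝ) (u : ℤ → ℂ) : Prop := u 0 = 0 ∧ sobNormSq σ u < ⊤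

/-- `u` is real-valued: `û_{-k}` is the complex conjugate of `û_k`. -/
def IsRealValued (u : ℤ → ℂ) : Prop := ∀ k : ℤ, u (-k) = star (u k)

/-- Fourier coefficients of a `2π`-periodic function. -/
def coeff (a : ℝ → ℝ) (k : ℤ) : ℂ :=
  (1 / (2 * Real.pi) : ℂ) *
    ∫ x in (0 : ℝ)..(2 * Real.pi), (a x : ℂ) * Complex.exp (-(Complex.I * k * x))

/-- The Hilbert transform, `(Hu)^_k = -i sgn(k) û_k`. -/
def hilbert (u : ℤ → ℂ) (k : ℤ) : ℂ := -Complex.I * (k.sign : ℂ) * u k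

/-- The derivative, `(∂ₓ u)^_k = i k û_k`. -/
def deriv1 (u : ℤ → ℂ) (k : ℤ) : ℂ := Complex.I * (k : ℂ) * u k

/-- The operator `D`, `(Du)^_k = |k| û_k`. -/
def absD (u : ℤ → ℂ) (k : ℤ) : ℂ := ((|k| : ℤ) : ℂ) * u k

/-- Multiplication by a function `a`: the product `a u` has the coefficients
`∑_j â_{k-j} û_j`. For smooth `a` and `u` in any `H^σ(𝕋)` the series converges absolutely. -/
def mulBy (a : ℝ → ℝ) (u : ℤ → ℂ) (k : ℤ) : ℂ := ∑' j : ℤ, coeff a (k - j) * u j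

/-- `G u = a (u - ∫ a u)`, where `∫ a u = 2π (a u)^_0` is the duality pairing of `u` and `a`. -/
def opG (a : ℝ → ℝ) (u : ℤ → ℂ) (k : ℤ) : ℂ :=
  mulBy a u k - (2 * Real.pi : ℂ) * mulBy a u 0 * coeff a k

/-- `v ∈ C([0,T], H^σ_0(𝕋))`. -/
def MemC (σ T : ℝ) (v : ℝ → ℤ → ℂ) : Prop :=
  (∀ t ∈ Icc 0 T, MemH0 σ (v t)) ∧
    ∀ t₀ ∈ Icc 0 T, Tendsto (fun t => sobNorm σ (v t - v t₀)) (𝓝[Icc 0 T] t₀) (𝓝 0)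

/-- The norm of `L²(0,T, H^σ(𝕋))`. -/
def normL2 (σ T : ℝ) (g : ℝ → ℤ → ℂ) : ℝ≥0∞ :=
  (∫⁻ t in Icc 0 T, sobNormSq σ (g t)) ^ (1 / 2 : ℝ)

/-- `g ∈ L²(0,T, H^σ_0(𝕋))`. As `H^σ_0(𝕋)` is a separable Hilbert space in which the trigonometric
monomials form an orthogonal basis, strong measurability is measurability of all coefficients. -/
def MemL2 (σ T : ℝ) (g : ℝ → ℤ → ℂ) : Prop :=
  (∀ k : ℤ, AEStronglyMeasurable (fun t => g t k) (volume.restrict (Icc 0 T))) ∧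
    (∀ᵐ t ∂volume.restrict (Icc 0 T), MemH0 σ (g t)) ∧ normL2 σ T g < ⊤

/-- `v ∈ Z_{s,T} = C([0,T], H^s_0(𝕋)) ∩ L²(0,T, H^{s+1/2}_0(𝕋))`. -/
def MemZ (s T : ℝ) (v : ℝ → ℤ → ℂ) : Prop := MemC s T v ∧ MemL2 (s + 1 / 2) T v

/-- The norm of `Z_{s,T}` (for continuous functions the `L^∞` norm in time is the supremum). -/
def normZ (s T : ℝ) (v : ℝ → ℤ → ℂ) : ℝ≥0∞ :=
  (⨆ t ∈ Icc 0 T, sobNorm s (v t)) + normL2 (s + 1 / 2) T v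

/-- `v` is a solution on `[0,T]` of `v_t + H v_xx + GDG v = g`, `v(0) = v₀`: it is continuous in
time with values in some `H^r_0(𝕋)`, `r ∈ ℝ`, and
`v(t) = v₀ + ∫₀ᵗ (g - H v_xx - GDG v) dτ` for all `t ∈ [0,T]` as distributions on `𝕋`, that is,
when tested against each `e^{-ikx}`. (The coefficients of `H v_xx` and `GDG v` are continuous in
time, so the integrand is integrable as soon as the coefficients of `g` are.) -/
def IsSolution (a : ℝ → ℝ) (T : ℝ) (v₀ : ℤ → ℂ) (g v : ℝ → ℤ → ℂ) : Prop :=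
  (∃ r : ℝ, MemC r T v) ∧
    ∀ t ∈ Icc 0 T, ∀ k : ℤ,
      v t k = v₀ k + ∫ τ in (0 : ℝ)..t,
        (g τ k - hilbert (deriv1 (deriv1 (v τ))) k - opG a (absD (opG a (v τ))) k)

end BenjaminOno

end

/-! Everything is done on Fourier coefficients: operators are infinite matrices whose entries decay
rapidly off the diagonal (`IsOrd`), and "modulo lower order" means that a matrix of order 0 has a
form bounded on L².

The heart is an energy inequality. The term H∂ₓ² has the diagonal symbol i k|k| and is skew-adjoint,
and GDG = (D^{1/2}G)*(D^{1/2}G) is nonnegative (`qform_sKer_nonneg`), so the plain L² energy does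
not grow through them. But the damping only sees half a derivative of Gv, which is degenerate
wherever a vanishes. To recover the full half derivative, the energy ⟨(1 + εb)v, v⟩ is used, where b
is periodic with b' = a²/μ - 1 and μ is the mean of a²; such a b exists because the right side has
mean zero. The commutator of b with H∂ₓ² contributes D^{1/2}(1 - a²/μ)D^{1/2}, which is D - μ⁻¹GDG
modulo order 0 (`isOrd_sKer_sub`, `isOrd_commutator`, `dispersion_form_le`). Thus ε⟨Dv, v⟩ is gained
everywhere, and for small ε the loss εμ⁻¹⟨GDGv, v⟩ is absorbed by the damping. The cross term
ε⟨GDGv, bv⟩ is split by positivity of the form; it costs a fraction of the damping and O(ε²) of the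
H^{1/2} norm (`energy_form`). Conjugation by (1 - ∂ₓ²)^{σ/2} changes GDG only by order 0
(`isOrd_tKer_sub`), so Gronwall gives `energy_estimate` for every real σ. The argument uses only
quadratic forms and a diagonal dispersive term, hence holds for truncations to any finite set of
modes, with constants independent of that set.

Existence: a truncated solution with smooth data also solves every larger truncation, up to a
forcing made of the neglected modes, which is small because it can be measured in a weaker norm
(`exists_approx_of_smooth`). Two approximate solutions can therefore be compared inside a common
truncation, and the energy estimate makes them Cauchy (`exists_isLimit`). The bound, the continuity
in time and the equation pass to the limit.

Uniqueness: the truncation of a difference of two solutions in C([0,T], H^r) is a truncated solution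
with a forcing that tends to 0 in H^{r-3}, so the estimate at σ = r - 5/2 applies
(`eq_zero_of_integral_eq`). Reality follows from uniqueness, as the complex conjugate solves the
same problem. The mean value stays 0 because ∫a = 1 makes Gu mean-free (`IsLimit.memC`). -/

namespace BenjaminOno

open scoped ComplexConjugate

section

/-! ### The weight `1 + k²` -/

/-- The weight `1 + k²`. -/
noncomputable def jap (k : ℤ) : ℝ := 1 + (k : ℝ) ^ 2

lemma one_le_jap (k : ℤ) : 1 ≤ jap k := by unfold jap; nlinarith [sq_nonneg (k : ℝ)]

lemma jap_pos (k : ℤ) : 0 < jap k := lt_of_lt_of_le one_pos (one_le_jap k)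

lemma jap_neg (k : ℤ) : jap (-k) = jap k := by simp [jap]

lemma jap_sub_comm (k j : ℤ) : jap (k - j) = jap (j - k) := by
  rw [← jap_neg, neg_sub]

lemma jap_rpow_pos (k : ℤ) (p : ℝ) : 0 < jap k ^ p := Real.rpow_pos_of_pos (jap_pos k) p

lemma jap_rpow_nonneg (k : ℤ) (p : ℝ) : 0 ≤ jap k ^ p := (jap_rpow_pos k p).le

lemma jap_rpow_mono (k : ℤ) {p q : ℝ} (h : p ≤ q) : jap k ^ p ≤ jap k ^ q :=
  Real.rpow_le_rpow_of_exponent_le (one_le_jap k) h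

lemma jap_rpow_add (k : ℤ) (p q : ℝ) : jap k ^ (p + q) = jap k ^ p * jap k ^ q :=
  Real.rpow_add (jap_pos k) p q

lemma jap_rpow_sq (k : ℤ) (p : ℝ) : (jap k ^ (p / 2)) ^ 2 = jap k ^ p := by
  rw [sq, ← jap_rpow_add]; congr 1; ring

lemma jap_le (k j : ℤ) : jap k ≤ 2 * jap (k - j) * jap j := by
  unfold jap; push_cast
  nlinarith [sq_nonneg ((k : ℝ) - 2 * j), sq_nonneg (((k : ℝ) - j) * j), sq_nonneg ((k : ℝ) - j),
    sq_nonneg (j : ℝ)]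

/-- Peetre's inequality. -/
lemma jap_rpow_le (p : ℝ) (k j : ℤ) :
    jap k ^ p ≤ 2 ^ |p| * jap (k - j) ^ |p| * jap j ^ p := by
  have h2 : (0 : ℝ) ≤ 2 * jap (k - j) := by have := jap_pos (k - j); positivity
  rw [← Real.mul_rpow two_pos.le (jap_pos _).le]
  rcases le_total 0 p with hp | hp
  · rw [abs_of_nonneg hp, ← Real.mul_rpow h2 (jap_pos _).le]
    exact Real.rpow_le_rpow (jap_pos _).le (jap_le k j) hp
  · rw [abs_of_nonpos hp]
    have h := jap_le j k
    rw [jap_sub_comm] at h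
    have h3 : jap j ^ (-p) ≤ (2 * jap (k - j)) ^ (-p) * jap k ^ (-p) := by
      rw [← Real.mul_rpow h2 (jap_pos _).le]
      exact Real.rpow_le_rpow (jap_pos _).le h (by linarith)
    have h4 : jap k ^ p * jap k ^ (-p) = 1 := by
      rw [← jap_rpow_add]; simp
    have h5 : jap j ^ p * jap j ^ (-p) = 1 := by
      rw [← jap_rpow_add]; simp
    calc jap k ^ p = jap k ^ p * (jap j ^ (-p) * jap j ^ p) := by rw [mul_comm (jap j ^ (-p)), h5, mul_one]
      _ ≤ jap k ^ p * ((2 * jap (k - j)) ^ (-p) * jap k ^ (-p) * jap j ^ p) := by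
        gcongr
        · exact jap_rpow_nonneg _ _
        · exact jap_rpow_nonneg _ _
      _ = (jap k ^ p * jap k ^ (-p)) * ((2 * jap (k - j)) ^ (-p) * jap j ^ p) := by ring
      _ = _ := by rw [h4, one_mul]

/-- Peetre's inequality in the form used for convolutions and rank-one matrices: decay in two
variables separately gives decay in their sum. -/
lemma jap_rpow_neg_mul_le {m : ℝ} (hm : 0 ≤ m) (x y : ℤ) :
    jap x ^ (-m) * jap y ^ (-m) ≤ 2 ^ m * jap (x + y) ^ (-m) := by
  have h := jap_rpow_le m (x + y) y
  rw [abs_of_nonneg hm, add_sub_cancel_right] at h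
  have e : ∀ i, jap i ^ (-m) * jap i ^ m = 1 := fun i => by rw [← jap_rpow_add]; simp
  have h0 := jap_rpow_nonneg x (-m)
  have h1 := jap_rpow_nonneg y (-m)
  have h2 := jap_rpow_nonneg (x + y) (-m)
  calc jap x ^ (-m) * jap y ^ (-m)
      = jap x ^ (-m) * jap y ^ (-m) * (jap (x + y) ^ (-m) * jap (x + y) ^ m) := by
        rw [e, mul_one]
    _ ≤ jap x ^ (-m) * jap y ^ (-m) *
        (jap (x + y) ^ (-m) * (2 ^ m * jap x ^ m * jap y ^ m)) := by gcongr
    _ = 2 ^ m * jap (x + y) ^ (-m) * (jap x ^ (-m) * jap x ^ m) *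
        (jap y ^ (-m) * jap y ^ m) := by ring
    _ = 2 ^ m * jap (x + y) ^ (-m) := by rw [e, e]; ring

lemma abs_le_jap_half (k : ℤ) : |(k : ℝ)| ≤ jap k ^ (1 / 2 : ℝ) := by
  rw [← Real.sqrt_eq_rpow]
  apply Real.abs_le_sqrt
  unfold jap; linarith

lemma jap_half_le (k : ℤ) : jap k ^ (1 / 2 : ℝ) ≤ 1 + |(k : ℝ)| := by
  rw [← Real.sqrt_eq_rpow]
  apply Real.sqrt_le_iff.2
  refine ⟨by positivity, ?_⟩
  unfold jap; nlinarith [sq_abs (k : ℝ), abs_nonneg (k : ℝ)]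

lemma abs_le_jap (k : ℤ) : |(k : ℝ)| ≤ jap k := by
  unfold jap; nlinarith [sq_abs (k : ℝ), abs_nonneg (k : ℝ), sq_nonneg (|(k : ℝ)| - 1)]

lemma summable_jap_inv : Summable (fun k : ℤ => jap k ^ (-1 : ℝ)) := by
  have h := (Real.summable_one_div_int_pow (p := 2)).2 (by norm_num)
  refine Summable.of_nonneg_of_le (fun k => jap_rpow_nonneg k _) (fun k => ?_)
    (h.add (summable_of_hasFiniteSupport (f := fun k : ℤ => if k = 0 then (1 : ℝ) else 0)
      ((finite_singleton (0 : ℤ)).subset fun k hk => by simpa using hk)))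
  rw [Real.rpow_neg_one]
  by_cases hk : k = 0
  · simp [hk, jap]
  · have : (0 : ℝ) < (k : ℝ) ^ 2 := by positivity
    simp only [hk, if_false, add_zero, one_div]
    exact inv_anti₀ this (by unfold jap; linarith)

/-- The constant `∑ (1 + k²)⁻¹`. -/
noncomputable def japSum : ℝ := ∑' k : ℤ, jap k ^ (-1 : ℝ)

lemma japSum_pos : 0 < japSum :=
  summable_jap_inv.tsum_pos (fun _ => jap_rpow_nonneg _ _) 0 (jap_rpow_pos _ _)

lemma summable_jap_inv_sub (k : ℤ) : Summable (fun j : ℤ => jap (k - j) ^ (-1 : ℝ)) :=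
  summable_jap_inv.comp_injective (sub_right_injective (b := k))

lemma tsum_jap_inv_sub (k : ℤ) : ∑' j : ℤ, jap (k - j) ^ (-1 : ℝ) = japSum :=
  (Equiv.subLeft k).tsum_eq (fun j => jap j ^ (-1 : ℝ))

/-! ### Kernels of a given order -/

/-- The infinite matrix `K` is of order `2p`: it maps `H^{σ+2p}(𝕋)` to `H^σ(𝕋)` for all `σ` and its
entries decay rapidly off the diagonal. -/
def IsOrd (p : ℝ) (K : ℤ → ℤ → ℂ) : Prop :=
  ∀ M : ℝ, ∃ C : ℝ, 0 ≤ C ∧ ∀ k j, ‖K k j‖ ≤ C * jap j ^ p * jap (k - j) ^ (-M)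

/-- Rapid decay of a sequence. -/
def Rapid (α : ℤ → ℂ) : Prop := ∀ M : ℝ, ∃ C : ℝ, 0 ≤ C ∧ ∀ k, ‖α k‖ ≤ C * jap k ^ (-M)

lemma IsOrd.mono {p q : ℝ} {K : ℤ → ℤ → ℂ} (hK : IsOrd p K) (h : p ≤ q) : IsOrd q K := by
  intro M
  obtain ⟨C, hC, hb⟩ := hK M
  refine ⟨C, hC, fun k j => (hb k j).trans ?_⟩
  have := jap_rpow_mono j h
  have := jap_rpow_nonneg (k - j) (-M)
  gcongr

/-- Polynomial growth off the diagonal is free: the decay of `L` is available at every rate, so it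
is taken faster by `m`. -/
lemma IsOrd.of_le {p q m c : ℝ} {K L : ℤ → ℤ → ℂ} (hL : IsOrd q L) (hc : 0 ≤ c)
    (h : ∀ k j, ‖K k j‖ ≤ c * jap j ^ p * jap (k - j) ^ m * ‖L k j‖) : IsOrd (p + q) K := by
  intro M
  obtain ⟨C, hC, hb⟩ := hL (M + m)
  refine ⟨c * C, by positivity, fun k j => (h k j).trans ?_⟩
  have h1 := jap_rpow_nonneg (k - j) m
  have h2 := jap_rpow_nonneg j p
  calc c * jap j ^ p * jap (k - j) ^ m * ‖L k j‖
      ≤ c * jap j ^ p * jap (k - j) ^ m * (C * jap j ^ q * jap (k - j) ^ (-(M + m))) := by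
        gcongr; exact hb k j
    _ = c * C * (jap j ^ p * jap j ^ q) * (jap (k - j) ^ m * jap (k - j) ^ (-(M + m))) := by ring
    _ = _ := by
      rw [← jap_rpow_add, ← jap_rpow_add]; congr 2; ring

lemma IsOrd.of_norm_le {q c : ℝ} {K L : ℤ → ℤ → ℂ} (hL : IsOrd q L) (hc : 0 ≤ c)
    (h : ∀ k j, ‖K k j‖ ≤ c * ‖L k j‖) : IsOrd q K := by
  have := IsOrd.of_le (p := 0) (m := 0) hL hc (K := K) (by simpa using h)
  simpa using this

lemma IsOrd.add {p : ℝ} {K L : ℤ → ℤ → ℂ} (hK : IsOrd p K) (hL : IsOrd p L) :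
    IsOrd p (fun k j => K k j + L k j) := by
  intro M
  obtain ⟨C, hC, hb⟩ := hK M
  obtain ⟨C', hC', hb'⟩ := hL M
  refine ⟨C + C', by positivity, fun k j => (norm_add_le _ _).trans ?_⟩
  have := hb k j
  have := hb' k j
  linarith

lemma IsOrd.const_mul {p : ℝ} {K : ℤ → ℤ → ℂ} (hK : IsOrd p K) (c : ℂ) :
    IsOrd p (fun k j => c * K k j) :=
  hK.of_norm_le (norm_nonneg c) (fun _ _ => (norm_mul _ _).le)

lemma IsOrd.sub {p : ℝ} {K L : ℤ → ℤ → ℂ} (hK : IsOrd p K) (hL : IsOrd p L) :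
    IsOrd p (fun k j => K k j - L k j) := by
  have := hK.add (hL.const_mul (-1))
  simpa [sub_eq_add_neg] using this

/-- Multiplication of a matrix from the left by the diagonal matrix `(1 + k²)^p`. -/
lemma IsOrd.left_mul {p q c : ℝ} {K L : ℤ → ℤ → ℂ} (hL : IsOrd q L) (hc : 0 ≤ c)
    (h : ∀ k j, ‖K k j‖ ≤ c * jap k ^ p * ‖L k j‖) : IsOrd (p + q) K := by
  refine hL.of_le (c := c * 2 ^ |p|) (m := |p|) (by positivity) fun k j => (h k j).trans ?_
  calc c * jap k ^ p * ‖L k j‖ ≤ c * (2 ^ |p| * jap (k - j) ^ |p| * jap j ^ p) * ‖L k j‖ := by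
        gcongr; exact jap_rpow_le p k j
    _ = _ := by ring

lemma IsOrd.toeplitz {α : ℤ → ℂ} (hα : Rapid α) : IsOrd 0 (fun k j => α (k - j)) := by
  intro M
  obtain ⟨C, hC, hb⟩ := hα M
  exact ⟨C, hC, fun k j => by simpa using hb (k - j)⟩

lemma isOrd_diag {p c : ℝ} (hc : 0 ≤ c) {d : ℤ → ℂ} (hd : ∀ k, ‖d k‖ ≤ c * jap k ^ p) :
    IsOrd p (fun k j => if k = j then d k else 0) := by
  intro M
  refine ⟨c, hc, fun k j => ?_⟩
  by_cases h : k = j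
  · subst h
    simpa [jap] using hd k
  · simp only [h, if_false, norm_zero]
    have := jap_rpow_nonneg j p
    have := jap_rpow_nonneg (k - j) (-M)
    positivity

/-- A rank-one operator with smooth factors is smoothing, so it has every order `p`; this lets all
rank-one parts of G be discarded later. -/
lemma isOrd_rankOne {α γ : ℤ → ℂ} (hα : Rapid α) (hγ : Rapid γ) (p : ℝ) :
    IsOrd p (fun k j => α k * γ j) := by
  intro M
  obtain ⟨C, hC, hb⟩ := hα |M|
  obtain ⟨C', hC', hb'⟩ := hγ (|M| - p)
  refine ⟨C * C' * 2 ^ |M|, by positivity, fun k j => ?_⟩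
  rw [norm_mul]
  have h3 : jap k ^ (-|M|) * jap j ^ (-|M|) ≤ 2 ^ |M| * jap (k - j) ^ (-M) := by
    have h := jap_rpow_neg_mul_le (abs_nonneg M) k (-j)
    rw [jap_neg, ← sub_eq_add_neg] at h
    exact h.trans (mul_le_mul_of_nonneg_left (jap_rpow_mono _ (neg_le_neg (le_abs_self M)))
      (by positivity))
  have h1 := jap_rpow_nonneg k (-|M|)
  calc ‖α k‖ * ‖γ j‖ ≤ (C * jap k ^ (-|M|)) * (C' * jap j ^ (-(|M| - p))) := by
        gcongr; exacts [hb k, hb' j]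
    _ = C * C' * jap j ^ p * (jap k ^ (-|M|) * jap j ^ (-|M|)) := by
        rw [show -(|M| - p) = p + -|M| by ring, jap_rpow_add]; ring
    _ ≤ C * C' * jap j ^ p * (2 ^ |M| * jap (k - j) ^ (-M)) := by
        have := jap_rpow_nonneg j p
        gcongr
    _ = _ := by ring

end

section

/-! ### Composition of kernels -/

lemma IsOrd.norm_comp_le {p q : ℝ} {K L : ℤ → ℤ → ℂ} (hK : IsOrd p K) (hL : IsOrd q L) (M : ℝ) :
    ∃ C : ℝ, 0 ≤ C ∧ ∀ k m j, ‖K k m‖ * ‖L m j‖ ≤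
      C * jap j ^ (p + q) * jap (k - j) ^ (-M) * jap (k - m) ^ (-1 : ℝ) := by
  -- Besides the rate `|M|` to be kept, one power is reserved for summing over `m`, and `|p|` powers
  -- pay for moving the weight from `m` to `j`.
  obtain ⟨C, hC, hb⟩ := hK (|M| + 1)
  obtain ⟨C', hC', hb'⟩ := hL (|M| + |p|)
  refine ⟨C * C' * 2 ^ |p| * 2 ^ |M|, by positivity, fun k m j => ?_⟩
  have hp := jap_rpow_le p m j
  have h1 := jap_rpow_nonneg (k - m) (-(|M| + 1))
  have h2 := jap_rpow_nonneg (m - j) (-(|M| + |p|))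
  have h3 := jap_rpow_nonneg j q
  have h4 := jap_rpow_nonneg m p
  have h5 := jap_rpow_nonneg j (p + q)
  have h6 := jap_rpow_nonneg (k - m) (-1)
  have h7 := jap_rpow_neg_mul_le (abs_nonneg M) (k - m) (m - j)
  rw [sub_add_sub_cancel] at h7
  have h8 := h7.trans (mul_le_mul_of_nonneg_left
    (jap_rpow_mono (k - j) (neg_le_neg (le_abs_self M))) (by positivity))
  calc ‖K k m‖ * ‖L m j‖
      ≤ (C * jap m ^ p * jap (k - m) ^ (-(|M| + 1))) *
        (C' * jap j ^ q * jap (m - j) ^ (-(|M| + |p|))) := by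
        gcongr; exacts [hb k m, hb' m j]
    _ ≤ (C * (2 ^ |p| * jap (m - j) ^ |p| * jap j ^ p) * jap (k - m) ^ (-(|M| + 1))) *
        (C' * jap j ^ q * jap (m - j) ^ (-(|M| + |p|))) := by gcongr
    _ = C * C' * 2 ^ |p| * jap j ^ (p + q) * jap (k - m) ^ (-1 : ℝ) *
        (jap (k - m) ^ (-|M|) * jap (m - j) ^ (-|M|)) := by
        rw [show -(|M| + 1) = -|M| + -1 by ring, show -(|M| + |p|) = -|M| + -|p| by ring,
          jap_rpow_add, jap_rpow_add, jap_rpow_add]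
        have : jap (m - j) ^ |p| * jap (m - j) ^ (-|p|) = 1 := by rw [← jap_rpow_add]; simp
        linear_combination (C * C' * 2 ^ |p| * jap j ^ p * jap j ^ q * jap (k - m) ^ (-1 : ℝ) *
          (jap (k - m) ^ (-|M|) * jap (m - j) ^ (-|M|))) * this
    _ ≤ C * C' * 2 ^ |p| * jap j ^ (p + q) * jap (k - m) ^ (-1 : ℝ) *
        (2 ^ |M| * jap (k - j) ^ (-M)) := by gcongr
    _ = _ := by ring

lemma IsOrd.summable_comp {p q : ℝ} {K L : ℤ → ℤ → ℂ} (hK : IsOrd p K) (hL : IsOrd q L)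
    (k j : ℤ) : Summable (fun m => ‖K k m‖ * ‖L m j‖) := by
  obtain ⟨C, -, hb⟩ := hK.norm_comp_le hL 0
  exact Summable.of_nonneg_of_le (fun m => by positivity) (fun m => hb k m j)
    ((summable_jap_inv_sub k).mul_left _)

/-- A matrix whose entries are series dominated by those of a matrix product. -/
lemma IsOrd.tsum_of_le {p q : ℝ} {K L : ℤ → ℤ → ℂ} (hK : IsOrd p K) (hL : IsOrd q L)
    {F : ℤ → ℤ → ℤ → ℂ} (hF : ∀ k m j, ‖F k m j‖ ≤ ‖K k m‖ * ‖L m j‖) :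
    IsOrd (p + q) (fun k j => ∑' m, F k m j) := by
  intro M
  obtain ⟨C, hC, hb⟩ := hK.norm_comp_le hL M
  refine ⟨C * japSum, mul_nonneg hC japSum_pos.le, fun k j => ?_⟩
  have hs := (summable_jap_inv_sub k).mul_left (C * jap j ^ (p + q) * jap (k - j) ^ (-M))
  refine (tsum_of_norm_bounded hs.hasSum fun m => (hF k m j).trans (hb k m j)).trans ?_
  rw [tsum_mul_left, tsum_jap_inv_sub]
  exact le_of_eq (by ring)

lemma IsOrd.comp {p q : ℝ} {K L : ℤ → ℤ → ℂ} (hK : IsOrd p K) (hL : IsOrd q L) :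
    IsOrd (p + q) (fun k j => ∑' m, K k m * L m j) :=
  hK.tsum_of_le hL fun _ _ _ => (norm_mul _ _).le

/-! ### Finite quadratic forms -/

/-- The sesquilinear form of the truncated matrix `K`. -/
noncomputable def qform (K : ℤ → ℤ → ℂ) (I : Finset ℤ) (y z : ℤ → ℂ) : ℂ :=
  ∑ k ∈ I, ∑ j ∈ I, K k j * y j * conj (z k)

/-- The truncated weighted sum of squares. -/
noncomputable def nsq (p : ℝ) (I : Finset ℤ) (y : ℤ → ℂ) : ℝ := ∑ k ∈ I, jap k ^ p * ‖y k‖ ^ 2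

/-- The truncated action of a matrix. -/
noncomputable def fapp (K : ℤ → ℤ → ℂ) (I : Finset ℤ) (y : ℤ → ℂ) (k : ℤ) : ℂ :=
  ∑ j ∈ I, K k j * y j

lemma nsq_nonneg (p : ℝ) (I : Finset ℤ) (y : ℤ → ℂ) : 0 ≤ nsq p I y :=
  Finset.sum_nonneg fun k _ => mul_nonneg (jap_rpow_nonneg k p) (sq_nonneg _)

lemma sum_jap_inv_sub_le (I : Finset ℤ) (k : ℤ) :
    ∑ j ∈ I, jap (k - j) ^ (-1 : ℝ) ≤ japSum :=
  ((summable_jap_inv_sub k).sum_le_tsum I fun _ _ => jap_rpow_nonneg _ _).trans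
    (tsum_jap_inv_sub k).le

lemma sum_jap_inv_mul_le (I : Finset ℤ) (f : ℤ → ℝ) (hf : ∀ k, 0 ≤ f k) :
    ∑ k ∈ I, ∑ j ∈ I, jap (k - j) ^ (-1 : ℝ) * f k ≤ japSum * ∑ k ∈ I, f k := by
  rw [Finset.mul_sum]
  refine Finset.sum_le_sum fun k _ => ?_
  rw [← Finset.sum_mul]
  exact mul_le_mul_of_nonneg_right (sum_jap_inv_sub_le I k) (hf k)

/-- A matrix of order `2p` has a form bounded on `H^p(𝕋)`. -/
lemma IsOrd.qform_le {p : ℝ} {K : ℤ → ℤ → ℂ} (hK : IsOrd p K) :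
    ∃ C : ℝ, 0 ≤ C ∧ ∀ I y z, ‖qform K I y z‖ ≤ C * (nsq p I y + nsq p I z) := by
  -- Half of the weight at `j` is moved to `k` at the price of `|p / 2|` powers of the distance; the
  -- remaining power makes rows and columns summable, as in Schur's test.
  obtain ⟨C, hC, hb⟩ := hK (1 + |p / 2|)
  set D := C * 2 ^ |p / 2| / 2 with hD
  have hDn : 0 ≤ D := by positivity
  refine ⟨D * japSum, mul_nonneg hDn japSum_pos.le, fun I y z => ?_⟩
  have key : ∀ k j, ‖K k j * y j * conj (z k)‖ ≤
      D * (jap (k - j) ^ (-1 : ℝ) * (jap k ^ p * ‖z k‖ ^ 2)) +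
      D * (jap (j - k) ^ (-1 : ℝ) * (jap j ^ p * ‖y j‖ ^ 2)) := by
    intro k j
    have hK' : ‖K k j‖ ≤ 2 * D * jap (k - j) ^ (-1 : ℝ) * (jap j ^ (p / 2) * jap k ^ (p / 2)) := by
      have hp := jap_rpow_le (p / 2) j k
      rw [jap_sub_comm] at hp
      have h1 := jap_rpow_nonneg (k - j) (-(1 + |p / 2|))
      have h2 := jap_rpow_nonneg j (p / 2)
      calc ‖K k j‖ ≤ C * jap j ^ p * jap (k - j) ^ (-(1 + |p / 2|)) := hb k j
        _ = C * (jap j ^ (p / 2) * jap j ^ (p / 2)) * jap (k - j) ^ (-(1 + |p / 2|)) := by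
          rw [← jap_rpow_add]; congr 3; ring
        _ ≤ C * (jap j ^ (p / 2) * (2 ^ |p / 2| * jap (k - j) ^ |p / 2| * jap k ^ (p / 2))) *
            jap (k - j) ^ (-(1 + |p / 2|)) := by gcongr
        _ = 2 * D * (jap (k - j) ^ |p / 2| * jap (k - j) ^ (-(1 + |p / 2|))) *
            (jap j ^ (p / 2) * jap k ^ (p / 2)) := by rw [hD]; ring
        _ = _ := by rw [← jap_rpow_add]; congr 3; ring
    rw [norm_mul, norm_mul, RCLike.norm_conj, jap_sub_comm j k, ← jap_rpow_sq k, ← jap_rpow_sq j]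
    set u := jap j ^ (p / 2) * ‖y j‖
    set v := jap k ^ (p / 2) * ‖z k‖
    have h0 : 0 ≤ D * jap (k - j) ^ (-1 : ℝ) := mul_nonneg hDn (jap_rpow_nonneg _ _)
    calc ‖K k j‖ * ‖y j‖ * ‖z k‖
        ≤ 2 * D * jap (k - j) ^ (-1 : ℝ) * (jap j ^ (p / 2) * jap k ^ (p / 2)) * ‖y j‖ * ‖z k‖ := by
          gcongr
      _ = D * jap (k - j) ^ (-1 : ℝ) * (2 * u * v) := by simp only [u, v]; ring
      _ ≤ D * jap (k - j) ^ (-1 : ℝ) * (u ^ 2 + v ^ 2) :=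
          mul_le_mul_of_nonneg_left (two_mul_le_add_sq u v) h0
      _ = _ := by simp only [u, v]; ring
  calc ‖qform K I y z‖ ≤ ∑ k ∈ I, ∑ j ∈ I, ‖K k j * y j * conj (z k)‖ :=
        (norm_sum_le _ _).trans (Finset.sum_le_sum fun k _ => norm_sum_le _ _)
    _ ≤ ∑ k ∈ I, ∑ j ∈ I, (D * (jap (k - j) ^ (-1 : ℝ) * (jap k ^ p * ‖z k‖ ^ 2)) +
      D * (jap (j - k) ^ (-1 : ℝ) * (jap j ^ p * ‖y j‖ ^ 2))) :=
        Finset.sum_le_sum fun k _ => Finset.sum_le_sum fun j _ => key k j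
    _ = D * ∑ k ∈ I, ∑ j ∈ I, jap (k - j) ^ (-1 : ℝ) * (jap k ^ p * ‖z k‖ ^ 2) +
        D * ∑ j ∈ I, ∑ k ∈ I, jap (j - k) ^ (-1 : ℝ) * (jap j ^ p * ‖y j‖ ^ 2) := by
        simp only [Finset.sum_add_distrib, Finset.mul_sum]
        congr 1
        exact Finset.sum_comm
    _ ≤ D * (japSum * nsq p I z) + D * (japSum * nsq p I y) := by
        gcongr
        · exact sum_jap_inv_mul_le I _ fun k => mul_nonneg (jap_rpow_nonneg k p) (sq_nonneg _)
        · exact sum_jap_inv_mul_le I _ fun k => mul_nonneg (jap_rpow_nonneg k p) (sq_nonneg _)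
    _ = _ := by ring

/-! ### Operators on sequences -/

/-- The weighted sum of squares as an extended nonnegative number. -/
lemma sobNormSq_eq (σ : ℝ) (u : ℤ → ℂ) : sobNormSq σ u =
    ENNReal.ofReal (2 * Real.pi) * ∑' k : ℤ, ENNReal.ofReal (jap k ^ σ) * ‖u k‖ₑ ^ 2 := rfl

/-- The action of an infinite matrix. -/
noncomputable def kapp (K : ℤ → ℤ → ℂ) (u : ℤ → ℂ) (k : ℤ) : ℂ := ∑' j, K k j * u j

/-- Schur's test: write `w` as the product of its square roots, apply Cauchy–Schwarz in each row,
then exchange the sums and use the column bound. -/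
lemma ennreal_young (w : ℤ → ℤ → ℝ≥0∞) (W : ℝ≥0∞) (x : ℤ → ℝ≥0∞)
    (h1 : ∀ k, ∑' j, w k j ≤ W) (h2 : ∀ j, ∑' k, w k j ≤ W) :
    ∑' k, (∑' j, w k j * x j) ^ 2 ≤ W ^ 2 * ∑' j, x j ^ 2 := by
  have cs : ∀ k, (∑' j, w k j * x j) ^ 2 ≤ W * ∑' j, w k j * x j ^ 2 := by
    intro k
    have h := ENNReal.lintegral_mul_le_Lp_mul_Lq (μ := Measure.count (α := ℤ)) (p := 2) (q := 2)
      (by constructor <;> norm_num) (f := fun j => w k j ^ (1 / 2 : ℝ))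
      (g := fun j => w k j ^ (1 / 2 : ℝ) * x j) (by fun_prop) (by fun_prop)
    simp only [lintegral_count, Pi.mul_apply] at h
    have e1 : ∀ t : ℝ≥0∞, t ^ (1 / 2 : ℝ) * t ^ (1 / 2 : ℝ) = t := fun t => by
      rw [← ENNReal.rpow_add_of_nonneg _ _ (by norm_num) (by norm_num)]; norm_num
    have e2 : ∀ t : ℝ≥0∞, (t ^ (1 / 2 : ℝ)) ^ 2 = t := fun t => by rw [sq, e1]
    have e3 : ∀ t : ℝ≥0∞, t ^ (2 : ℝ) = t ^ 2 := fun t => by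
      rw [← ENNReal.rpow_natCast]; norm_num
    simp only [← mul_assoc, e1, e3, mul_pow, e2] at h
    calc (∑' j, w k j * x j) ^ 2
        ≤ ((∑' j, w k j) ^ (1 / 2 : ℝ) * (∑' j, w k j * x j ^ 2) ^ (1 / 2 : ℝ)) ^ 2 := by gcongr
      _ = (∑' j, w k j) * ∑' j, w k j * x j ^ 2 := by rw [mul_pow, e2, e2]
      _ ≤ _ := by gcongr; exact h1 k
  calc ∑' k, (∑' j, w k j * x j) ^ 2 ≤ ∑' k, W * ∑' j, w k j * x j ^ 2 :=
        ENNReal.tsum_le_tsum cs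
    _ = W * ∑' j, (∑' k, w k j) * x j ^ 2 := by
        rw [ENNReal.tsum_mul_left, ENNReal.tsum_comm]
        simp only [ENNReal.tsum_mul_right]
    _ ≤ W * ∑' j, W * x j ^ 2 := by
        gcongr with j; exact h2 j
    _ = _ := by rw [ENNReal.tsum_mul_left, ← mul_assoc, sq]

end

section

/-! ### Mapping properties of matrices between Sobolev spaces -/

lemma ofReal_jap_rpow_half_sq (k : ℤ) (σ : ℝ) :
    ENNReal.ofReal (jap k ^ (σ / 2)) ^ 2 = ENNReal.ofReal (jap k ^ σ) := by
  rw [← ENNReal.ofReal_pow (jap_rpow_nonneg _ _), jap_rpow_sq]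

/-- A matrix of order `2p` maps `H^{σ+2p}(𝕋)` to `H^σ(𝕋)`, with absolutely convergent series. -/
lemma IsOrd.abs_kapp_le {p : ℝ} {K : ℤ → ℤ → ℂ} (hK : IsOrd p K) (σ : ℝ) :
    ∃ C : ℝ≥0, ∀ u : ℤ → ℂ, ENNReal.ofReal (2 * Real.pi) *
      ∑' k : ℤ, ENNReal.ofReal (jap k ^ σ) * (∑' j, ‖K k j‖ₑ * ‖u j‖ₑ) ^ 2 ≤
        C * sobNormSq (σ + 2 * p) u := by
  obtain ⟨C, hC, hb⟩ := (hK.left_mul (c := 1) (p := σ / 2)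
    (K := fun k j => (jap k ^ (σ / 2) : ℝ) * K k j) zero_le_one (fun k j => by
      rw [norm_mul, one_mul, Complex.norm_real, Real.norm_of_nonneg (jap_rpow_nonneg _ _)])) 1
  set W : ℝ≥0∞ := ENNReal.ofReal (C * japSum) with hW
  refine ⟨(C * japSum).toNNReal ^ 2, fun u => ?_⟩
  set w : ℤ → ℤ → ℝ≥0∞ := fun k j => ENNReal.ofReal (C * jap (k - j) ^ (-1 : ℝ)) with hw
  set x : ℤ → ℝ≥0∞ := fun j => ENNReal.ofReal (jap j ^ ((σ + 2 * p) / 2)) * ‖u j‖ₑ with hx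
  have hw1 : ∀ k, ∑' j, w k j ≤ W := fun k => by
    rw [hw, ← ENNReal.ofReal_tsum_of_nonneg
      (fun j => mul_nonneg hC (jap_rpow_nonneg _ _)) ((summable_jap_inv_sub k).mul_left _),
      tsum_mul_left, tsum_jap_inv_sub]
  have hw2 : ∀ j, ∑' k, w k j ≤ W := fun j => by
    have : ∀ k, w k j = w j k := fun k => by simp only [hw]; rw [jap_sub_comm]
    simp only [this]; exact hw1 j
  have hy := ennreal_young w W x hw1 hw2
  have hterm : ∀ k, ENNReal.ofReal (jap k ^ σ) * (∑' j, ‖K k j‖ₑ * ‖u j‖ₑ) ^ 2 ≤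
      (∑' j, w k j * x j) ^ 2 := by
    intro k
    rw [← ofReal_jap_rpow_half_sq, ← mul_pow, ← ENNReal.tsum_mul_left]
    refine pow_le_pow_left₀ zero_le (ENNReal.tsum_le_tsum fun j => ?_) 2
    rw [← mul_assoc, hx, ← mul_assoc]
    gcongr ?_ * _
    have h := hb k j
    rw [norm_mul, Complex.norm_real, Real.norm_of_nonneg (jap_rpow_nonneg _ _)] at h
    rw [← ofReal_norm, ← ENNReal.ofReal_mul (jap_rpow_nonneg _ _), hw,
      ← ENNReal.ofReal_mul (mul_nonneg hC (jap_rpow_nonneg _ _))]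
    apply ENNReal.ofReal_le_ofReal
    rw [show (σ + 2 * p) / 2 = σ / 2 + p by ring]
    exact h.trans (le_of_eq (by ring))
  calc _ ≤ ENNReal.ofReal (2 * Real.pi) * (W ^ 2 * ∑' j, x j ^ 2) := by
        gcongr
        exact (ENNReal.tsum_le_tsum hterm).trans hy
    _ = W ^ 2 * sobNormSq (σ + 2 * p) u := by
        rw [sobNormSq_eq]
        simp only [hx, mul_pow, ofReal_jap_rpow_half_sq]
        ring
    _ = _ := by rw [hW, ENNReal.coe_pow, ENNReal.ofReal]

lemma enorm_kapp_le (K : ℤ → ℤ → ℂ) (u : ℤ → ℂ) (k : ℤ) :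
    ‖kapp K u k‖ₑ ≤ ∑' j, ‖K k j‖ₑ * ‖u j‖ₑ := by
  refine enorm_tsum_le_tsum_enorm.trans (le_of_eq ?_)
  simp only [enorm_mul]

lemma IsOrd.sobNormSq_kapp_le {p : ℝ} {K : ℤ → ℤ → ℂ} (hK : IsOrd p K) (σ : ℝ) :
    ∃ C : ℝ≥0, ∀ u : ℤ → ℂ, sobNormSq σ (kapp K u) ≤ C * sobNormSq (σ + 2 * p) u := by
  obtain ⟨C, hC⟩ := hK.abs_kapp_le σ
  refine ⟨C, fun u => le_trans ?_ (hC u)⟩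
  rw [sobNormSq_eq]
  gcongr with k
  exact enorm_kapp_le K u k

lemma two_pi_ofReal_ne_zero : ENNReal.ofReal (2 * Real.pi) ≠ 0 := by
  simpa using Real.pi_pos

lemma one_le_two_pi_ofReal : 1 ≤ ENNReal.ofReal (2 * Real.pi) := by
  rw [ENNReal.one_le_ofReal]; linarith [Real.pi_gt_three]

lemma coeff_sq_le_sobNormSq (σ : ℝ) (u : ℤ → ℂ) (k : ℤ) :
    ENNReal.ofReal (jap k ^ σ) * ‖u k‖ₑ ^ 2 ≤ sobNormSq σ u := by
  rw [sobNormSq_eq]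
  refine le_trans ?_ (le_mul_of_one_le_left zero_le one_le_two_pi_ofReal)
  exact ENNReal.le_tsum (f := fun k => ENNReal.ofReal (jap k ^ σ) * ‖u k‖ₑ ^ 2) k

lemma enorm_sq_le_sobNormSq (σ : ℝ) (u : ℤ → ℂ) (k : ℤ) :
    ‖u k‖ₑ ^ 2 ≤ ENNReal.ofReal (jap k ^ (-σ)) * sobNormSq σ u := by
  calc ‖u k‖ₑ ^ 2 = ENNReal.ofReal (jap k ^ (-σ)) * (ENNReal.ofReal (jap k ^ σ) * ‖u k‖ₑ ^ 2) := by
        rw [← mul_assoc, ← ENNReal.ofReal_mul (jap_rpow_nonneg _ _), ← jap_rpow_add]; simp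
    _ ≤ _ := by gcongr; exact coeff_sq_le_sobNormSq σ u k

lemma IsOrd.summable_kapp {p r : ℝ} {K : ℤ → ℤ → ℂ} (hK : IsOrd p K) {u : ℤ → ℂ}
    (hu : sobNormSq r u < ⊤) (k : ℤ) : Summable (fun j => ‖K k j‖ * ‖u j‖) := by
  obtain ⟨C, hC⟩ := hK.abs_kapp_le (r - 2 * p)
  have h := hC u
  rw [sub_add_cancel] at h
  have h1 : ENNReal.ofReal (2 * Real.pi) *
      ∑' k : ℤ, ENNReal.ofReal (jap k ^ (r - 2 * p)) * (∑' j, ‖K k j‖ₑ * ‖u j‖ₑ) ^ 2 ≠ ⊤ :=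
    (lt_of_le_of_lt h (ENNReal.mul_lt_top ENNReal.coe_lt_top hu)).ne
  have h2 := ENNReal.ne_top_of_tsum_ne_top
    (fun h' => h1 (by rw [h', ENNReal.mul_top two_pi_ofReal_ne_zero])) k
  have h3 : (∑' j, ‖K k j‖ₑ * ‖u j‖ₑ) ≠ ⊤ := by
    intro h'
    apply h2
    rw [h', ENNReal.top_pow two_ne_zero, ENNReal.mul_top]
    simpa using jap_rpow_pos k _
  have h4 := ENNReal.summable_toReal h3
  simpa using h4

lemma IsOrd.summable_kapp' {p r : ℝ} {K : ℤ → ℤ → ℂ} (hK : IsOrd p K) {u : ℤ → ℂ}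
    (hu : sobNormSq r u < ⊤) (k : ℤ) : Summable (fun j => K k j * u j) :=
  Summable.of_norm (by simpa only [norm_mul] using hK.summable_kapp hu k)

/-- Fubini. The double series converges absolutely because the product of the matrices of absolute
values is again of order `p + q`. -/
lemma IsOrd.kapp_kapp {p q r : ℝ} {K L : ℤ → ℤ → ℂ} (hK : IsOrd p K) (hL : IsOrd q L)
    {u : ℤ → ℂ} (hu : sobNormSq r u < ⊤) :
    kapp K (kapp L u) = kapp (fun k j => ∑' m, K k m * L m j) u := by
  funext k
  unfold kapp
  have habs : IsOrd (p + q) (fun k j => ∑' m, ((‖K k m‖ * ‖L m j‖ : ℝ) : ℂ)) :=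
    hK.tsum_of_le hL fun k m j => by
      rw [Complex.norm_real, Real.norm_of_nonneg (by positivity)]
  have hs := habs.summable_kapp hu k
  have hsum : Summable (fun x : ℤ × ℤ => K k x.2 * L x.2 x.1 * u x.1) := by
    apply Summable.of_norm
    rw [summable_prod_of_nonneg (fun _ => norm_nonneg _)]
    simp only [norm_mul]
    refine ⟨fun j => (hK.summable_comp hL k j).mul_right _, ?_⟩
    simp only [tsum_mul_right]
    refine hs.congr fun j => ?_
    rw [← Complex.ofReal_tsum, Complex.norm_real, Real.norm_of_nonneg]
    exact tsum_nonneg fun _ => by positivity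
  have h1 := hsum.tsum_comm (f := fun j m => K k m * L m j * u j)
  simp only [← tsum_mul_right]
  rw [← h1]
  refine tsum_congr fun m => ?_
  rw [← tsum_mul_left]
  exact tsum_congr fun j => by ring

/-! ### Elementary properties of the Sobolev norms -/

lemma sobNormSq_add_le (σ : ℝ) (u v : ℤ → ℂ) :
    sobNormSq σ (u + v) ≤ 2 * sobNormSq σ u + 2 * sobNormSq σ v := by
  have key : ∀ k, ‖(u + v) k‖ₑ ^ 2 ≤ 2 * ‖u k‖ₑ ^ 2 + 2 * ‖v k‖ₑ ^ 2 := fun k => by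
    have h : ‖u k + v k‖ ^ 2 ≤ 2 * ‖u k‖ ^ 2 + 2 * ‖v k‖ ^ 2 := by
      have := norm_add_le (u k) (v k)
      nlinarith [norm_nonneg (u k + v k), sq_nonneg (‖u k‖ - ‖v k‖)]
    have h2 := ENNReal.ofReal_le_ofReal h
    rwa [ENNReal.ofReal_add (by positivity) (by positivity), ENNReal.ofReal_mul two_pos.le,
      ENNReal.ofReal_mul two_pos.le, ENNReal.ofReal_pow (norm_nonneg _),
      ENNReal.ofReal_pow (norm_nonneg _), ENNReal.ofReal_pow (norm_nonneg _), ofReal_norm,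
      ofReal_norm, ofReal_norm, ENNReal.ofReal_ofNat] at h2
  rw [sobNormSq_eq, sobNormSq_eq, sobNormSq_eq]
  calc _ ≤ ENNReal.ofReal (2 * Real.pi) * ∑' k, (2 * (ENNReal.ofReal (jap k ^ σ) * ‖u k‖ₑ ^ 2) +
        2 * (ENNReal.ofReal (jap k ^ σ) * ‖v k‖ₑ ^ 2)) := by
        gcongr with k
        calc _ ≤ ENNReal.ofReal (jap k ^ σ) * (2 * ‖u k‖ₑ ^ 2 + 2 * ‖v k‖ₑ ^ 2) := by
              gcongr; exact key k
          _ = _ := by ring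
    _ = _ := by
      rw [ENNReal.tsum_add, ENNReal.tsum_mul_left, ENNReal.tsum_mul_left]; ring

lemma sobNormSq_congr {σ : ℝ} {u v : ℤ → ℂ} (h : ∀ k, ‖u k‖ = ‖v k‖) :
    sobNormSq σ u = sobNormSq σ v := by
  rw [sobNormSq_eq, sobNormSq_eq]
  simp only [← ofReal_norm, h]

lemma sobNormSq_neg (σ : ℝ) (u : ℤ → ℂ) : sobNormSq σ (-u) = sobNormSq σ u :=
  sobNormSq_congr fun k => by simp

lemma sobNormSq_sub_comm (σ : ℝ) (u v : ℤ → ℂ) : sobNormSq σ (u - v) = sobNormSq σ (v - u) :=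
  sobNormSq_congr fun k => by simp [norm_sub_rev]

lemma sobNormSq_sub_le (σ : ℝ) (u v : ℤ → ℂ) :
    sobNormSq σ (u - v) ≤ 2 * sobNormSq σ u + 2 * sobNormSq σ v := by
  rw [sub_eq_add_neg]
  simpa only [sobNormSq_neg] using sobNormSq_add_le σ u (-v)

lemma sobNormSq_le_of_norm_le {σ : ℝ} {u v : ℤ → ℂ} (h : ∀ k, ‖u k‖ ≤ ‖v k‖) :
    sobNormSq σ u ≤ sobNormSq σ v := by
  rw [sobNormSq_eq, sobNormSq_eq]
  gcongr with k
  exact enorm_le_iff_norm_le.2 (h k)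

lemma sobNormSq_mono {σ τ : ℝ} (h : σ ≤ τ) (u : ℤ → ℂ) : sobNormSq σ u ≤ sobNormSq τ u := by
  rw [sobNormSq_eq, sobNormSq_eq]
  gcongr with k
  exact one_le_jap k

lemma sobNormSq_zero (σ : ℝ) : sobNormSq σ 0 = 0 := by
  simp [sobNormSq_eq]

lemma sobNormSq_finite {I : Finset ℤ} {u : ℤ → ℂ} (hu : ∀ k ∉ I, u k = 0) (σ : ℝ) :
    sobNormSq σ u = ENNReal.ofReal (2 * Real.pi * nsq σ I u) := by
  rw [sobNormSq_eq, ENNReal.ofReal_mul (p := 2 * Real.pi) (by positivity), nsq, ENNReal.ofReal_sum_of_nonneg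
    (fun k _ => mul_nonneg (jap_rpow_nonneg _ _) (sq_nonneg _)), tsum_eq_sum (s := I)
    (fun k hk => by simp [hu k hk])]
  congr 1
  refine Finset.sum_congr rfl fun k _ => ?_
  rw [ENNReal.ofReal_mul (jap_rpow_nonneg _ _), ENNReal.ofReal_pow (norm_nonneg _),
    ofReal_norm]

lemma sobNormSq_finite_lt_top {I : Finset ℤ} {u : ℤ → ℂ} (hu : ∀ k ∉ I, u k = 0) (σ : ℝ) :
    sobNormSq σ u < ⊤ := by
  rw [sobNormSq_finite hu]; exact ENNReal.ofReal_lt_top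

lemma sobNorm_sq (σ : ℝ) (u : ℤ → ℂ) : sobNorm σ u ^ 2 = sobNormSq σ u := by
  rw [sobNorm, ← ENNReal.rpow_natCast, ← ENNReal.rpow_mul]; norm_num

/-- The truncation `(1 - Π_N) u` gains derivatives. -/
lemma sobNormSq_tail_le {N : ℕ} (hN : 0 < N) (σ : ℝ) {u v : ℤ → ℂ}
    (h1 : ∀ k : ℤ, |k| ≤ N → u k = 0) (h2 : ∀ k, ‖u k‖ ≤ ‖v k‖) :
    sobNormSq σ u ≤ ENNReal.ofReal (1 / N) * sobNormSq (σ + 1) v := by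
  rw [sobNormSq_eq, sobNormSq_eq, mul_left_comm]
  refine mul_le_mul_right ?_ _
  rw [← ENNReal.tsum_mul_left]
  refine ENNReal.tsum_le_tsum fun k => ?_
  by_cases hk : |k| ≤ N
  · simp [h1 k hk]
  · rw [← mul_assoc, ← ENNReal.ofReal_mul (by positivity)]
    gcongr
    · rw [jap_rpow_add, Real.rpow_one]
      have h3 : (N : ℝ) ≤ jap k := by
        have : (N : ℝ) ≤ |(k : ℝ)| := by
          rw [← Int.cast_abs]; exact_mod_cast (not_le.1 hk).le
        exact this.trans (abs_le_jap k)
      have hN' : (0 : ℝ) < N := by exact_mod_cast hN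
      have h4 := jap_rpow_nonneg k σ
      calc jap k ^ σ = 1 / N * (jap k ^ σ * N) := by field_simp
        _ ≤ _ := by gcongr
    · exact enorm_le_iff_norm_le.2 (h2 k)

end

section

/-! ### The operators of the equation as matrices -/

/-- The matrix of `G`. -/
noncomputable def gKer (α : ℤ → ℂ) (k j : ℤ) : ℂ :=
  α (k - j) - 2 * Real.pi * (α k * α (-j))

/-- The matrix of `DG`. -/
noncomputable def dgKer (α : ℤ → ℂ) (k j : ℤ) : ℂ := ((|k| : ℤ) : ℂ) * gKer α k j

/-- The matrix of `GDG`. -/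
noncomputable def sKer (α : ℤ → ℂ) (k j : ℤ) : ℂ := ∑' m, gKer α k m * dgKer α m j

/-- The matrix of `H∂ₓ² + GDG`. -/
noncomputable def aKer (α : ℤ → ℂ) (k j : ℤ) : ℂ :=
  (if k = j then Complex.I * (k * (|k| : ℤ)) else 0) + sKer α k j

lemma Rapid.neg {α : ℤ → ℂ} (hα : Rapid α) : Rapid (fun k => α (-k)) := by
  intro M
  obtain ⟨C, hC, h⟩ := hα M
  exact ⟨C, hC, fun k => by simpa [jap_neg] using h (-k)⟩

lemma norm_absCast (k : ℤ) : ‖((|k| : ℤ) : ℂ)‖ = |(k : ℝ)| := by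
  rw [Complex.norm_intCast]; simp

/-- G is multiplication by a smooth function, a Toeplitz matrix, minus a smoothing rank-one
operator. -/
lemma isOrd_gKer {α : ℤ → ℂ} (hα : Rapid α) : IsOrd 0 (gKer α) :=
  (IsOrd.toeplitz hα).sub ((isOrd_rankOne hα hα.neg 0).const_mul (2 * Real.pi))

lemma isOrd_abs_mul {K : ℤ → ℤ → ℂ} {p : ℝ} (hK : IsOrd p K) :
    IsOrd (1 / 2 + p) (fun k j => ((|k| : ℤ) : ℂ) * K k j) :=
  hK.left_mul zero_le_one fun k j => by
    rw [norm_mul, norm_absCast, one_mul]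
    gcongr
    exact abs_le_jap_half k

lemma isOrd_dgKer {α : ℤ → ℂ} (hα : Rapid α) : IsOrd (1 / 2) (dgKer α) := by
  simpa using! isOrd_abs_mul (isOrd_gKer hα)

lemma isOrd_sKer {α : ℤ → ℂ} (hα : Rapid α) : IsOrd (1 / 2) (sKer α) := by
  simpa using! (isOrd_gKer hα).comp (isOrd_dgKer hα)

lemma isOrd_aKer {α : ℤ → ℂ} (hα : Rapid α) : IsOrd 1 (aKer α) := by
  refine IsOrd.add (isOrd_diag zero_le_one fun k => ?_) ((isOrd_sKer hα).mono (by norm_num))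
  rw [norm_mul, norm_mul, Complex.norm_I, norm_absCast, Complex.norm_intCast, one_mul, one_mul,
    Real.rpow_one, jap]
  nlinarith [sq_abs (k : ℝ)]

variable {a : ℝ → ℝ} {r : ℝ} {u : ℤ → ℂ}

lemma opG_eq_kapp (hα : Rapid (coeff a)) (hu : sobNormSq r u < ⊤) :
    opG a u = kapp (gKer (coeff a)) u := by
  funext k
  have h1 := (IsOrd.toeplitz hα).summable_kapp' hu k
  have h2 := (isOrd_rankOne hα hα.neg 0).summable_kapp' hu k
  simp only [opG, mulBy, kapp, gKer, sub_mul, zero_sub]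
  have h3 := (h2.mul_left (2 * Real.pi : ℂ))
  rw [Summable.tsum_sub h1 (h3.congr fun j => by ring)]
  congr 1
  rw [mul_right_comm, ← tsum_mul_left]
  exact tsum_congr fun j => by ring

lemma absD_opG_eq_kapp (hα : Rapid (coeff a)) (hu : sobNormSq r u < ⊤) :
    absD (opG a u) = kapp (dgKer (coeff a)) u := by
  funext k
  rw [opG_eq_kapp hα hu, absD, kapp, kapp, ← tsum_mul_left]
  exact tsum_congr fun j => by rw [dgKer, mul_assoc]

lemma opGDG_eq_kapp (hα : Rapid (coeff a)) (hu : sobNormSq r u < ⊤) :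
    opG a (absD (opG a u)) = kapp (sKer (coeff a)) u := by
  rw [absD_opG_eq_kapp hα hu]
  obtain ⟨C, hC⟩ := (isOrd_dgKer hα).sobNormSq_kapp_le (r - 1)
  have hlt : sobNormSq (r - 1) (kapp (dgKer (coeff a)) u) < ⊤ :=
    (hC u).trans_lt (ENNReal.mul_lt_top ENNReal.coe_lt_top (by simpa using hu))
  rw [opG_eq_kapp hα hlt, (isOrd_gKer hα).kapp_kapp (isOrd_dgKer hα) hu]
  rfl

lemma hilbert_deriv1_deriv1 (u : ℤ → ℂ) (k : ℤ) :
    hilbert (deriv1 (deriv1 u)) k = Complex.I * (k * (|k| : ℤ)) * u k := by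
  have h : ((|k| : ℤ) : ℂ) = (k.sign : ℂ) * k := by
    rw [← Int.sign_mul_self_eq_abs]; push_cast; ring
  rw [hilbert, deriv1, deriv1, h]
  linear_combination (-Complex.I * k.sign * (k : ℂ) ^ 2 * u k) * Complex.I_sq

lemma generator_eq_kapp (hα : Rapid (coeff a)) (hu : sobNormSq r u < ⊤) (k : ℤ) :
    hilbert (deriv1 (deriv1 u)) k + opG a (absD (opG a u)) k = kapp (aKer (coeff a)) u k := by
  have h : Summable fun j => (if k = j then Complex.I * (k * (|k| : ℤ)) else 0) * u j :=
    summable_of_ne_finset_zero (s := {k}) fun j hj => by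
      rw [if_neg (by simpa [eq_comm] using hj), zero_mul]
  simp only [kapp, aKer, add_mul]
  rw [h.tsum_add ((isOrd_sKer hα).summable_kapp' hu k), opGDG_eq_kapp hα hu,
    hilbert_deriv1_deriv1, tsum_eq_single k]
  · simp [kapp]
  · intro j hj
    rw [if_neg (Ne.symm hj), zero_mul]

lemma kapp_eq_fapp (K : ℤ → ℤ → ℂ) {I : Finset ℤ} (hu : ∀ k ∉ I, u k = 0) :
    kapp K u = fapp K I u := by
  funext k
  exact tsum_eq_sum fun j hj => by rw [hu j hj, mul_zero]

/-! ### Symmetry and positivity -/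

/-- The coefficients of a real-valued function. -/
def Herm (α : ℤ → ℂ) : Prop := ∀ k, α (-k) = conj (α k)

variable {α : ℤ → ℂ}

/-- Self-adjointness of G, which comes from a being real and from the rank-one part being symmetric.
-/
lemma gKer_conj (hα : Herm α) (k j : ℤ) : conj (gKer α k j) = gKer α j k := by
  have e : ∀ k, conj (α k) = α (-k) := fun k => (hα k).symm
  simp only [gKer, map_sub, map_mul, e, map_ofNat, Complex.conj_ofReal, neg_neg, neg_sub]
  ring

lemma sKer_summable (hα : Rapid α) (k j : ℤ) :
    Summable (fun m => gKer α k m * dgKer α m j) :=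
  Summable.of_norm (by simpa only [norm_mul] using (isOrd_gKer hα).summable_comp (isOrd_dgKer hα) k j)

lemma sKer_conj (hα : Herm α) (k j : ℤ) : conj (sKer α k j) = sKer α j k := by
  rw [sKer, Complex.conj_tsum]
  refine tsum_congr fun m => ?_
  simp only [dgKer, map_mul, gKer_conj hα, map_intCast]
  ring

/-- With G self-adjoint, the form of GDG at a finitely supported `y` is the sum of |m| |(Gy)_m|²
over all modes m, also those outside `I`. -/
lemma qform_sKer_nonneg (hr : Rapid α) (hα : Herm α) (I : Finset ℤ) (y : ℤ → ℂ) :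
    0 ≤ (qform (sKer α) I y y).re := by
  have h : qform (sKer α) I y y =
      ∑' m : ℤ, ((|(m : ℝ)| * ‖fapp (gKer α) I y m‖ ^ 2 : ℝ) : ℂ) := by
    have h1 : ∀ m : ℤ, ((|(m : ℝ)| * ‖fapp (gKer α) I y m‖ ^ 2 : ℝ) : ℂ) =
        ∑ k ∈ I, ∑ j ∈ I, gKer α k m * dgKer α m j * y j * conj (y k) := fun m => by
      have e : ((‖fapp (gKer α) I y m‖ ^ 2 : ℝ) : ℂ) =
          conj (fapp (gKer α) I y m) * fapp (gKer α) I y m := by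
        rw [Complex.conj_mul']; push_cast; rfl
      rw [Complex.ofReal_mul, e, fapp, map_sum, Finset.sum_mul_sum, Finset.mul_sum]
      refine Finset.sum_congr rfl fun k _ => ?_
      rw [Finset.mul_sum]
      refine Finset.sum_congr rfl fun j _ => ?_
      rw [map_mul, gKer_conj hα, dgKer, ← Int.cast_abs, Complex.ofReal_intCast]
      ring
    simp only [h1]
    rw [Summable.tsum_finsetSum fun k _ => summable_sum fun j _ =>
      ((sKer_summable hr k j).mul_right _).mul_right _, qform]
    refine Finset.sum_congr rfl fun k _ => ?_
    rw [Summable.tsum_finsetSum fun j _ => ((sKer_summable hr k j).mul_right _).mul_right _]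
    refine Finset.sum_congr rfl fun j _ => ?_
    rw [tsum_mul_right, tsum_mul_right, sKer]
  rw [h, ← Complex.ofReal_tsum, Complex.ofReal_re]
  exact tsum_nonneg fun m => by positivity

end

section

/-! ### The weight whose derivative is `a² / μ - 1` -/

/-- The coefficients of the square. -/
noncomputable def conv (α : ℤ → ℂ) (k : ℤ) : ℂ := ∑' m, α (k - m) * α m

/-- The mean value `μ` of the square. -/
noncomputable def meanSq (α : ℤ → ℂ) : ℝ := ∑' m, ‖α m‖ ^ 2

/-- The coefficients of a periodic function `b` with `b' = a² / μ - 1`. -/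
noncomputable def wt (α : ℤ → ℂ) (k : ℤ) : ℂ := conv α k / (meanSq α * (Complex.I * k))

variable {α : ℤ → ℂ}

lemma conv_sub (α : ℤ → ℂ) (k j : ℤ) : conv α (k - j) = ∑' m, α (k - m) * α (m - j) := by
  rw [conv, ← (Equiv.subRight j).tsum_eq]
  exact tsum_congr fun m => by simp

lemma Rapid.conv (hα : Rapid α) : Rapid (conv α) := by
  intro M
  obtain ⟨C, hC, h⟩ := (IsOrd.toeplitz hα).comp (IsOrd.toeplitz hα) M
  refine ⟨C, hC, fun k => ?_⟩
  simpa [BenjaminOno.conv, jap] using h k 0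

lemma Herm.conv (hα : Herm α) : Herm (conv α) := by
  intro k
  rw [BenjaminOno.conv, BenjaminOno.conv, Complex.conj_tsum, ← (Equiv.neg ℤ).tsum_eq]
  refine tsum_congr fun m => ?_
  rw [map_mul, ← hα, ← hα]
  simp only [Equiv.neg_apply, neg_sub]
  ring_nf

lemma conv_zero (hα : Herm α) : conv α 0 = meanSq α := by
  rw [conv, meanSq, Complex.ofReal_tsum]
  refine tsum_congr fun m => ?_
  rw [zero_sub, hα, Complex.conj_mul']
  push_cast; rfl

lemma meanSq_pos (hr : Rapid α) (h0 : α 0 ≠ 0) : 0 < meanSq α := by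
  have hs : Summable fun m => ‖α m‖ ^ 2 := by
    have h := ((IsOrd.toeplitz hr).summable_comp (IsOrd.toeplitz hr.neg) 0 0)
    refine (Equiv.summable_iff (f := fun m => ‖α m‖ ^ 2) (Equiv.neg ℤ)).1 (h.congr fun m => ?_)
    simp [sq]
  exact hs.tsum_pos (fun _ => by positivity) 0 (by positivity)

lemma Rapid.wt (hr : Rapid α) : Rapid (wt α) := by
  intro M
  obtain ⟨C, hC, h⟩ := hr.conv M
  refine ⟨|meanSq α|⁻¹ * C, by positivity, fun k => ?_⟩
  -- Division by zero gives the coefficient 0 here, so b is the primitive of mean zero.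
  by_cases hk : k = 0
  · subst hk
    simp only [BenjaminOno.wt, Int.cast_zero, mul_zero, div_zero, norm_zero]
    have := jap_rpow_nonneg 0 (-M)
    positivity
  · have h1 : (1 : ℝ) ≤ |(k : ℝ)| := by
      rw [← Int.cast_abs]; exact_mod_cast Int.one_le_abs hk
    rw [BenjaminOno.wt, norm_div, norm_mul, norm_mul, Complex.norm_I, one_mul, Complex.norm_intCast,
      Complex.norm_real, Real.norm_eq_abs, div_eq_mul_inv, mul_inv]
    calc ‖BenjaminOno.conv α k‖ * (|meanSq α|⁻¹ * |(k : ℝ)|⁻¹)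
        ≤ (C * jap k ^ (-M)) * (|meanSq α|⁻¹ * 1) := by
          gcongr
          · exact mul_nonneg hC (jap_rpow_nonneg _ _)
          · exact h k
          · exact inv_le_one_of_one_le₀ h1
      _ = _ := by ring

lemma Herm.wt (hα : Herm α) : Herm (wt α) := by
  intro k
  simp only [BenjaminOno.wt, map_div₀, map_mul, Complex.conj_ofReal, Complex.conj_I, map_intCast,
    hα.conv k]
  push_cast
  ring

/-- The identity b' = a²/μ - 1. At frequency 0 both sides vanish because μ is the mean of a². -/
lemma I_mul_wt (hα : Herm α) (hμ : 0 < meanSq α) (k : ℤ) :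
    Complex.I * k * wt α k = conv α k / meanSq α - if k = 0 then 1 else 0 := by
  have hμ' : (meanSq α : ℂ) ≠ 0 := by exact_mod_cast hμ.ne'
  by_cases hk : k = 0
  · subst hk
    simp [conv_zero hα, hμ']
  · have : (k : ℂ) ≠ 0 := by exact_mod_cast hk
    simp only [wt, hk, if_false, sub_zero]
    field_simp

/-! ### The commutator with the dispersive term -/

/-- The root is the geometric mean of |k| and |j|, and each of these lies within |k - m| + |m - j|
of |m|. This allows D in the middle of aDa to be split symmetrically onto both sides. -/
lemma abs_sub_sqrt_le (k m j : ℝ) : |(|m| - √(|k| * |j|))| ≤ |k - m| + |m - j| := by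
  have h1 : |k| ≤ |m| + |k - m| := by
    have := abs_add_le m (k - m); simpa using this
  have h2 : |m| ≤ |k| + |k - m| := by
    have := abs_sub_abs_le_abs_sub m k; rw [abs_sub_comm] at this; linarith
  have h3 : |j| ≤ |m| + |m - j| := by
    have := abs_sub_abs_le_abs_sub j m; rw [abs_sub_comm] at this; linarith
  have h4 : |m| ≤ |j| + |m - j| := by
    have := abs_sub_abs_le_abs_sub m j; linarith
  have hk := abs_nonneg k
  have hj := abs_nonneg j
  have hm := abs_nonneg m
  have a1 := abs_nonneg (k - m)
  have a2 := abs_nonneg (m - j)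
  rw [abs_le]
  constructor
  · have : √(|k| * |j|) ≤ |m| + |k - m| + |m - j| := by
      apply Real.sqrt_le_iff.2 ⟨by positivity, ?_⟩
      rw [sq]; gcongr <;> linarith
    linarith
  · rcases le_total (|m|) (|k - m| + |m - j|) with h | h
    · have := Real.sqrt_nonneg (|k| * |j|); linarith
    · have : |m| - (|k - m| + |m - j|) ≤ √(|k| * |j|) := by
        apply Real.le_sqrt_of_sq_le
        rw [sq]; gcongr <;> linarith
      linarith

/-- The derivative 2|ξ| of ξ|ξ| is evaluated at a geometric mean. For x = p², y = q² the left side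
is |p² - q²|(p - q)², and (p - q)² ≤ |p² - q²|; for opposite signs both |x| and |y| are at most |x -
y|. The quadratic error is harmless against rapidly decaying coefficients. -/
lemma abs_dispersion_sub_le (x y : ℝ) :
    |x * |x| - y * |y| - 2 * (x - y) * √(|x| * |y|)| ≤ (x - y) ^ 2 := by
  rw [Real.sqrt_mul (abs_nonneg x)]
  obtain ⟨p, hx0, hx, hp⟩ : ∃ p, 0 ≤ p ∧ p ^ 2 = |x| ∧ √|x| = p :=
    ⟨_, Real.sqrt_nonneg _, Real.sq_sqrt (abs_nonneg x), rfl⟩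
  obtain ⟨q, hy0, hy, hq⟩ : ∃ q, 0 ≤ q ∧ q ^ 2 = |y| ∧ √|y| = q :=
    ⟨_, Real.sqrt_nonneg _, Real.sq_sqrt (abs_nonneg y), rfl⟩
  rw [hp, hq]
  clear hp hq
  rw [abs_le]
  rcases abs_cases x with ⟨h1, h1'⟩ | ⟨h1, h1'⟩ <;> rcases abs_cases y with ⟨h2, h2'⟩ | ⟨h2, h2'⟩ <;>
    rw [h1] at hx ⊢ <;> rw [h2] at hy ⊢
  · rw [← hx, ← hy]
    constructor <;> nlinarith [mul_nonneg hx0 hy0, mul_nonneg (sq_nonneg (p - q)) (mul_nonneg hx0 hy0), mul_nonneg (sq_nonneg (p - q)) (sq_nonneg p), mul_nonneg (sq_nonneg (p - q)) (sq_nonneg q)]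
  · obtain rfl : y = -q ^ 2 := by linarith
    rw [← hx]
    constructor <;> nlinarith [mul_nonneg hx0 hy0, sq_nonneg (p - q), mul_nonneg (sq_nonneg (p - q)) (add_nonneg (sq_nonneg p) (sq_nonneg q)), sq_nonneg (p * q), mul_nonneg (mul_nonneg hx0 hy0) (add_nonneg (sq_nonneg p) (sq_nonneg q))]
  · obtain rfl : x = -p ^ 2 := by linarith
    rw [← hy]
    constructor <;> nlinarith [mul_nonneg hx0 hy0, sq_nonneg (p - q), mul_nonneg (sq_nonneg (p - q)) (add_nonneg (sq_nonneg p) (sq_nonneg q)), sq_nonneg (p * q), mul_nonneg (mul_nonneg hx0 hy0) (add_nonneg (sq_nonneg p) (sq_nonneg q))]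
  · obtain rfl : x = -p ^ 2 := by linarith
    obtain rfl : y = -q ^ 2 := by linarith
    constructor <;> nlinarith [mul_nonneg hx0 hy0, mul_nonneg (sq_nonneg (p - q)) (mul_nonneg hx0 hy0), mul_nonneg (sq_nonneg (p - q)) (sq_nonneg p), mul_nonneg (sq_nonneg (p - q)) (sq_nonneg q)]

lemma IsOrd.congr {p : ℝ} {K L : ℤ → ℤ → ℂ} (hK : IsOrd p K) (h : ∀ k j, L k j = K k j) :
    IsOrd p L := by
  have : L = K := funext₂ h
  rwa [this]

lemma isOrd_jap_toeplitz (hr : Rapid α) :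
    IsOrd 0 (fun k j => (jap (k - j) : ℂ) * α (k - j)) := by
  have := (IsOrd.toeplitz hr).of_le (p := 0) (m := 1) (c := 1)
    (K := fun k j => (jap (k - j) : ℂ) * α (k - j)) zero_le_one (fun k j => by
      rw [norm_mul, Complex.norm_real, Real.norm_of_nonneg (jap_pos _).le]; simp)
  simpa using this

/-- `GDG - D^{1/2} a² D^{1/2}` is of order `0`. -/
lemma isOrd_sKer_sub (hr : Rapid α) :
    IsOrd 0 (fun k j => sKer α k j - conv α (k - j) * (√(|(k : ℝ)| * |(j : ℝ)|) : ℝ)) := by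
  have hT := IsOrd.toeplitz hr
  have hDT : IsOrd (1 / 2) (fun m j => ((|m| : ℤ) : ℂ) * α (m - j)) := by
    simpa using! isOrd_abs_mul hT
  have hR : ∀ p, IsOrd p (fun k j => 2 * Real.pi * (α k * α (-j))) := fun p =>
    (isOrd_rankOne hr hr.neg p).const_mul (2 * Real.pi)
  -- The rank-one part is taken with exponent -1/2, so that the factor |m| brings it to 0.
  have hDR : IsOrd 0 (fun m j => ((|m| : ℤ) : ℂ) * (2 * Real.pi * (α m * α (-j)))) := by
    simpa using! isOrd_abs_mul (hR (-(1 / 2)))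
  have h1 : IsOrd 0 (fun k j => ∑' m : ℤ, α (k - m) * α (m - j) *
      ((|(m : ℝ)| - √(|(k : ℝ)| * |(j : ℝ)|) : ℝ) : ℂ)) := by
    have := (((isOrd_jap_toeplitz hr).const_mul 2).tsum_of_le (isOrd_jap_toeplitz hr)
      (F := fun k m j : ℤ => α (k - m) * α (m - j) *
        ((|(m : ℝ)| - √(|(k : ℝ)| * |(j : ℝ)|) : ℝ) : ℂ)) fun k m j => by
      have h := abs_sub_sqrt_le k m j
      have h3 := abs_le_jap (k - m)
      have h4 := abs_le_jap (m - j)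
      push_cast at h3 h4
      have h5 := one_le_jap (k - m)
      have h6 := one_le_jap (m - j)
      rw [norm_mul, norm_mul, norm_mul, norm_mul, norm_mul, Complex.norm_real, Complex.norm_real,
        Complex.norm_real, Real.norm_of_nonneg (jap_pos _).le, Real.norm_of_nonneg (jap_pos _).le,
        Real.norm_eq_abs, RCLike.norm_ofNat]
      have h7 : |(|(m : ℝ)| - √(|(k : ℝ)| * |(j : ℝ)|))| ≤ 2 * (jap (k - m) * jap (m - j)) := by
        nlinarith
      calc _ ≤ ‖α (k - m)‖ * ‖α (m - j)‖ * (2 * (jap (k - m) * jap (m - j))) := by gcongr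
        _ = _ := by ring)
    simpa using this
  have h2 : IsOrd 0 (fun k j => ∑' m, (2 * Real.pi * (α k * α (-m))) *
      (((|m| : ℤ) : ℂ) * α (m - j))) := by
    simpa using! (hR (-(1 / 2))).comp hDT
  have h3 : IsOrd 0 (fun k j => ∑' m, gKer α k m *
      (((|m| : ℤ) : ℂ) * (2 * Real.pi * (α m * α (-j))))) := by
    simpa using! (isOrd_gKer hr).comp hDR
  refine ((h1.sub h2).sub h3).congr fun k j => ?_
  have s0 : Summable fun m => α (k - m) * α (m - j) :=
    Summable.of_norm (by simpa only [norm_mul] using hT.summable_comp hT k j)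
  have s1 : Summable fun m => α (k - m) * (((|m| : ℤ) : ℂ) * α (m - j)) :=
    Summable.of_norm (by simpa only [norm_mul] using hT.summable_comp hDT k j)
  have s2 : Summable fun m => (2 * Real.pi * (α k * α (-m))) * (((|m| : ℤ) : ℂ) * α (m - j)) :=
    Summable.of_norm (by simpa only [norm_mul] using (hR 0).summable_comp hDT k j)
  have s3 : Summable fun m => gKer α k m * (((|m| : ℤ) : ℂ) * (2 * Real.pi * (α m * α (-j)))) :=
    Summable.of_norm (by simpa only [norm_mul] using (isOrd_gKer hr).summable_comp hDR k j)
  have e1 : ∀ m : ℤ, α (k - m) * α (m - j) * ((|(m : ℝ)| - √(|(k : ℝ)| * |(j : ℝ)|) : ℝ) : ℂ) =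
      α (k - m) * (((|m| : ℤ) : ℂ) * α (m - j)) -
        α (k - m) * α (m - j) * (√(|(k : ℝ)| * |(j : ℝ)|) : ℝ) := fun m => by
    rw [Complex.ofReal_sub, ← Int.cast_abs, Complex.ofReal_intCast]; ring
  simp only [e1]
  -- With G = A - R, A multiplication by a and R of rank one, this is GDG = ADA - RDA - GDR; only
  -- ADA is not of order 0.
  have e2 : sKer α k j = ∑' m, α (k - m) * (((|m| : ℤ) : ℂ) * α (m - j)) -
      ∑' m, (2 * Real.pi * (α k * α (-m))) * (((|m| : ℤ) : ℂ) * α (m - j)) -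
      ∑' m, gKer α k m * (((|m| : ℤ) : ℂ) * (2 * Real.pi * (α m * α (-j)))) := by
    rw [← Summable.tsum_sub s1 s2, ← Summable.tsum_sub (s1.sub s2) s3, sKer]
    refine tsum_congr fun m => ?_
    simp only [dgKer, gKer]
    ring
  rw [Summable.tsum_sub s1 (s0.mul_right _), tsum_mul_right, ← conv_sub, e2]
  ring

/-- The real part of `b i D|D|` is `D - μ⁻¹ GDG` up to an operator of order `0`. -/
lemma isOrd_commutator (hr : Rapid α) (hα : Herm α) (hμ : 0 < meanSq α) :
    IsOrd 0 (fun k j : ℤ => -Complex.I * wt α (k - j) * (k * (|k| : ℤ) - j * (|j| : ℤ)) -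
      2 * ((if k = j then ((|k| : ℤ) : ℂ) else 0) - (meanSq α : ℂ)⁻¹ * sKer α k j)) := by
  have hμ' : (meanSq α : ℂ) ≠ 0 := by exact_mod_cast hμ.ne'
  have h1 : IsOrd 0 (fun k j : ℤ => -Complex.I * wt α (k - j) *
      (((k * |(k : ℝ)| - j * |(j : ℝ)| - 2 * (k - j) * √(|(k : ℝ)| * |(j : ℝ)|) : ℝ)) : ℂ)) := by
    refine (isOrd_jap_toeplitz hr.wt).of_norm_le zero_le_one fun k j => ?_
    have h := abs_dispersion_sub_le k j
    have h' : ((k : ℝ) - j) ^ 2 ≤ jap (k - j) := by unfold jap; push_cast; linarith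
    rw [norm_mul, norm_mul, norm_mul, norm_neg, Complex.norm_I, one_mul, one_mul, Complex.norm_real,
      Complex.norm_real, Real.norm_of_nonneg (jap_pos _).le, Real.norm_eq_abs, mul_comm]
    gcongr
    exact h.trans h'
  refine (h1.add ((isOrd_sKer_sub hr).const_mul (2 * (meanSq α : ℂ)⁻¹))).congr fun k j => ?_
  -- The leading part -2i(k - j)b̂ times the root equals -2(a²/μ - 1)^ times the root. The 1
  -- contributes on the diagonal only, where the root is |k|, and the a² part is GDG modulo order 0.
  have hw := I_mul_wt hα hμ (k - j)
  have hd : (if k - j = 0 then (1 : ℂ) else 0) * (√(|(k : ℝ)| * |(j : ℝ)|) : ℝ) =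
      if k = j then ((|k| : ℤ) : ℂ) else 0 := by
    by_cases h : k = j
    · subst h
      simp only [sub_self, if_true, one_mul, Real.sqrt_mul_self (abs_nonneg _)]
      rw [← Int.cast_abs, Complex.ofReal_intCast]
    · simp [h, sub_eq_zero]
  rw [← hd]
  push_cast at hw ⊢
  have hc : conv α (k - j) = meanSq α * (Complex.I * (k - j) * wt α (k - j) +
      if k - j = 0 then (1 : ℂ) else 0) := by
    rw [hw]; field_simp; ring
  rw [hc]
  have ek : ∀ k : ℤ, (((|(k : ℝ)| : ℝ)) : ℂ) = ((|k| : ℤ) : ℂ) := fun k => by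
    rw [← Int.cast_abs, Complex.ofReal_intCast]
  simp only [ek]
  field_simp
  ring

/-- The Hermitian part of a form. -/
lemma qform_re_symm (K : ℤ → ℤ → ℂ) (I : Finset ℤ) (y : ℤ → ℂ) :
    (qform K I y y).re = (qform (fun k j => conj (K j k)) I y y).re := by
  rw [← Complex.conj_re]
  congr 1
  simp only [qform, map_sum, map_mul, Complex.conj_conj]
  rw [Finset.sum_comm]
  refine Finset.sum_congr rfl fun j _ => Finset.sum_congr rfl fun k _ => ?_
  ring

lemma qform_add (K L : ℤ → ℤ → ℂ) (I : Finset ℤ) (y z : ℤ → ℂ) :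
    qform (fun k j => K k j + L k j) I y z = qform K I y z + qform L I y z := by
  simp only [qform, add_mul, Finset.sum_add_distrib]

lemma qform_const_mul (c : ℂ) (K : ℤ → ℤ → ℂ) (I : Finset ℤ) (y z : ℤ → ℂ) :
    qform (fun k j => c * K k j) I y z = c * qform K I y z := by
  simp only [qform, Finset.mul_sum, mul_assoc]

lemma qform_diag (d : ℤ → ℂ) (I : Finset ℤ) (y z : ℤ → ℂ) :
    qform (fun k j => if k = j then d k else 0) I y z = ∑ k ∈ I, d k * y k * conj (z k) := by
  refine Finset.sum_congr rfl fun k hk => ?_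
  rw [Finset.sum_eq_single_of_mem k hk fun j _ hj => by simp [Ne.symm hj]]
  simp

/-- The smoothing effect of the dispersive term seen through the weight `b`. -/
lemma dispersion_form_le (hr : Rapid α) (hα : Herm α) (hμ : 0 < meanSq α) :
    ∃ C : ℝ, 0 ≤ C ∧ ∀ (I : Finset ℤ) (y : ℤ → ℂ),
      ∑ k ∈ I, |(k : ℝ)| * ‖y k‖ ^ 2 - (meanSq α)⁻¹ * (qform (sKer α) I y y).re - C * nsq 0 I y ≤
      (∑ k ∈ I, Complex.I * (k * (|k| : ℤ)) * y k *
        conj (fapp (fun k j => wt α (k - j)) I y k)).re := by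
  obtain ⟨C, hC, h⟩ := (isOrd_commutator hr hα hμ).qform_le
  refine ⟨C, hC, fun I y => ?_⟩
  have hb := h I y y
  set Z : ℤ → ℤ → ℂ := fun k j : ℤ => -Complex.I * wt α (k - j) * (k * (|k| : ℤ) - j * (|j| : ℤ)) -
      2 * ((if k = j then ((|k| : ℤ) : ℂ) else 0) - (meanSq α : ℂ)⁻¹ * sKer α k j) with hZ
  set Lk : ℤ → ℤ → ℂ := fun k j => wt α (k - j) * (Complex.I * (j * (|j| : ℤ))) with hL
  have e1 : ∑ k ∈ I, Complex.I * (k * (|k| : ℤ)) * y k *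
      conj (fapp (fun k j => wt α (k - j)) I y k) = qform Lk I y y := by
    simp only [fapp, map_sum, map_mul, Finset.mul_sum, qform]
    rw [Finset.sum_comm]
    refine Finset.sum_congr rfl fun k _ => Finset.sum_congr rfl fun j _ => ?_
    rw [← hα.wt, neg_sub, hL]
    ring
  -- Adding the adjoint doubles the real part of the form and turns b times the dispersive symbol
  -- into the commutator.
  have e2 : (fun k j => Lk k j + conj (Lk j k)) = fun k j =>
      Z k j + 2 * ((if k = j then ((|k| : ℤ) : ℂ) else 0) + (-(meanSq α : ℂ)⁻¹) * sKer α k j) := by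
    funext k j
    have : conj (wt α (j - k)) = wt α (k - j) := by rw [← hα.wt, neg_sub]
    simp only [hL, hZ, map_mul, Complex.conj_I, map_intCast, this]
    ring
  have e3 := congrArg (fun K => (qform K I y y).re) e2
  simp only [qform_add, qform_const_mul, qform_diag, Complex.add_re] at e3
  rw [← qform_re_symm] at e3
  have e4 : ∑ k ∈ I, ((|k| : ℤ) : ℂ) * y k * conj (y k) =
      ((∑ k ∈ I, |(k : ℝ)| * ‖y k‖ ^ 2 : ℝ) : ℂ) := by
    rw [Complex.ofReal_sum]
    refine Finset.sum_congr rfl fun k _ => ?_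
    rw [mul_assoc, Complex.mul_conj', Complex.ofReal_mul, ← Int.cast_abs, Complex.ofReal_intCast,
      Complex.ofReal_pow]
  have e5 : (2 * (∑ k ∈ I, ((|k| : ℤ) : ℂ) * y k * conj (y k) +
      -(meanSq α : ℂ)⁻¹ * qform (sKer α) I y y)).re =
      2 * (∑ k ∈ I, |(k : ℝ)| * ‖y k‖ ^ 2 - (meanSq α)⁻¹ * (qform (sKer α) I y y).re) := by
    rw [e4, ← Complex.ofReal_inv, ← Complex.ofReal_neg, show (2 : ℂ) = ((2 : ℝ) : ℂ) by norm_num,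
      Complex.re_ofReal_mul, Complex.add_re, Complex.ofReal_re, Complex.re_ofReal_mul]
    ring
  rw [e5] at e3
  have h6 := (Complex.abs_re_le_norm (qform Z I y y)).trans hb
  rw [abs_le] at h6
  rw [e1]
  linarith [h6.1]

end

section

/-! ### Commutation with powers of the weight -/

/-- Mean value inequality. The power q - 1 is monotone, increasing or decreasing, so on the segment
it is at most the sum of its two end values. -/
lemma abs_rpow_sub_rpow_le (q : ℝ) {x y : ℝ} (hx : 0 < x) (hy : 0 < y) :
    |x ^ q - y ^ q| ≤ |q| * (x ^ (q - 1) + y ^ (q - 1)) * |x - y| := by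
  have hpos : ∀ z ∈ uIcc y x, 0 < z := fun z hz =>
    (lt_min hy hx).trans_le hz.1
  have h := (convex_uIcc y x).norm_image_sub_le_of_norm_hasDerivWithin_le (𝕜 := ℝ)
    (f := fun t => t ^ q) (f' := fun t => q * t ^ (q - 1))
    (C := |q| * (x ^ (q - 1) + y ^ (q - 1)))
    (fun z hz => (Real.hasDerivAt_rpow_const (Or.inl (hpos z hz).ne')).hasDerivWithinAt)
    (fun z hz => by
      have hz0 := hpos z hz
      rw [Real.norm_eq_abs, abs_mul, abs_of_nonneg (Real.rpow_nonneg hz0.le _)]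
      have h1 := Real.rpow_nonneg hx.le (q - 1)
      have h2 := Real.rpow_nonneg hy.le (q - 1)
      gcongr
      rcases le_total 0 (q - 1) with hq | hq
      · rcases le_max_iff.1 hz.2 with h' | h'
        · have := Real.rpow_le_rpow hz0.le h' hq; linarith
        · have := Real.rpow_le_rpow hz0.le h' hq; linarith
      · rcases min_le_iff.1 hz.1 with h' | h'
        · have := Real.rpow_le_rpow_of_nonpos hy h' hq; linarith
        · have := Real.rpow_le_rpow_of_nonpos hx h' hq; linarith)
    (x := y) (y := x) left_mem_uIcc right_mem_uIcc
  simpa using h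

lemma abs_jap_sub_le (k j : ℤ) :
    |jap k - jap j| ≤ 3 * (jap (k - j) ^ (3 / 2 : ℝ) * jap j ^ (1 / 2 : ℝ)) := by
  have h1 := abs_le_jap_half (k - j)
  have h2 := abs_le_jap_half k
  have h3 := abs_le_jap_half j
  have h4 := jap_rpow_le (1 / 2) k j
  rw [abs_of_pos (by norm_num : (0 : ℝ) < 1 / 2)] at h4
  have hs : (2 : ℝ) ^ (1 / 2 : ℝ) ≤ 3 / 2 := by
    rw [← Real.sqrt_eq_rpow]; exact Real.sqrt_le_iff.2 ⟨by norm_num, by norm_num⟩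
  have e : jap k - jap j = (((k - j : ℤ) : ℝ)) * (k + j) := by unfold jap; push_cast; ring
  have p1 := jap_rpow_pos j (1 / 2)
  have p2 : (1 : ℝ) ≤ jap (k - j) ^ (1 / 2 : ℝ) := Real.one_le_rpow (one_le_jap _) (by norm_num)
  rw [e, abs_mul]
  have h5 : |(k : ℝ) + j| ≤ 5 / 2 * (jap (k - j) ^ (1 / 2 : ℝ) * jap j ^ (1 / 2 : ℝ)) := by
    calc |(k : ℝ) + j| ≤ |(k : ℝ)| + |(j : ℝ)| := abs_add_le _ _
      _ ≤ 3 / 2 * jap (k - j) ^ (1 / 2 : ℝ) * jap j ^ (1 / 2 : ℝ) +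
          jap (k - j) ^ (1 / 2 : ℝ) * jap j ^ (1 / 2 : ℝ) := by
          gcongr
          · refine h2.trans (h4.trans ?_); gcongr
          · exact h3.trans (le_mul_of_one_le_left p1.le p2)
      _ = _ := by ring
  have h6 : jap (k - j) ^ (1 / 2 : ℝ) * jap (k - j) ^ (1 / 2 : ℝ) ≤ jap (k - j) ^ (3 / 2 : ℝ) := by
    rw [← jap_rpow_add]; exact jap_rpow_mono _ (by norm_num)
  calc _ ≤ jap (k - j) ^ (1 / 2 : ℝ) *
        (5 / 2 * (jap (k - j) ^ (1 / 2 : ℝ) * jap j ^ (1 / 2 : ℝ))) := by gcongr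
    _ = 5 / 2 * (jap (k - j) ^ (1 / 2 : ℝ) * jap (k - j) ^ (1 / 2 : ℝ)) * jap j ^ (1 / 2 : ℝ) := by
        ring
    _ ≤ 3 * jap (k - j) ^ (3 / 2 : ℝ) * jap j ^ (1 / 2 : ℝ) := by
        gcongr; norm_num
    _ = _ := by ring

/-- Commuting a power of the weight past a matrix gains one derivative, that is, 1/2 in the exponent
of `jap`, with a loss only off the diagonal. -/
lemma abs_jap_rpow_sub_le (q : ℝ) : ∃ C m : ℝ, 0 ≤ C ∧ ∀ k j : ℤ,
    |jap k ^ q - jap j ^ q| ≤ C * jap j ^ (q - 1 / 2) * jap (k - j) ^ m := by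
  refine ⟨|q| * (2 ^ |q - 1| + 1) * 3, |q - 1| + 3 / 2, by positivity, fun k j => ?_⟩
  have h1 := abs_rpow_sub_rpow_le q (jap_pos k) (jap_pos j)
  have h2 := jap_rpow_le (q - 1) k j
  have h3 : (1 : ℝ) ≤ jap (k - j) ^ |q - 1| := Real.one_le_rpow (one_le_jap _) (abs_nonneg _)
  have h4 := jap_rpow_pos j (q - 1)
  calc _ ≤ _ := h1
    _ ≤ |q| * (2 ^ |q - 1| * jap (k - j) ^ |q - 1| * jap j ^ (q - 1) +
        jap (k - j) ^ |q - 1| * jap j ^ (q - 1)) *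
        (3 * (jap (k - j) ^ (3 / 2 : ℝ) * jap j ^ (1 / 2 : ℝ))) := by
        gcongr
        · exact le_mul_of_one_le_left h4.le h3
        · exact abs_jap_sub_le k j
    _ = _ := by
        rw [show q - 1 / 2 = (q - 1) + 1 / 2 by ring, jap_rpow_add, jap_rpow_add]; ring

variable {α : ℤ → ℂ}

/-- The matrix of `GDG` conjugated by `(1 - ∂ₓ²)^{σ/2}`. -/
noncomputable def tKer (α : ℤ → ℂ) (σ : ℝ) (k j : ℤ) : ℂ :=
  (jap k ^ (σ / 2) : ℝ) * sKer α k j * (jap j ^ (-(σ / 2)) : ℝ)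

/-- The difference is [Λ, GDG]Λ⁻¹ with Λ = (1 - ∂ₓ²)^{σ/2}: GDG has order 1 and the commutator gains
1. The dispersive term is diagonal and commutes with Λ, so this is the only error when passing to
H^σ. -/
lemma isOrd_tKer_sub (hr : Rapid α) (σ : ℝ) :
    IsOrd 0 (fun k j => tKer α σ k j - sKer α k j) := by
  obtain ⟨C, m, hC, h⟩ := abs_jap_rpow_sub_le (σ / 2)
  have := (isOrd_sKer hr).of_le (p := -(1 / 2)) (m := m) (c := C)
    (K := fun k j => tKer α σ k j - sKer α k j) hC fun k j => by
    have e1 : jap j ^ (σ / 2) * jap j ^ (-(σ / 2)) = 1 := by rw [← jap_rpow_add]; simp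
    have e : tKer α σ k j - sKer α k j =
        (((jap k ^ (σ / 2) - jap j ^ (σ / 2)) * jap j ^ (-(σ / 2)) : ℝ) : ℂ) * sKer α k j := by
      have e1' := congrArg (fun x : ℝ => (x : ℂ)) e1
      simp only [Complex.ofReal_mul, Complex.ofReal_one] at e1'
      rw [tKer, Complex.ofReal_mul, Complex.ofReal_sub]
      linear_combination (sKer α k j) * e1'
    rw [e, norm_mul, Complex.norm_real, Real.norm_eq_abs, abs_mul,
      abs_of_nonneg (jap_rpow_nonneg j _)]
    refine mul_le_mul_of_nonneg_right ?_ (norm_nonneg _)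
    calc _ ≤ (C * jap j ^ (σ / 2 - 1 / 2) * jap (k - j) ^ m) * jap j ^ (-(σ / 2)) := by
          gcongr
          · exact jap_rpow_nonneg _ _
          · exact h k j
      _ = _ := by
          rw [show -(1 / 2 : ℝ) = (σ / 2 - 1 / 2) + -(σ / 2) by ring, jap_rpow_add]; ring
  simpa using! this

/-! ### The energy inequality for quadratic forms -/

lemma sum_fapp_mul_conj (K : ℤ → ℤ → ℂ) (I : Finset ℤ) (y z : ℤ → ℂ) :
    ∑ k ∈ I, fapp K I y k * conj (z k) = qform K I y z := by
  simp only [fapp, qform, Finset.sum_mul]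

lemma nsq_smul (p c : ℝ) (I : Finset ℤ) (y : ℤ → ℂ) :
    nsq p I (fun k => (c : ℂ) * y k) = c ^ 2 * nsq p I y := by
  simp only [nsq, Finset.mul_sum, norm_mul, Complex.norm_real, mul_pow, Real.norm_eq_abs, sq_abs]
  exact Finset.sum_congr rfl fun k _ => by ring

lemma nsq_add_le (p : ℝ) (I : Finset ℤ) (y z : ℤ → ℂ) :
    nsq p I (fun k => y k + z k) ≤ 2 * nsq p I y + 2 * nsq p I z := by
  simp only [nsq, Finset.mul_sum, ← Finset.sum_add_distrib]
  refine Finset.sum_le_sum fun k _ => ?_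
  have h : ‖y k + z k‖ ^ 2 ≤ 2 * ‖y k‖ ^ 2 + 2 * ‖z k‖ ^ 2 := by
    have := norm_add_le (y k) (z k)
    nlinarith [norm_nonneg (y k + z k), sq_nonneg (‖y k‖ - ‖z k‖)]
  calc _ ≤ jap k ^ p * (2 * ‖y k‖ ^ 2 + 2 * ‖z k‖ ^ 2) :=
        mul_le_mul_of_nonneg_left h (jap_rpow_nonneg _ _)
    _ = _ := by ring

/-- The bounded form of the weighted matrix is tested with the pair ((C+1)y, Ky): the left side is
(C+1) times the squared norm of Ky, while the right side contains it only C times, so it can be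
absorbed. -/
lemma IsOrd.nsq_fapp_le {K : ℤ → ℤ → ℂ} (hK : IsOrd 0 K) (p : ℝ) :
    ∃ C : ℝ, 0 ≤ C ∧ ∀ I y, nsq p I (fapp K I y) ≤ C * nsq p I y := by
  have hK' : IsOrd p (fun k j => (jap k ^ p : ℝ) * K k j) := by
    have := hK.left_mul (p := p) (K := fun k j => (jap k ^ p : ℝ) * K k j) zero_le_one
      fun k j => by
        rw [norm_mul, Complex.norm_real, Real.norm_of_nonneg (jap_rpow_nonneg _ _), one_mul]
    simpa using this
  obtain ⟨C, hC, h⟩ := hK'.qform_le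
  refine ⟨C * (C + 1) ^ 2, by positivity, fun I y => ?_⟩
  have h1 := h I (fun k => ((C + 1 : ℝ) : ℂ) * y k) (fapp K I y)
  rw [nsq_smul] at h1
  have e : qform (fun k j => (jap k ^ p : ℝ) * K k j) I (fun k => ((C + 1 : ℝ) : ℂ) * y k)
      (fapp K I y) = (((C + 1) * nsq p I (fapp K I y) : ℝ) : ℂ) := by
    rw [Complex.ofReal_mul, nsq, Complex.ofReal_sum, Finset.mul_sum]
    refine Finset.sum_congr rfl fun k _ => ?_
    rw [Complex.ofReal_mul, Complex.ofReal_pow, ← Complex.mul_conj']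
    conv_rhs => rw [fapp]
    simp only [Finset.mul_sum, Finset.sum_mul]
    exact Finset.sum_congr rfl fun j _ => by rw [fapp]; ring
  have hn := nsq_nonneg p I (fapp K I y)
  rw [e, Complex.norm_real, Real.norm_of_nonneg (by positivity)] at h1
  nlinarith

lemma re_sum_mul_conj_le {δ : ℝ} (hδ : 0 < δ) (I : Finset ℤ) (η z : ℤ → ℂ) :
    (∑ k ∈ I, η k * conj (z k)).re ≤
      δ * nsq (1 / 2) I z + (4 * δ)⁻¹ * nsq (-(1 / 2)) I η := by
  rw [Complex.re_sum, nsq, nsq, Finset.mul_sum, Finset.mul_sum, ← Finset.sum_add_distrib]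
  refine Finset.sum_le_sum fun k _ => ?_
  refine (Complex.re_le_norm _).trans ?_
  rw [norm_mul, RCLike.norm_conj, ← jap_rpow_sq k (1 / 2), ← jap_rpow_sq k (-(1 / 2))]
  have e : jap k ^ (-(1 / 2) / 2 : ℝ) * jap k ^ (1 / 2 / 2 : ℝ) = 1 := by
    rw [← jap_rpow_add]; norm_num
  set a := jap k ^ (-(1 / 2) / 2 : ℝ) * ‖η k‖
  set b := jap k ^ (1 / 2 / 2 : ℝ) * ‖z k‖
  have h1 : ‖η k‖ * ‖z k‖ = a * b := by
    simp only [a, b]; linear_combination (-‖η k‖ * ‖z k‖) * e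
  have h2 : 0 ≤ (δ * b - a / 2) ^ 2 / δ := by positivity
  have h3 : (δ * b - a / 2) ^ 2 / δ = δ * b ^ 2 + (4 * δ)⁻¹ * a ^ 2 - a * b := by
    field_simp; ring
  calc _ = a * b := h1
    _ ≤ δ * b ^ 2 + (4 * δ)⁻¹ * a ^ 2 := by linarith
    _ = _ := by simp only [a, b]; ring

/-- Expands the nonnegative form at y/2 + w. It replaces Cauchy–Schwarz and spends only a quarter of
the damping of `y`. -/
lemma qform_sKer_re_ge (hr : Rapid α) (hα : Herm α) (I : Finset ℤ) (y w : ℤ → ℂ) :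
    -(1 / 4) * (qform (sKer α) I y y).re - (qform (sKer α) I w w).re ≤
      (qform (sKer α) I y w).re := by
  have h := qform_sKer_nonneg hr hα I (fun k => ((1 / 2 : ℝ) : ℂ) * y k + w k)
  have e : qform (sKer α) I (fun k => ((1 / 2 : ℝ) : ℂ) * y k + w k)
      (fun k => ((1 / 2 : ℝ) : ℂ) * y k + w k) =
      ((1 / 4 : ℝ) : ℂ) * qform (sKer α) I y y + qform (sKer α) I w w +
        ((1 / 2 : ℝ) : ℂ) * (qform (sKer α) I y w + qform (sKer α) I w y) := by
    simp only [qform, Finset.mul_sum, ← Finset.sum_add_distrib, map_add, map_mul,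
      Complex.conj_ofReal]
    refine Finset.sum_congr rfl fun k _ => Finset.sum_congr rfl fun j _ => ?_
    push_cast
    ring
  have e2 : (qform (sKer α) I w y).re = (qform (sKer α) I y w).re := by
    rw [← Complex.conj_re]
    congr 1
    simp only [qform, map_sum, map_mul, Complex.conj_conj, sKer_conj hα]
    rw [Finset.sum_comm]
    exact Finset.sum_congr rfl fun j _ => Finset.sum_congr rfl fun k _ => by ring
  rw [e] at h
  simp only [Complex.add_re, Complex.re_ofReal_mul, e2] at h
  linarith

/-- The matrix of multiplication by `b`. -/
noncomputable def bKer (α : ℤ → ℂ) (k j : ℤ) : ℂ := wt α (k - j)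

lemma isOrd_bKer (hr : Rapid α) : IsOrd 0 (bKer α) := IsOrd.toeplitz hr.wt

/-- The energy inequality: the form of the conjugated operator with respect to the inner product
`⟨(1 + ε b) ·, ·⟩` controls half a derivative more than the energy, for every truncation. -/
lemma energy_form (hr : Rapid α) (hα : Herm α) (hμ : 0 < meanSq α) (σ : ℝ) :
    ∃ ε c C : ℝ, 0 < ε ∧ 0 < c ∧ 0 ≤ C ∧
      (∀ I y, |ε * (qform (bKer α) I y y).re| ≤ 1 / 2 * nsq 0 I y) ∧
      ∀ (I : Finset ℤ) (y η : ℤ → ℂ),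
        2 * (∑ j ∈ I, (η j - (Complex.I * (j * (|j| : ℤ)) * y j + fapp (tKer α σ) I y j)) *
          conj (y j + (ε : ℂ) * fapp (bKer α) I y j)).re ≤
        -c * nsq (1 / 2) I y + C * nsq 0 I y + C * nsq (-(1 / 2)) I η := by
  obtain ⟨C₁, hC₁, h₁⟩ := dispersion_form_le hr hα hμ
  obtain ⟨C₂, hC₂, h₂⟩ := (isOrd_bKer hr).qform_le
  obtain ⟨C₃, hC₃, h₃⟩ := (isOrd_bKer hr).nsq_fapp_le (1 / 2)
  obtain ⟨C₄, hC₄, h₄⟩ := (isOrd_bKer hr).nsq_fapp_le 0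
  obtain ⟨C₅, hC₅, h₅⟩ := (isOrd_sKer hr).qform_le
  obtain ⟨C₆, hC₆, h₆⟩ := (isOrd_tKer_sub hr σ).qform_le
  set μ := meanSq α with hμd
  -- Smallness of ε: the commutator loss takes at most half of the damping, the modified energy
  -- stays between 1/2 and 3/2 of the L² energy, and the term quadratic in ε takes at most a quarter
  -- of the gain ε.
  obtain ⟨ε, hε, hε1, hεμ, hε2, hε5⟩ : ∃ ε : ℝ, 0 < ε ∧ ε ≤ 1 ∧ ε * μ⁻¹ ≤ 1 / 2 ∧
      ε * C₂ ≤ 1 / 4 ∧ ε * (2 * C₅ * C₃) ≤ 1 / 4 := by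
    have p1 : (0 : ℝ) < 1 + 2 * μ⁻¹ + 4 * C₂ + 4 * (2 * C₅ * C₃) := by positivity
    refine ⟨(1 + 2 * μ⁻¹ + 4 * C₂ + 4 * (2 * C₅ * C₃))⁻¹, by positivity, ?_, ?_, ?_, ?_⟩
    all_goals
      have q1 : 0 ≤ μ⁻¹ := by positivity
      have q2 : 0 ≤ C₅ * C₃ := by positivity
      first
      | rw [inv_le_one₀ p1]; nlinarith
      | rw [inv_mul_le_iff₀ p1]; nlinarith
  -- Chosen so that δ(2 + 2C₃) = ε/4, the share of the gain given to the forcing.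
  set δ := ε / (8 * (1 + C₃)) with hδ
  have hδ0 : 0 < δ := by positivity
  refine ⟨ε, ε / 2, 2 * ((4 * δ)⁻¹ + ε * (1 + C₁) + C₆ * (3 + 2 * C₄)), hε, by positivity,
    by positivity, fun I y => ?_, fun I y η => ?_⟩
  · have := (Complex.abs_re_le_norm _).trans (h₂ I y y)
    rw [abs_mul, abs_of_pos hε]
    nlinarith [nsq_nonneg 0 I y]
  set x := fapp (bKer α) I y with hx
  set z : ℤ → ℂ := fun k => y k + (ε : ℂ) * x k with hz
  have n0 := nsq_nonneg 0 I y
  have n1 := nsq_nonneg (1 / 2) I y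
  have n2 := nsq_nonneg (-(1 / 2)) I η
  have x0 : nsq 0 I x ≤ C₄ * nsq 0 I y := h₄ I y
  have x1 : nsq (1 / 2) I x ≤ C₃ * nsq (1 / 2) I y := h₃ I y
  have hε2' : ε ^ 2 ≤ 1 := by nlinarith
  have z0 : nsq 0 I z ≤ (2 + 2 * C₄) * nsq 0 I y := by
    have h := nsq_add_le 0 I y (fun k => (ε : ℂ) * x k)
    rw [nsq_smul] at h
    have := mul_le_mul hε2' x0 (nsq_nonneg 0 I x) zero_le_one
    simp only [hz]; linarith
  have z1 : nsq (1 / 2) I z ≤ (2 + 2 * C₃) * nsq (1 / 2) I y := by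
    have h := nsq_add_le (1 / 2) I y (fun k => (ε : ℂ) * x k)
    rw [nsq_smul] at h
    have := mul_le_mul hε2' x1 (nsq_nonneg (1 / 2) I x) zero_le_one
    simp only [hz]; linarith
  -- forcing
  have t1 : (∑ k ∈ I, η k * conj (z k)).re ≤ ε / 4 * nsq (1 / 2) I y +
      (4 * δ)⁻¹ * nsq (-(1 / 2)) I η := by
    refine (re_sum_mul_conj_le hδ0 I η z).trans ?_
    have h := mul_le_mul_of_nonneg_left z1 hδ0.le
    have e : δ * ((2 + 2 * C₃) * nsq (1 / 2) I y) = ε / 4 * nsq (1 / 2) I y := by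
      rw [hδ]; field_simp; ring
    linarith
  -- dispersion
  have t2 : (∑ k ∈ I, Complex.I * (k * (|k| : ℤ)) * y k * conj (y k)).re = 0 := by
    rw [Complex.re_sum]
    refine Finset.sum_eq_zero fun k _ => ?_
    rw [mul_assoc, Complex.mul_conj', mul_assoc, Complex.I_mul_re, neg_eq_zero]
    rw [← Complex.ofReal_intCast, ← Complex.ofReal_intCast, ← Complex.ofReal_mul,
      ← Complex.ofReal_pow, ← Complex.ofReal_mul, Complex.ofReal_im]
  have t3 := h₁ I y
  have t3' : nsq (1 / 2) I y - nsq 0 I y ≤ ∑ k ∈ I, |(k : ℝ)| * ‖y k‖ ^ 2 := by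
    rw [nsq, nsq, ← Finset.sum_sub_distrib]
    refine Finset.sum_le_sum fun k _ => ?_
    rw [Real.rpow_zero, ← sub_mul]
    gcongr
    linarith [jap_half_le k]
  -- damping
  have s0 := qform_sKer_nonneg hr hα I y
  have t4 := qform_sKer_re_ge hr hα I y (fun k => (ε : ℂ) * x k)
  have t5 : (qform (sKer α) I (fun k => (ε : ℂ) * x k) (fun k => (ε : ℂ) * x k)).re ≤
      ε / 4 * nsq (1 / 2) I y := by
    refine ((Complex.abs_re_le_norm _).trans' (le_abs_self _)).trans ((h₅ I _ _).trans ?_)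
    rw [nsq_smul]
    have h := mul_le_mul_of_nonneg_left x1 (by positivity : 0 ≤ C₅ * (2 * ε ^ 2))
    have h' := mul_le_mul_of_nonneg_left hε5 (by positivity : 0 ≤ ε * nsq (1 / 2) I y)
    nlinarith
  have t6 : -(C₆ * (3 + 2 * C₄) * nsq 0 I y) ≤
      (qform (fun k j => tKer α σ k j - sKer α k j) I y z).re := by
    have h := (Complex.abs_re_le_norm _).trans (h₆ I y z)
    have h' := mul_le_mul_of_nonneg_left z0 hC₆
    rw [abs_le] at h
    nlinarith [h.1]
  have key : ∑ j ∈ I, (η j - (Complex.I * (j * (|j| : ℤ)) * y j + fapp (tKer α σ) I y j)) *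
      conj (z j) = ∑ k ∈ I, η k * conj (z k) -
      (∑ k ∈ I, Complex.I * (k * (|k| : ℤ)) * y k * conj (y k) +
        (ε : ℂ) * ∑ k ∈ I, Complex.I * (k * (|k| : ℤ)) * y k * conj (x k)) -
      (qform (sKer α) I y y + qform (sKer α) I y (fun k => (ε : ℂ) * x k)) -
      qform (fun k j => tKer α σ k j - sKer α k j) I y z := by
    simp only [← sum_fapp_mul_conj, Finset.mul_sum, ← Finset.sum_add_distrib,
      ← Finset.sum_sub_distrib]
    refine Finset.sum_congr rfl fun k _ => ?_
    have : fapp (fun k j => tKer α σ k j - sKer α k j) I y k =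
        fapp (tKer α σ) I y k - fapp (sKer α) I y k := by
      simp only [fapp, sub_mul, Finset.sum_sub_distrib]
    rw [this]
    simp only [hz, map_add, map_mul, Complex.conj_ofReal]
    ring
  rw [key]
  simp only [Complex.sub_re, Complex.add_re, Complex.re_ofReal_mul, t2]
  set Sy := (qform (sKer α) I y y).re
  set B := (∑ k ∈ I, Complex.I * (k * (|k| : ℤ)) * y k * conj (x k)).re
  have t7 : ε * (nsq (1 / 2) I y - nsq 0 I y - μ⁻¹ * Sy - C₁ * nsq 0 I y) ≤ ε * B := by
    refine mul_le_mul_of_nonneg_left (le_trans ?_ t3) hε.le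
    linarith
  have t8 : ε * μ⁻¹ * Sy ≤ 1 / 2 * Sy := mul_le_mul_of_nonneg_right hεμ s0
  have r1 : 0 ≤ (4 * δ)⁻¹ * nsq 0 I y := by positivity
  have r2 : 0 ≤ (ε * (1 + C₁) + C₆ * (3 + 2 * C₄)) * nsq (-(1 / 2)) I η := by positivity
  -- Balance: of the gain ε in the H^{1/2} norm, ε/4 goes to the forcing and ε/4 to the cross term;
  -- of the damping, 1/2 goes to the commutator and 1/4 to the cross term.
  nlinarith

end

section

/-! ### The energy estimate for truncated problems -/

/-- Gronwall with the integrating factor exp(-Kτ), keeping the dissipation: the weighted energy plus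
the integral of `f` is nonincreasing. -/
lemma gronwall_energy {T c K : ℝ} (hK : 0 ≤ K) (hc : 0 ≤ c) {E E' n H : ℝ → ℝ}
    (hE : ContinuousOn E (Icc 0 T)) (hn : ContinuousOn n (Icc 0 T)) (hH : ContinuousOn H (Icc 0 T))
    (hE0 : ∀ t, 0 ≤ E t) (hn0 : ∀ t, 0 ≤ n t) (hH0 : ∀ t, 0 ≤ H t)
    (hd : ∀ t ∈ Ioo 0 T, HasDerivAt E (E' t) t)
    (hle : ∀ t ∈ Ioo 0 T, E' t ≤ -c * n t + K * E t + K * H t) {t : ℝ} (ht : t ∈ Icc 0 T) :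
    E t + c * ∫ τ in (0 : ℝ)..t, n τ ≤ Real.exp (K * T) * (E 0 + K * ∫ τ in (0 : ℝ)..T, H τ) := by
  have hT : 0 ≤ T := ht.1.trans ht.2
  have hexp : Continuous fun τ : ℝ => Real.exp (-K * τ) := by fun_prop
  set f : ℝ → ℝ := fun τ => Real.exp (-K * τ) * (c * n τ - K * H τ) with hf
  have hfc : ContinuousOn f (Icc 0 T) :=
    hexp.continuousOn.mul ((hn.const_smul c).sub (hH.const_smul K))
  have hint : ∀ {g : ℝ → ℝ}, ContinuousOn g (Icc 0 T) → ∀ {a b}, a ∈ Icc 0 T → b ∈ Icc 0 T →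
      IntervalIntegrable g volume a b := fun hg _ _ ha hb =>
    (hg.mono (uIcc_subset_Icc ha hb)).intervalIntegrable
  have h0 : (0 : ℝ) ∈ Icc 0 T := ⟨le_rfl, hT⟩
  have hTm : T ∈ Icc 0 T := ⟨hT, le_rfl⟩
  set F : ℝ → ℝ := fun s => Real.exp (-K * s) * E s + ∫ τ in (0 : ℝ)..s, f τ with hF
  have hanti : AntitoneOn F (Icc 0 T) := by
    have hder : ∀ s ∈ Ioo 0 T, HasDerivAt F (-K * Real.exp (-K * s) * E s +
        Real.exp (-K * s) * E' s + f s) s := fun s hs => by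
      have h1 : HasDerivAt (fun s : ℝ => Real.exp (-K * s)) (-K * Real.exp (-K * s)) s := by
        have := ((hasDerivAt_id s).const_mul (-K)).exp
        simpa [mul_comm] using this
      refine (h1.mul (hd s hs)).add ?_
      have hnh : Icc 0 T ∈ 𝓝 s := Icc_mem_nhds hs.1 hs.2
      exact intervalIntegral.integral_hasDerivAt_right (hint hfc h0 (Ioo_subset_Icc_self hs))
        ((hfc.mono Ioo_subset_Icc_self).stronglyMeasurableAtFilter isOpen_Ioo s hs)
        (hfc.continuousAt hnh)
    refine antitoneOn_of_deriv_nonpos (convex_Icc 0 T) ?_ ?_ ?_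
    · refine (hexp.continuousOn.mul hE).add ?_
      have := intervalIntegral.continuousOn_primitive_interval'
        (hint hfc h0 hTm) (a := (0 : ℝ)) (by simp)
      rwa [uIcc_of_le hT] at this
    · rw [interior_Icc]; exact fun s hs => (hder s hs).differentiableAt.differentiableWithinAt
    · rw [interior_Icc]; intro s hs
      rw [(hder s hs).deriv]
      have h2 := mul_le_mul_of_nonneg_left (hle s hs) (Real.exp_pos (-K * s)).le
      simp only [hf]; nlinarith
  have h1 : F t ≤ F 0 := hanti h0 ht ht.1
  simp only [hF, intervalIntegral.integral_same, add_zero, mul_zero, Real.exp_zero, one_mul] at h1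
  have e1 : (∫ τ in (0 : ℝ)..t, f τ) = c * (∫ τ in (0 : ℝ)..t, Real.exp (-K * τ) * n τ) -
      K * ∫ τ in (0 : ℝ)..t, Real.exp (-K * τ) * H τ := by
    rw [← intervalIntegral.integral_const_mul, ← intervalIntegral.integral_const_mul,
      ← intervalIntegral.integral_sub]
    · exact intervalIntegral.integral_congr fun τ _ => by simp only [hf]; ring
    · exact (hint (hexp.continuousOn.mul hn) h0 ht).const_mul c
    · exact (hint (hexp.continuousOn.mul hH) h0 ht).const_mul K
  have e2 : Real.exp (-K * T) * ∫ τ in (0 : ℝ)..t, n τ ≤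
      ∫ τ in (0 : ℝ)..t, Real.exp (-K * τ) * n τ := by
    rw [← intervalIntegral.integral_const_mul]
    refine intervalIntegral.integral_mono_on ht.1 ((hint hn h0 ht).const_mul _)
      (hint (hexp.continuousOn.mul hn) h0 ht) fun τ hτ => ?_
    refine mul_le_mul_of_nonneg_right (Real.exp_le_exp.2 ?_) (hn0 τ)
    have := hτ.2.trans ht.2
    nlinarith
  have e3 : (∫ τ in (0 : ℝ)..t, Real.exp (-K * τ) * H τ) ≤ ∫ τ in (0 : ℝ)..T, H τ := by
    refine (intervalIntegral.integral_mono_on ht.1 (hint (hexp.continuousOn.mul hH) h0 ht)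
      (hint hH h0 ht) fun τ hτ => ?_).trans (intervalIntegral.integral_mono_interval le_rfl ht.1
        ht.2 (ae_of_all _ hH0) (hint hH h0 hTm))
    refine mul_le_of_le_one_left (hH0 τ) (Real.exp_le_one_iff.2 ?_)
    nlinarith [hτ.1]
  have e4 : Real.exp (-K * T) * E t ≤ Real.exp (-K * t) * E t := by
    refine mul_le_mul_of_nonneg_right (Real.exp_le_exp.2 ?_) (hE0 t)
    nlinarith [ht.2]
  have e5 : Real.exp (-K * T) * (E t + c * ∫ τ in (0 : ℝ)..t, n τ) ≤
      E 0 + K * ∫ τ in (0 : ℝ)..T, H τ := by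
    have := mul_le_mul_of_nonneg_left e2 hc
    have := mul_le_mul_of_nonneg_left e3 hK
    linarith
  calc E t + c * ∫ τ in (0 : ℝ)..t, n τ
      = Real.exp (K * T) * (Real.exp (-K * T) * (E t + c * ∫ τ in (0 : ℝ)..t, n τ)) := by
        rw [← mul_assoc, ← Real.exp_add]; simp
    _ ≤ _ := by gcongr

variable {α : ℤ → ℂ}

/-- `e` solves the truncation to the modes in `I` of the equation with the forcing `h`. -/
structure IsGalerkin (α : ℤ → ℂ) (I : Finset ℤ) (T : ℝ) (e h : ℝ → ℤ → ℂ) : Prop where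
  supp : ∀ t, ∀ k ∉ I, e t k = 0
  supp_forcing : ∀ t, ∀ k ∉ I, h t k = 0
  cont : ∀ k, ContinuousOn (fun t => e t k) (Icc 0 T)
  cont_forcing : ∀ k, ContinuousOn (fun t => h t k) (Icc 0 T)
  hasDerivAt : ∀ k ∈ I, ∀ t ∈ Ioo 0 T,
    HasDerivAt (fun t => e t k) (h t k - fapp (aKer α) I (e t) k) t

lemma continuousOn_nsq {T : ℝ} {e : ℝ → ℤ → ℂ}
    (he : ∀ k, ContinuousOn (fun t => e t k) (Icc 0 T)) (p : ℝ) (I : Finset ℤ) :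
    ContinuousOn (fun t => nsq p I (e t)) (Icc 0 T) :=
  continuousOn_finsetSum _ fun k _ => continuousOn_const.mul ((he k).norm.pow 2)

lemma continuousOn_qform {T : ℝ} {e : ℝ → ℤ → ℂ}
    (he : ∀ k, ContinuousOn (fun t => e t k) (Icc 0 T)) (K : ℤ → ℤ → ℂ) (I : Finset ℤ) :
    ContinuousOn (fun t => qform K I (e t) (e t)) (Icc 0 T) :=
  continuousOn_finsetSum _ fun k _ => continuousOn_finsetSum _ fun j _ =>
    (continuousOn_const.mul (he j)).mul (Complex.continuous_conj.comp_continuousOn (he k))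

lemma lintegral_sobNormSq_eq {T : ℝ} (hT : 0 ≤ T) {e : ℝ → ℤ → ℂ} {I : Finset ℤ}
    (he : ∀ k, ContinuousOn (fun t => e t k) (Icc 0 T)) (hs : ∀ t, ∀ k ∉ I, e t k = 0) (p : ℝ) :
    ∫⁻ t in Icc 0 T, sobNormSq p (e t) =
      ENNReal.ofReal (2 * Real.pi * ∫ t in (0 : ℝ)..T, nsq p I (e t)) := by
  have hc := continuousOn_nsq he p I
  rw [← intervalIntegral.integral_const_mul, intervalIntegral.integral_of_le hT,
    ← integral_Icc_eq_integral_Ioc, ofReal_integral_eq_lintegral_ofReal]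
  · exact lintegral_congr fun t => sobNormSq_finite (hs t) p
  · exact (hc.integrableOn_Icc).const_mul _
  · exact ae_of_all _ fun t => mul_nonneg (by positivity) (nsq_nonneg _ _ _)

lemma jap_weight_smul (σ p : ℝ) (I : Finset ℤ) (e : ℤ → ℂ) :
    nsq p I (fun k => (jap k ^ (σ / 2) : ℝ) * e k) = nsq (σ + p) I e := by
  refine Finset.sum_congr rfl fun k _ => ?_
  rw [norm_mul, Complex.norm_real, Real.norm_of_nonneg (jap_rpow_nonneg _ _), mul_pow,
    jap_rpow_sq, jap_rpow_add]
  ring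

lemma fapp_weight (σ : ℝ) (I : Finset ℤ) (e : ℤ → ℂ) (k : ℤ) :
    fapp (tKer α σ) I (fun k => (jap k ^ (σ / 2) : ℝ) * e k) k =
      (jap k ^ (σ / 2) : ℝ) * fapp (sKer α) I e k := by
  simp only [fapp, Finset.mul_sum]
  refine Finset.sum_congr rfl fun j _ => ?_
  have e1 : jap j ^ (σ / 2) * jap j ^ (-(σ / 2)) = 1 := by rw [← jap_rpow_add]; simp
  have e1' := congrArg (fun x : ℝ => (x : ℂ)) e1
  simp only [Complex.ofReal_mul, Complex.ofReal_one] at e1'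
  rw [tKer]
  linear_combination ((jap k ^ (σ / 2) : ℝ) * sKer α k j * e j) * e1'

lemma fapp_aKer (I : Finset ℤ) (e : ℤ → ℂ) {k : ℤ} (hk : k ∈ I) :
    fapp (aKer α) I e k = Complex.I * (k * (|k| : ℤ)) * e k + fapp (sKer α) I e k := by
  simp only [fapp, aKer, add_mul, Finset.sum_add_distrib]
  congr 1
  rw [Finset.sum_eq_single_of_mem k hk fun j _ hj => by simp [Ne.symm hj]]
  simp

/-- For a Hermitian matrix the two terms of the product rule are complex conjugates of each other.
-/
lemma hasDerivAt_qform {K : ℤ → ℤ → ℂ} (hK : ∀ k j, conj (K k j) = K j k) {I : Finset ℤ}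
    {y : ℝ → ℤ → ℂ} {y' : ℤ → ℂ} {t : ℝ} (hy : ∀ k ∈ I, HasDerivAt (fun t => y t k) (y' k) t) :
    HasDerivAt (fun t => (qform K I (y t) (y t)).re)
      (2 * (∑ j ∈ I, y' j * conj (fapp K I (y t) j)).re) t := by
  have h : HasDerivAt (fun t => qform K I (y t) (y t))
      (∑ k ∈ I, ∑ j ∈ I, (K k j * y' j * conj (y t k) + K k j * y t j * conj (y' k))) t :=
    HasDerivAt.fun_sum fun k hk => HasDerivAt.fun_sum fun j hj =>
      ((hy j hj).const_mul _).mul (hy k hk).star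
  have h2 : (∑ k ∈ I, ∑ j ∈ I, (K k j * y' j * conj (y t k) + K k j * y t j * conj (y' k))).re =
      2 * (∑ j ∈ I, y' j * conj (fapp K I (y t) j)).re := by
    have e1 : ∑ k ∈ I, ∑ j ∈ I, K k j * y' j * conj (y t k) =
        ∑ j ∈ I, y' j * conj (fapp K I (y t) j) := by
      rw [Finset.sum_comm]
      refine Finset.sum_congr rfl fun j _ => ?_
      simp only [fapp, map_sum, map_mul, hK, Finset.mul_sum]
      exact Finset.sum_congr rfl fun k _ => by ring
    have e2 : ∑ k ∈ I, ∑ j ∈ I, K k j * y t j * conj (y' k) =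
        conj (∑ j ∈ I, y' j * conj (fapp K I (y t) j)) := by
      simp only [fapp, map_sum, map_mul, Complex.conj_conj, Finset.mul_sum]
      exact Finset.sum_congr rfl fun k _ => Finset.sum_congr rfl fun j _ => by ring
    simp only [Finset.sum_add_distrib]
    rw [e1, e2, Complex.add_re, Complex.conj_re]
    ring
  rw [← h2]
  exact Complex.reCLM.hasFDerivAt.comp_hasDerivAt t h

/-- The energy estimate, uniform in the truncation. -/
theorem energy_estimate (hr : Rapid α) (hα : Herm α) (hμ : 0 < meanSq α) (σ : ℝ) :
    ∃ C : ℝ, 0 ≤ C ∧ ∀ (I : Finset ℤ) (T : ℝ) (e h : ℝ → ℤ → ℂ), IsGalerkin α I T e h →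
      ∀ t ∈ Icc 0 T, sobNormSq σ (e t) + ∫⁻ τ in Icc 0 T, sobNormSq (σ + 1 / 2) (e τ) ≤
        ENNReal.ofReal (C * Real.exp (C * T)) *
          (sobNormSq σ (e 0) + ∫⁻ τ in Icc 0 T, sobNormSq (σ - 1 / 2) (h τ)) := by
  obtain ⟨ε, c, C, hε, hc, hC, hb, henergy⟩ := energy_form hr hα hμ σ
  -- The factor 2 is from bounding the L² norm by the modified energy, which is at least half of it.
  set K := 2 * C with hKd
  -- One number serves as prefactor and as exponential rate: 2 and `c⁻¹` come from the pointwise and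
  -- the integrated norm, 3/2 from the initial energy, and the extra `K` makes it at least the
  -- Gronwall rate.
  refine ⟨(2 + c⁻¹) * (3 / 2 + K) + K, by positivity, fun I T e h hg t ht => ?_⟩
  have hT : 0 ≤ T := ht.1.trans ht.2
  set w : ℤ → ℂ := fun k => ((jap k ^ (σ / 2) : ℝ) : ℂ) with hw
  set y : ℝ → ℤ → ℂ := fun t k => w k * e t k with hy
  set η : ℝ → ℤ → ℂ := fun t k => w k * h t k with hη
  -- The matrix of 1 + εb, Hermitian since b is real.
  set P : ℤ → ℤ → ℂ := fun k j => (if k = j then 1 else 0) + (ε : ℂ) * bKer α k j with hP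
  have hyc : ∀ k, ContinuousOn (fun t => y t k) (Icc 0 T) := fun k =>
    continuousOn_const.mul (hg.cont k)
  have hηc : ∀ k, ContinuousOn (fun t => η t k) (Icc 0 T) := fun k =>
    continuousOn_const.mul (hg.cont_forcing k)
  have hPh : ∀ k j, conj (P k j) = P j k := fun k j => by
    have e1 : conj (wt α (k - j)) = wt α (j - k) := by rw [← hα.wt, neg_sub]
    simp only [hP, map_add, map_mul, Complex.conj_ofReal, bKer, e1]
    congr 1
    by_cases hkj : k = j
    · simp [hkj]
    · simp [hkj, Ne.symm hkj]
  set E : ℝ → ℝ := fun t => (qform P I (y t) (y t)).re with hE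
  have hEe : ∀ t, E t = nsq 0 I (y t) + ε * (qform (bKer α) I (y t) (y t)).re := fun t => by
    simp only [hE, hP, qform_add, qform_const_mul, qform_diag, Complex.add_re,
      Complex.re_ofReal_mul]
    congr 1
    rw [Complex.re_sum]
    refine Finset.sum_congr rfl fun k _ => ?_
    rw [one_mul, Complex.mul_conj', Real.rpow_zero, one_mul, ← Complex.ofReal_pow,
      Complex.ofReal_re]
  have hE1 : ∀ t, 1 / 2 * nsq 0 I (y t) ≤ E t := fun t => by
    have := (abs_le.1 (hb I (y t))).1
    rw [hEe]; linarith
  have hE2 : ∀ t, E t ≤ 3 / 2 * nsq 0 I (y t) := fun t => by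
    have := (abs_le.1 (hb I (y t))).2
    rw [hEe]; linarith
  have hE0 : ∀ t, 0 ≤ E t := fun t => le_trans (by have := nsq_nonneg 0 I (y t); positivity) (hE1 t)
  set y' : ℝ → ℤ → ℂ := fun t j =>
    η t j - (Complex.I * (j * (|j| : ℤ)) * y t j + fapp (tKer α σ) I (y t) j) with hy'
  have hder : ∀ t ∈ Ioo 0 T, HasDerivAt E
      (2 * (∑ j ∈ I, y' t j * conj (fapp P I (y t) j)).re) t := fun t ht =>
    hasDerivAt_qform hPh fun k hk => by
      have h1 := (hg.hasDerivAt k hk t ht).const_mul (w k)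
      have e1 : w k * (h t k - fapp (aKer α) I (e t) k) = y' t k := by
        rw [fapp_aKer I _ hk]
        simp only [hy', hη, hy, hw, fapp_weight]
        ring
      rwa [e1] at h1
  have hle : ∀ t ∈ Ioo 0 T, 2 * (∑ j ∈ I, y' t j * conj (fapp P I (y t) j)).re ≤
      -c * nsq (1 / 2) I (y t) + K * E t + K * nsq (-(1 / 2)) I (η t) := fun t _ => by
    have h1 := henergy I (y t) (η t)
    have e1 : ∑ j ∈ I, y' t j * conj (fapp P I (y t) j) =
        ∑ j ∈ I, (η t j - (Complex.I * (j * (|j| : ℤ)) * y t j + fapp (tKer α σ) I (y t) j)) *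
          conj (y t j + (ε : ℂ) * fapp (bKer α) I (y t) j) := by
      refine Finset.sum_congr rfl fun k hk => ?_
      congr 2
      simp only [fapp, hP, add_mul, Finset.sum_add_distrib, Finset.mul_sum, mul_assoc]
      congr 1
      rw [Finset.sum_eq_single_of_mem k hk fun j _ hj => by simp [Ne.symm hj]]
      simp
    rw [e1]
    refine h1.trans ?_
    have h2 := mul_le_mul_of_nonneg_left (hE1 t) hC
    have h3 := mul_nonneg hC (nsq_nonneg (-(1 / 2)) I (η t))
    rw [hKd]
    linarith
  have hgr := fun {t} (ht : t ∈ Icc 0 T) => gronwall_energy (K := K) (by positivity) hc.le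
    (E := E) (Complex.continuous_re.comp_continuousOn (continuousOn_qform hyc P I))
    (continuousOn_nsq hyc (1 / 2) I) (continuousOn_nsq hηc (-(1 / 2)) I) hE0
    (fun t => nsq_nonneg _ _ _) (fun t => nsq_nonneg _ _ _) hder hle ht
  have w0 : ∀ t, nsq 0 I (y t) = nsq σ I (e t) := fun t => by
    rw [hy, hw]; simpa using jap_weight_smul σ 0 I (e t)
  have w1 : ∀ t, nsq (1 / 2) I (y t) = nsq (σ + 1 / 2) I (e t) := fun t =>
    jap_weight_smul σ (1 / 2) I (e t)
  have w2 : ∀ t, nsq (-(1 / 2)) I (η t) = nsq (σ - 1 / 2) I (h t) := fun t =>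
    jap_weight_smul σ (-(1 / 2)) I (h t)
  simp only [w1, w2] at hgr
  simp only [w0] at hE1 hE2
  have hn : ∀ s ∈ Icc (0 : ℝ) T, 0 ≤ ∫ τ in (0 : ℝ)..s, nsq (σ + 1 / 2) I (e τ) := fun s hs =>
    intervalIntegral.integral_nonneg hs.1 fun _ _ => nsq_nonneg _ _ _
  have hH : 0 ≤ ∫ τ in (0 : ℝ)..T, nsq (σ - 1 / 2) I (h τ) :=
    intervalIntegral.integral_nonneg hT fun _ _ => nsq_nonneg _ _ _
  have g1 := hgr ht
  have g2 := hgr (t := T) ⟨hT, le_rfl⟩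
  have p1 := hE1 t
  have p2 := hE2 0
  have p3 := hE0 T
  have m1 := hn t ht
  have m2 := hn T ⟨hT, le_rfl⟩
  have n0 := nsq_nonneg σ I (e 0)
  rw [sobNormSq_finite (hg.supp t), sobNormSq_finite (hg.supp 0),
    lintegral_sobNormSq_eq hT hg.cont hg.supp,
    lintegral_sobNormSq_eq hT hg.cont_forcing hg.supp_forcing,
    ← ENNReal.ofReal_add (mul_nonneg (by positivity) (nsq_nonneg _ _ _))
      (mul_nonneg (by positivity) m2),
    ← ENNReal.ofReal_add (mul_nonneg (by positivity) n0) (mul_nonneg (by positivity) hH),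
    ← ENNReal.ofReal_mul (by positivity)]
  apply ENNReal.ofReal_le_ofReal
  rw [← mul_add, ← mul_add, mul_left_comm]
  refine mul_le_mul_of_nonneg_left ?_ (by positivity)
  set A := nsq σ I (e 0)
  set H := ∫ τ in (0 : ℝ)..T, nsq (σ - 1 / 2) I (h τ)
  set X := ∫ τ in (0 : ℝ)..T, nsq (σ + 1 / 2) I (e τ)
  set R := Real.exp (K * T) * (E 0 + K * H)
  have hK0 : 0 ≤ K := by positivity
  have r1 : nsq σ I (e t) ≤ 2 * R := by
    have := mul_nonneg hc.le m1; linarith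
  have r2 : X ≤ c⁻¹ * R := by
    rw [le_inv_mul_iff₀ hc]; linarith
  have r3 : R ≤ (3 / 2 + K) * Real.exp (K * T) * (A + H) := by
    have : E 0 + K * H ≤ (3 / 2 + K) * (A + H) := by nlinarith
    calc R ≤ Real.exp (K * T) * ((3 / 2 + K) * (A + H)) := by
          simp only [R]; gcongr
      _ = _ := by ring
  have c0 : 0 ≤ c⁻¹ := by positivity
  calc nsq σ I (e t) + X ≤ (2 + c⁻¹) * R := by linarith
    _ ≤ (2 + c⁻¹) * ((3 / 2 + K) * Real.exp (K * T) * (A + H)) := by gcongr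
    _ = (2 + c⁻¹) * (3 / 2 + K) * Real.exp (K * T) * (A + H) := by ring
    _ ≤ _ := by
      gcongr
      · linarith
      · have : 0 ≤ (2 + c⁻¹) * (3 / 2 + K) := by positivity
        linarith

end

section

/-! ### Existence for truncated problems -/

/-- Variation of constants: u(t) = exp(-tL)(x + ∫₀ᵗ exp(τL)F(τ) dτ). -/
lemma exists_hasDerivAt_linear {E : Type*} [NormedAddCommGroup E] [NormedSpace ℝ E]
    [CompleteSpace E] (L : E →L[ℝ] E) {F : ℝ → E} (hF : Continuous F) (x : E) :
    ∃ u : ℝ → E, u 0 = x ∧ ∀ t, HasDerivAt u (F t - L (u t)) t := by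
  set S : ℝ → E →L[ℝ] E := fun t => NormedSpace.exp (t • (-L)) with hS
  set R : ℝ → E →L[ℝ] E := fun t => NormedSpace.exp (t • L) with hR
  have hRd : ∀ t, HasDerivAt R (R t * L) t := fun t => hasDerivAt_exp_smul_const L t
  have hSd : ∀ t, HasDerivAt S ((-L) * S t) t := fun t => hasDerivAt_exp_smul_const' (-L) t
  have hRc : Continuous R := continuous_iff_continuousAt.2 fun t => (hRd t).continuousAt
  have hRF : Continuous fun t => R t (F t) := hRc.clm_apply hF
  have hSR : ∀ t, S t * R t = 1 := fun t => by
    have h1 : Commute (t • (-L)) (t • L) :=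
      ((Commute.refl L).neg_left.smul_left t).smul_right t
    let : NormedAlgebra ℚ (E →L[ℝ] E) := NormedAlgebra.restrictScalars ℚ ℝ _
    rw [hS, hR]
    simp only
    rw [← NormedSpace.exp_add_of_commute h1]
    simp
  refine ⟨fun t => S t (x + ∫ τ in (0 : ℝ)..t, R τ (F τ)), by simp [hS], fun t => ?_⟩
  have hv : HasDerivAt (fun t => x + ∫ τ in (0 : ℝ)..t, R τ (F τ)) (R t (F t)) t :=
    (intervalIntegral.integral_hasDerivAt_right (hRF.intervalIntegrable _ _)
      hRF.stronglyMeasurable.stronglyMeasurableAtFilter hRF.continuousAt).const_add x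
  have h := (hSd t).clm_apply hv
  convert h using 1
  have h2 : S t (R t (F t)) = F t := by
    rw [← mul_apply_eq_comp, hSR]; rfl
  rw [h2, mul_apply_eq_comp, neg_apply]
  abel

variable {α : ℤ → ℂ}

lemma exists_isGalerkin (α : ℤ → ℂ) (I : Finset ℤ) (T : ℝ) {x : ℤ → ℂ} {f : ℝ → ℤ → ℂ}
    (hx : ∀ k ∉ I, x k = 0) (hf : ∀ t, ∀ k ∉ I, f t k = 0)
    (hfc : ∀ k, Continuous fun t => f t k) :
    ∃ e, e 0 = x ∧ IsGalerkin α I T e f := by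
  classical
  let Ll : (I → ℂ) →ₗ[ℝ] (I → ℂ) :=
    { toFun := fun v k => ∑ j : I, aKer α k j * v j
      map_add' := fun v w => by
        funext k; simp only [Pi.add_apply, mul_add, Finset.sum_add_distrib]
      map_smul' := fun c v => by
        funext k
        simp only [Pi.smul_apply, Finset.smul_sum, mul_smul_comm, RingHom.id_apply] }
  obtain ⟨u, hu0, hu⟩ := exists_hasDerivAt_linear (LinearMap.toContinuousLinearMap Ll)
    (F := fun t (k : I) => f t k) (continuous_pi fun k => hfc k) (fun k => x k)
  have hud : ∀ (t : ℝ) (k : ℤ) (hk : k ∈ I), HasDerivAt (fun t => u t ⟨k, hk⟩)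
      (f t k - ∑ j : I, aKer α k j * u t j) t := fun t k hk =>
    (hasDerivAt_pi.1 (hu t)) ⟨k, hk⟩
  refine ⟨fun t k => if hk : k ∈ I then u t ⟨k, hk⟩ else 0, ?_, ?_, hf, ?_,
    fun k => (hfc k).continuousOn, ?_⟩
  · funext k
    by_cases hk : k ∈ I
    · simp [hk, hu0]
    · simp [hk, hx k hk]
  · exact fun t k hk => dif_neg hk
  · intro k
    by_cases hk : k ∈ I
    · simp only [hk, dif_pos]
      exact fun t _ => (hud t k hk).continuousAt.continuousWithinAt
    · simp only [hk, dif_neg, not_false_eq_true]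
      exact continuousOn_const
  · intro k hk t _
    have e1 : fapp (aKer α) I (fun k => if hk : k ∈ I then u t ⟨k, hk⟩ else 0) k =
        ∑ j : I, aKer α k j * u t j := by
      rw [fapp, ← Finset.sum_coe_sort]
      exact Finset.sum_congr rfl fun j _ => by simp
    rw [e1]
    simpa only [hk, dif_pos] using hud t k hk

/-- Passing to more modes, the neglected part of the operator appears as a forcing. -/
lemma IsGalerkin.extend {I J : Finset ℤ} {T : ℝ} {e h : ℝ → ℤ → ℂ} (hg : IsGalerkin α I T e h)
    (hIJ : I ⊆ J) :
    IsGalerkin α J T e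
      (fun t k => h t k + if k ∈ J ∧ k ∉ I then kapp (aKer α) (e t) k else 0) := by
  have hA : ∀ t, kapp (aKer α) (e t) = fapp (aKer α) I (e t) := fun t =>
    kapp_eq_fapp _ (hg.supp t)
  have hJ : ∀ t k, k ∉ J → e t k = 0 := fun t k hk => hg.supp t k fun h => hk (hIJ h)
  refine ⟨hJ, fun t k hk => ?_, hg.cont, fun k => ?_, fun k hk t ht => ?_⟩
  · simp [hk, hg.supp_forcing t k fun h => hk (hIJ h)]
  · refine (hg.cont_forcing k).add ?_
    by_cases hk : k ∈ J ∧ k ∉ I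
    · simp only [hk, not_false_eq_true, and_self, if_true, hA]
      exact continuousOn_finsetSum _ fun j _ => continuousOn_const.mul (hg.cont j)
    · simp only [hk, if_false]
      exact continuousOn_const
  · rw [← kapp_eq_fapp (aKer α) (hJ t), hA]
    by_cases hkI : k ∈ I
    · simpa [hkI, hk] using hg.hasDerivAt k hkI t ht
    · have : (fun t => e t k) = fun _ => 0 := funext fun t => hg.supp t k hkI
      rw [this]
      simpa [hkI, hk, hg.supp_forcing t k hkI] using hasDerivAt_const t (0 : ℂ)

/-- The Fourier modes `|k| ≤ N`. -/
noncomputable def modes (N : ℕ) : Finset ℤ := Finset.Icc (-(N : ℤ)) N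

lemma mem_modes {N : ℕ} {k : ℤ} : k ∈ modes N ↔ |k| ≤ N := by
  rw [modes, Finset.mem_Icc, abs_le]

lemma modes_mono {M N : ℕ} (h : M ≤ N) : modes M ⊆ modes N := fun k hk => by
  rw [mem_modes] at hk ⊢; exact hk.trans (by exact_mod_cast h)

/-- Truncated solutions for smooth data are approximate solutions for all larger truncations. -/
lemma exists_approx_of_smooth (hr : Rapid α) (hα : Herm α) (hμ : 0 < meanSq α) (s : ℝ) {T : ℝ}
    (hT : 0 < T) {n : ℕ} {x : ℤ → ℂ} {f : ℝ → ℤ → ℂ}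
    (hx : ∀ k ∉ modes n, x k = 0) (hf : ∀ t, ∀ k ∉ modes n, f t k = 0)
    (hfc : ∀ k, Continuous fun t => f t k) {δ : ℝ≥0∞} (hδ : 0 < δ) :
    ∃ (N : ℕ) (e : ℝ → ℤ → ℂ), e 0 = x ∧ (∀ t, ∀ k ∉ modes N, e t k = 0) ∧ ∀ M, N ≤ M →
      ∃ h, IsGalerkin α (modes M) T e h ∧
        ∫⁻ t in Icc 0 T, sobNormSq (s - 1 / 2) (h t - f t) ≤ δ := by
  -- The neglected modes are measured in H^{s-1/2}; one derivative buys the factor 1/N and the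
  -- generator costs two, hence s - 1/2 + 1 + 2.
  obtain ⟨C, hC, hen⟩ := energy_estimate hr hα hμ (s + 5 / 2)
  obtain ⟨A, hA⟩ := (isOrd_aKer hr).sobNormSq_kapp_le (s + 1 / 2)
  set B : ℝ≥0∞ := ENNReal.ofReal (C * Real.exp (C * T)) * (sobNormSq (s + 5 / 2) x +
    ∫⁻ τ in Icc 0 T, sobNormSq (s + 5 / 2 - 1 / 2) (f τ)) with hB
  have hBt : B < ⊤ := by
    refine ENNReal.mul_lt_top ENNReal.ofReal_lt_top (ENNReal.add_lt_top.2
      ⟨sobNormSq_finite_lt_top hx _, ?_⟩)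
    rw [lintegral_sobNormSq_eq hT.le (fun k => (hfc k).continuousOn) hf]
    exact ENNReal.ofReal_lt_top
  obtain ⟨N, hnN, hN0, hN⟩ : ∃ N : ℕ, n ≤ N ∧ 0 < N ∧
      ENNReal.ofReal (1 / N) * (A * B) * ENNReal.ofReal T ≤ δ := by
    have hlim : Tendsto (fun N : ℕ => ENNReal.ofReal (1 / N) * (A * B) * ENNReal.ofReal T) atTop
        (𝓝 (0 * (A * B) * ENNReal.ofReal T)) := by
      refine ENNReal.Tendsto.mul_const (ENNReal.Tendsto.mul_const ?_ (Or.inr ?_)) (Or.inr ?_)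
      · have := (ENNReal.continuous_ofReal.tendsto 0).comp tendsto_one_div_atTop_nhds_zero_nat
        simpa [Function.comp_def] using this
      · exact (ENNReal.mul_lt_top ENNReal.coe_lt_top hBt).ne
      · exact ENNReal.ofReal_ne_top
    rw [zero_mul, zero_mul] at hlim
    have h1 := hlim.eventually_le_const hδ
    obtain ⟨N, h1, h2⟩ := (h1.and (eventually_ge_atTop (n + 1))).exists
    exact ⟨N, by omega, by omega, h1⟩
  have hsub := modes_mono hnN
  have hfN : ∀ t, ∀ k ∉ modes N, f t k = 0 := fun t k hk => hf t k fun h => hk (hsub h)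
  obtain ⟨e, he0, he⟩ := exists_isGalerkin α (modes N) T (fun k hk => hx k fun h => hk (hsub h))
    hfN hfc
  refine ⟨N, e, he0, he.supp, fun M hM => ⟨_, he.extend (modes_mono hM), ?_⟩⟩
  have hpt : ∀ t ∈ Icc 0 T, sobNormSq (s - 1 / 2) ((fun k => f t k +
      if k ∈ modes M ∧ k ∉ modes N then kapp (aKer α) (e t) k else 0) - f t) ≤
      ENNReal.ofReal (1 / N) * (A * B) := by
    intro t ht
    refine (sobNormSq_tail_le hN0 (s - 1 / 2) (v := kapp (aKer α) (e t)) (fun k hk => ?_)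
      fun k => ?_).trans ?_
    · simp [mem_modes, hk]
    · simp only [Pi.sub_apply, add_sub_cancel_left]
      split_ifs
      · exact le_rfl
      · simp
    · have h1 := hA (e t)
      have h2 := hen (modes N) T e f he t ht
      rw [he0] at h2
      rw [show s - 1 / 2 + 1 = s + 1 / 2 by ring]
      rw [show s + 1 / 2 + 2 * 1 = s + 5 / 2 by ring] at h1
      gcongr
      exact h1.trans (by gcongr; exact le_self_add.trans h2)
  calc _ ≤ ∫⁻ _ in Icc 0 T, ENNReal.ofReal (1 / N) * (A * B) :=
        setLIntegral_mono measurable_const hpt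
    _ = ENNReal.ofReal (1 / N) * (A * B) * ENNReal.ofReal T := by simp
    _ ≤ δ := hN

end

section

/-! ### Approximation of the data -/

lemma aemeasurable_sobNormSq {ν : Measure ℝ} {u : ℝ → ℤ → ℂ}
    (hu : ∀ k, AEStronglyMeasurable (fun t => u t k) ν) (p : ℝ) :
    AEMeasurable (fun t => sobNormSq p (u t)) ν := by
  simp only [sobNormSq_eq]
  exact (AEMeasurable.tsum fun k => ((hu k).enorm.pow_const 2).const_mul _).const_mul _

lemma lintegral_sobNormSq {ν : Measure ℝ} {u : ℝ → ℤ → ℂ}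
    (hu : ∀ k, AEStronglyMeasurable (fun t => u t k) ν) (p : ℝ) :
    ∫⁻ t, sobNormSq p (u t) ∂ν = ∑' k : ℤ,
      ENNReal.ofReal (2 * Real.pi) * (ENNReal.ofReal (jap k ^ p) * ∫⁻ t, ‖u t k‖ₑ ^ 2 ∂ν) := by
  have h : ∀ k, AEMeasurable (fun t => ‖u t k‖ₑ ^ 2) ν := fun k => (hu k).enorm.pow_const 2
  simp only [sobNormSq_eq]
  rw [lintegral_const_mul'' _ (AEMeasurable.tsum fun k => (h k).const_mul _),
    lintegral_tsum fun k => (h k).const_mul _, ENNReal.tsum_mul_left]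
  congr 1
  exact tsum_congr fun k => lintegral_const_mul'' _ (h k)

lemma exists_modes_tail_le {c : ℤ → ℝ≥0∞} (hc : ∑' k, c k ≠ ⊤) {δ : ℝ≥0∞} (hδ : 0 < δ) :
    ∃ n, ∀ N, n ≤ N → ∑' k, (if k ∈ modes N then 0 else c k) ≤ δ := by
  have h := (ENNReal.tendsto_tsum_compl_atTop_zero hc).eventually_le_const hδ
  obtain ⟨S, hS⟩ := eventually_atTop.1 h
  obtain ⟨n, hn⟩ : ∃ n, S ⊆ modes n := by
    refine ⟨S.sup Int.natAbs, fun k hk => mem_modes.2 ?_⟩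
    rw [Int.abs_eq_natAbs]
    exact_mod_cast Finset.le_sup (f := Int.natAbs) hk
  refine ⟨n, fun N hN => ?_⟩
  have h1 := hS _ (hn.trans (modes_mono hN))
  have h2 := tsum_subtype {k | k ∉ modes N} c
  refine le_trans (le_of_eq (tsum_congr fun k => ?_)) (h2.symm.le.trans h1)
  by_cases hk : k ∈ modes N <;> simp [indicator, hk]

lemma lintegral_sq_lt_top {T p : ℝ} {g : ℝ → ℤ → ℂ} (hg : MemL2 p T g) :
    ∫⁻ t in Icc 0 T, sobNormSq p (g t) ≠ ⊤ := by
  intro h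
  have h2 := hg.2.2
  rw [normL2, h] at h2
  simp at h2

lemma exists_continuous_approx {T : ℝ} {γ : ℝ → ℂ}
    (hm : AEStronglyMeasurable γ (volume.restrict (Icc 0 T)))
    (hγ : ∫⁻ t in Icc 0 T, ‖γ t‖ₑ ^ 2 ≠ ⊤) {δ : ℝ≥0∞} (hδ : 0 < δ) :
    ∃ f : ℝ → ℂ, Continuous f ∧ ∫⁻ t in Icc 0 T, ‖f t - γ t‖ₑ ^ 2 ≤ δ := by
  have e : ∀ u : ℝ → ℂ, eLpNorm u 2 (volume.restrict (Icc 0 T)) =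
      (∫⁻ t in Icc 0 T, ‖u t‖ₑ ^ 2) ^ (1 / 2 : ℝ) := fun u => by
    rw [eLpNorm_eq_lintegral_rpow_enorm_toReal two_ne_zero ENNReal.ofNat_ne_top]
    simp
  have hL : MemLp γ 2 (volume.restrict (Icc 0 T)) := by
    refine ⟨hm, ?_⟩
    rw [e]
    exact ENNReal.rpow_lt_top_of_nonneg (by norm_num) hγ
  obtain ⟨f, hf, -⟩ := hL.exists_boundedContinuous_eLpNorm_sub_le ENNReal.ofNat_ne_top
    (ε := δ ^ (1 / 2 : ℝ)) (by
      rw [Ne, ENNReal.rpow_eq_zero_iff]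
      rintro (⟨h, -⟩ | ⟨-, h⟩)
      · exact hδ.ne' h
      · norm_num at h)
  refine ⟨f, f.continuous, ?_⟩
  rw [e, ENNReal.rpow_le_rpow_iff (by norm_num)] at hf
  refine le_trans (le_of_eq (lintegral_congr fun t => ?_)) hf
  rw [Pi.sub_apply, ← enorm_neg, neg_sub]

/-- High modes are cut off, and each of the finitely many remaining coefficients of `g` is replaced
by a function continuous in time, so that the truncated problem has a classical solution. -/
lemma exists_smooth_data {s p T : ℝ} {v₀ : ℤ → ℂ} {g : ℝ → ℤ → ℂ} (hv₀ : sobNormSq s v₀ < ⊤)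
    (hg : MemL2 p T g) {δ : ℝ≥0∞} (hδ : 0 < δ) :
    ∃ (n : ℕ) (x : ℤ → ℂ) (f : ℝ → ℤ → ℂ), (∀ k ∉ modes n, x k = 0) ∧
      (∀ t, ∀ k ∉ modes n, f t k = 0) ∧ (∀ k, Continuous fun t => f t k) ∧
      sobNormSq s (x - v₀) ≤ δ ∧ ∫⁻ t in Icc 0 T, sobNormSq p (f t - g t) ≤ δ := by
  have hgi := lintegral_sq_lt_top hg
  rw [lintegral_sobNormSq hg.1] at hgi
  have hvi : ∑' k : ℤ, ENNReal.ofReal (2 * Real.pi) *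
      (ENNReal.ofReal (jap k ^ s) * ‖v₀ k‖ₑ ^ 2) ≠ ⊤ := by
    rw [ENNReal.tsum_mul_left]; exact hv₀.ne
  have hδ2 : 0 < δ / 2 := ENNReal.half_pos hδ.ne'
  obtain ⟨n₁, h₁⟩ := exists_modes_tail_le hvi hδ
  obtain ⟨n₂, h₂⟩ := exists_modes_tail_le hgi hδ2
  set n := max n₁ n₂
  have hgk : ∀ k, ∫⁻ t in Icc 0 T, ‖g t k‖ₑ ^ 2 ≠ ⊤ := fun k h => by
    have := ENNReal.ne_top_of_tsum_ne_top hgi k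
    rw [h, ENNReal.mul_top (by simpa using jap_rpow_pos k p),
      ENNReal.mul_top two_pi_ofReal_ne_zero] at this
    exact this rfl
  set W := ∑ k ∈ modes n, ENNReal.ofReal (2 * Real.pi) * ENNReal.ofReal (jap k ^ p) with hW
  have hWt : W ≠ ⊤ := ENNReal.sum_ne_top.2 fun k _ =>
    ENNReal.mul_ne_top ENNReal.ofReal_ne_top ENNReal.ofReal_ne_top
  choose φ hφc hφ using fun k => exists_continuous_approx (hg.1 k) (hgk k)
    (ENNReal.div_pos hδ2.ne' hWt)
  refine ⟨n, fun k => if k ∈ modes n then v₀ k else 0, fun t k => if k ∈ modes n then φ k t else 0,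
    fun k hk => if_neg hk, fun t k hk => if_neg hk, fun k => ?_, ?_, ?_⟩
  · by_cases hk : k ∈ modes n
    · simpa only [hk, if_true] using hφc k
    · simpa only [hk, if_false] using continuous_const
  · refine le_trans (le_of_eq ?_) (h₁ n (le_max_left _ _))
    rw [sobNormSq_eq, ← ENNReal.tsum_mul_left]
    refine tsum_congr fun k => ?_
    by_cases hk : k ∈ modes n <;> simp [hk]
  · rw [lintegral_sobNormSq fun k => ?_]
    swap
    · refine AEStronglyMeasurable.sub ?_ (hg.1 k)
      by_cases hk : k ∈ modes n
      · simpa only [hk, if_true] using (hφc k).aestronglyMeasurable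
      · simpa only [hk, if_false] using aestronglyMeasurable_const
    calc _ ≤ ∑' k : ℤ, ((if k ∈ modes n then ENNReal.ofReal (2 * Real.pi) *
            ENNReal.ofReal (jap k ^ p) * (δ / 2 / W) else 0) +
          (if k ∈ modes n then 0 else ENNReal.ofReal (2 * Real.pi) *
            (ENNReal.ofReal (jap k ^ p) * ∫⁻ t in Icc 0 T, ‖g t k‖ₑ ^ 2))) := by
          refine ENNReal.tsum_le_tsum fun k => ?_
          by_cases hk : k ∈ modes n
          · simp only [hk, if_true, add_zero, Pi.sub_apply, mul_assoc]
            gcongr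
            exact hφ k
          · simp [hk]
      _ ≤ δ / 2 + δ / 2 := by
          rw [ENNReal.tsum_add]
          refine add_le_add ?_ (h₂ n (le_max_right _ _))
          rw [tsum_eq_sum (s := modes n) fun k hk => if_neg hk,
            Finset.sum_congr rfl fun k hk => if_pos hk, ← Finset.sum_mul]
          exact ENNReal.mul_div_le
      _ = δ := ENNReal.add_halves δ

variable {α : ℤ → ℂ}

lemma lintegral_sobNormSq_sub_le {ν : Measure ℝ} {u v w : ℝ → ℤ → ℂ}
    (hu : ∀ k, AEStronglyMeasurable (fun t => u t k) ν)
    (hw : ∀ k, AEStronglyMeasurable (fun t => w t k) ν) (p : ℝ) :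
    ∫⁻ t, sobNormSq p (u t - v t) ∂ν ≤ 2 * ∫⁻ t, sobNormSq p (u t - w t) ∂ν +
      2 * ∫⁻ t, sobNormSq p (w t - v t) ∂ν := by
  have hm := aemeasurable_sobNormSq (u := fun t => u t - w t)
    (fun k => (hu k).sub (hw k)) p
  rw [← lintegral_const_mul'' _ hm, ← lintegral_const_mul' _ _ ENNReal.ofNat_ne_top,
    ← lintegral_add_left' (hm.const_mul _)]
  refine lintegral_mono fun t => ?_
  have := sobNormSq_add_le p (u t - w t) (w t - v t)
  rwa [sub_add_sub_cancel] at this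

lemma IsGalerkin.aestronglyMeasurable {I : Finset ℤ} {T : ℝ} {e h : ℝ → ℤ → ℂ}
    (hg : IsGalerkin α I T e h) (k : ℤ) :
    AEStronglyMeasurable (fun t => e t k) (volume.restrict (Icc 0 T)) :=
  (hg.cont k).aestronglyMeasurable measurableSet_Icc

lemma IsGalerkin.aestronglyMeasurable_forcing {I : Finset ℤ} {T : ℝ} {e h : ℝ → ℤ → ℂ}
    (hg : IsGalerkin α I T e h) (k : ℤ) :
    AEStronglyMeasurable (fun t => h t k) (volume.restrict (Icc 0 T)) :=
  (hg.cont_forcing k).aestronglyMeasurable measurableSet_Icc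

/-- Approximate solutions for general data. -/
lemma exists_approx (hr : Rapid α) (hα : Herm α) (hμ : 0 < meanSq α) {s T : ℝ} (hT : 0 < T)
    {v₀ : ℤ → ℂ} {g : ℝ → ℤ → ℂ} (hv₀ : sobNormSq s v₀ < ⊤) (hg : MemL2 (s - 1 / 2) T g)
    {δ : ℝ≥0∞} (hδ : 0 < δ) :
    ∃ (N : ℕ) (e : ℝ → ℤ → ℂ), sobNormSq s (e 0 - v₀) ≤ δ ∧ ∀ M, N ≤ M →
      ∃ h, IsGalerkin α (modes M) T e h ∧
        ∫⁻ t in Icc 0 T, sobNormSq (s - 1 / 2) (h t - g t) ≤ δ := by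
  have hδ4 : 0 < δ / 4 := ENNReal.div_pos hδ.ne' ENNReal.ofNat_ne_top
  obtain ⟨n, x, f, hx, hf, hfc, hxv, hfg⟩ := exists_smooth_data hv₀ hg hδ4
  obtain ⟨N, e, he0, -, he⟩ := exists_approx_of_smooth hr hα hμ s hT hx hf hfc hδ4
  refine ⟨N, e, ?_, fun M hM => ?_⟩
  · rw [he0]; exact hxv.trans (ENNReal.div_le_of_le_mul (le_mul_of_one_le_right zero_le (by norm_num)))
  obtain ⟨h, hgal, hh⟩ := he M hM
  refine ⟨h, hgal, (lintegral_sobNormSq_sub_le hgal.aestronglyMeasurable_forcing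
    (fun k => (hfc k).aestronglyMeasurable) _).trans ?_⟩
  calc _ ≤ 2 * (δ / 4) + 2 * (δ / 4) := by gcongr
    _ = 4 * (δ / 4) := by ring
    _ ≤ δ := ENNReal.mul_div_le

end

section

/-! ### Passage to the limit -/

/-- Fatou's lemma for the counting measure; coefficientwise convergence is thus enough to pass to
the limit in all norms. -/
lemma sobNormSq_le_liminf {p : ℝ} {u : ℕ → ℤ → ℂ} {v : ℤ → ℂ}
    (h : ∀ k, Tendsto (fun n => u n k) atTop (𝓝 (v k))) :
    sobNormSq p v ≤ liminf (fun n => sobNormSq p (u n)) atTop := by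
  have e : ∀ w : ℤ → ℂ, sobNormSq p w = ∫⁻ k, ENNReal.ofReal (2 * Real.pi) *
      (ENNReal.ofReal (jap k ^ p) * ‖w k‖ₑ ^ 2) ∂(Measure.count : Measure ℤ) := fun w => by
    rw [lintegral_count, ENNReal.tsum_mul_left, sobNormSq_eq]
  simp only [e]
  refine le_trans (le_of_eq (lintegral_congr fun k => ?_))
    (lintegral_liminf_le fun n => measurable_of_countable _)
  refine (Tendsto.liminf_eq ?_).symm
  refine ENNReal.Tendsto.const_mul (ENNReal.Tendsto.const_mul ?_ (Or.inr ENNReal.ofReal_ne_top))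
    (Or.inr ENNReal.ofReal_ne_top)
  exact ((ENNReal.continuous_pow 2).tendsto _).comp
    ((continuous_enorm.tendsto (v k)).comp (h k))

lemma eq_zero_of_forall_le_mul {x c : ℝ≥0∞} (hc : c ≠ ⊤) (h : ∀ ρ : ℝ≥0∞, 0 < ρ → x ≤ c * ρ) :
    x = 0 := by
  have h1 : Tendsto (fun n : ℕ => c * (n : ℝ≥0∞)⁻¹) atTop (𝓝 (c * 0)) :=
    ENNReal.Tendsto.const_mul ENNReal.tendsto_inv_nat_nhds_zero (Or.inr hc)
  rw [mul_zero] at h1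
  exact le_antisymm (ge_of_tendsto' h1 fun n => h _ (by simp)) zero_le

lemma le_of_forall_le_add_mul {x y c : ℝ≥0∞} (hc : c ≠ ⊤)
    (h : ∀ ρ : ℝ≥0∞, 0 < ρ → x ≤ y + c * ρ) : x ≤ y := by
  have h1 : Tendsto (fun n : ℕ => y + c * (n : ℝ≥0∞)⁻¹) atTop (𝓝 (y + c * 0)) :=
    tendsto_const_nhds.add (ENNReal.Tendsto.const_mul ENNReal.tendsto_inv_nat_nhds_zero (Or.inr hc))
  rw [mul_zero, add_zero] at h1
  exact ge_of_tendsto' h1 fun n => h _ (by simp)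

variable {α : ℤ → ℂ}

lemma IsGalerkin.sub {I : Finset ℤ} {T : ℝ} {e h e' h' : ℝ → ℤ → ℂ} (hg : IsGalerkin α I T e h)
    (hg' : IsGalerkin α I T e' h') :
    IsGalerkin α I T (fun t => e t - e' t) (fun t => h t - h' t) := by
  refine ⟨fun t k hk => ?_, fun t k hk => ?_, fun k => (hg.cont k).sub (hg'.cont k),
    fun k => (hg.cont_forcing k).sub (hg'.cont_forcing k), fun k hk t ht => ?_⟩
  · simp [hg.supp t k hk, hg'.supp t k hk]
  · simp [hg.supp_forcing t k hk, hg'.supp_forcing t k hk]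
  · have h1 := (hg.hasDerivAt k hk t ht).sub (hg'.hasDerivAt k hk t ht)
    have h2 : fapp (aKer α) I (e t - e' t) k = fapp (aKer α) I (e t) k - fapp (aKer α) I (e' t) k := by
      simp only [fapp, Pi.sub_apply, mul_sub, Finset.sum_sub_distrib]
    rw [h2, Pi.sub_apply, sub_sub_sub_comm]
    exact h1

/-- `v` is a limit in `Z_{s,T}` of solutions of truncated problems whose data converge. -/
def IsLimit (α : ℤ → ℂ) (s T : ℝ) (v₀ : ℤ → ℂ) (g v : ℝ → ℤ → ℂ) : Prop :=
  ∀ ρ : ℝ≥0∞, 0 < ρ → ∃ (N : ℕ) (e : ℝ → ℤ → ℂ),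
    (∀ t ∈ Icc 0 T, sobNormSq s (v t - e t) ≤ ρ) ∧
    ∫⁻ t in Icc 0 T, sobNormSq (s + 1 / 2) (v t - e t) ≤ ρ ∧
    sobNormSq s (e 0 - v₀) ≤ ρ ∧
    ∀ M, N ≤ M → ∃ h, IsGalerkin α (modes M) T e h ∧
      ∫⁻ t in Icc 0 T, sobNormSq (s - 1 / 2) (h t - g t) ≤ ρ

/-- The approximations are Cauchy by the energy estimate for their differences. Only limits of
single coefficients are constructed; the bounds on the distance to the limit then follow by lower
semicontinuity. -/
lemma exists_isLimit (hr : Rapid α) (hα : Herm α) (hμ : 0 < meanSq α) {s T : ℝ} (hT : 0 < T)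
    {v₀ : ℤ → ℂ} {g : ℝ → ℤ → ℂ} (hv₀ : sobNormSq s v₀ < ⊤) (hg : MemL2 (s - 1 / 2) T g) :
    ∃ v, IsLimit α s T v₀ g v := by
  obtain ⟨C, hC, hen⟩ := energy_estimate hr hα hμ s
  set C₁ := ENNReal.ofReal (C * Real.exp (C * T)) with hC₁
  have hC₁t : C₁ ≠ ⊤ := ENNReal.ofReal_ne_top
  set δ : ℕ → ℝ≥0∞ := fun n => (n : ℝ≥0∞)⁻¹ with hδ
  have hδ0 : ∀ n, 0 < δ n := fun n => by simp [hδ]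
  have hδlim : Tendsto δ atTop (𝓝 0) := ENNReal.tendsto_inv_nat_nhds_zero
  choose N e he0 he using fun n => exists_approx hr hα hμ hT hv₀ hg (hδ0 n)
  have hcauchy : ∀ n m, ∀ t ∈ Icc 0 T, sobNormSq s (e n t - e m t) +
      ∫⁻ τ in Icc 0 T, sobNormSq (s + 1 / 2) (e n τ - e m τ) ≤
        C₁ * (4 * δ n + 4 * δ m) := by
    intro n m t ht
    -- Both approximations are viewed in the same truncation, so their difference solves a truncated
    -- problem with the difference of the forcings.
    obtain ⟨h, hgal, hh⟩ := he n (max (N n) (N m)) (le_max_left _ _)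
    obtain ⟨h', hgal', hh'⟩ := he m (max (N n) (N m)) (le_max_right _ _)
    refine (hen _ T _ _ (hgal.sub hgal') t ht).trans (mul_le_mul_right ?_ _)
    have i1 : sobNormSq s (e n 0 - e m 0) ≤ 2 * δ n + 2 * δ m := by
      have := sobNormSq_sub_le s (e n 0 - v₀) (e m 0 - v₀)
      rw [sub_sub_sub_cancel_right] at this
      exact this.trans (by gcongr; exacts [he0 n, he0 m])
    have i2 : ∫⁻ τ in Icc 0 T, sobNormSq (s - 1 / 2) (h τ - h' τ) ≤ 2 * δ n + 2 * δ m := by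
      refine (lintegral_sobNormSq_sub_le hgal.aestronglyMeasurable_forcing hg.1 _).trans ?_
      gcongr
      refine le_trans (le_of_eq (lintegral_congr fun τ => ?_)) hh'
      exact sobNormSq_sub_comm _ _ _
    calc _ ≤ (2 * δ n + 2 * δ m) + (2 * δ n + 2 * δ m) := add_le_add i1 i2
      _ = _ := by ring
  have hconv : ∀ t ∈ Icc 0 T, ∀ k, ∃ z, Tendsto (fun n => e n t k) atTop (𝓝 z) := by
    intro t ht k
    apply cauchySeq_tendsto_of_complete
    set W := ENNReal.ofReal (jap k ^ (-s))
    rw [EMetric.cauchySeq_iff_le_tendsto_0]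
    refine ⟨fun n => (W * (C₁ * (8 * δ n))) ^ (1 / 2 : ℝ), fun n m q hn hm => ?_, ?_⟩
    · have hd : ∀ {a b : ℕ}, a ≤ b → δ b ≤ δ a := fun {a b} hab => by
        simp only [hδ]; exact ENNReal.inv_le_inv.2 (by exact_mod_cast hab)
      have h2 := (enorm_sq_le_sobNormSq s (e n t - e m t) k).trans
        (mul_le_mul_right (le_self_add.trans (hcauchy n m t ht)) _)
      rw [edist_eq_enorm_sub]
      have h3 : ‖e n t k - e m t k‖ₑ = (‖e n t k - e m t k‖ₑ ^ 2) ^ (1 / 2 : ℝ) := by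
        rw [← ENNReal.rpow_natCast, ← ENNReal.rpow_mul]; norm_num
      rw [h3]
      refine ENNReal.rpow_le_rpow (h2.trans ?_) (by norm_num)
      gcongr
      calc 4 * δ n + 4 * δ m ≤ 4 * δ q + 4 * δ q := by gcongr <;> exact hd ‹_›
        _ = 8 * δ q := by ring
    · have h1 : Tendsto (fun n => W * (C₁ * (8 * δ n))) atTop (𝓝 (W * (C₁ * (8 * 0)))) :=
        ENNReal.Tendsto.const_mul (ENNReal.Tendsto.const_mul (ENNReal.Tendsto.const_mul hδlim
          (Or.inr ENNReal.ofNat_ne_top)) (Or.inr hC₁t)) (Or.inr ENNReal.ofReal_ne_top)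
      have h2 := h1.ennrpow_const (1 / 2)
      simpa using h2
  have hv : ∃ v : ℝ → ℤ → ℂ, ∀ t ∈ Icc 0 T, ∀ k, Tendsto (fun n => e n t k) atTop (𝓝 (v t k)) := by
    refine ⟨fun t k => limUnder atTop fun n => e n t k, fun t ht k => ?_⟩
    exact tendsto_nhds_limUnder (hconv t ht k)
  obtain ⟨v, hv⟩ := hv
  have hlimn : ∀ n, Tendsto (fun m => C₁ * (4 * δ m + 4 * δ n)) atTop (𝓝 (C₁ * (4 * δ n))) := by
    intro n
    have : Tendsto (fun m => C₁ * (4 * δ m + 4 * δ n)) atTop (𝓝 (C₁ * (4 * 0 + 4 * δ n))) :=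
      ENNReal.Tendsto.const_mul ((ENNReal.Tendsto.const_mul hδlim
        (Or.inr ENNReal.ofNat_ne_top)).add tendsto_const_nhds) (Or.inr hC₁t)
    simpa using this
  have hlim1 : ∀ n, ∀ t ∈ Icc 0 T, ∀ p, sobNormSq p (v t - e n t) ≤
      liminf (fun m => sobNormSq p (e m t - e n t)) atTop := fun n t ht p =>
    sobNormSq_le_liminf fun k => (hv t ht k).sub_const _
  have hvn : ∀ n, ∀ t ∈ Icc 0 T, sobNormSq s (v t - e n t) ≤ C₁ * (4 * δ n) := fun n t ht => by
    refine (hlim1 n t ht s).trans ?_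
    rw [← (hlimn n).liminf_eq]
    exact liminf_le_liminf (Eventually.of_forall fun m =>
      le_self_add.trans (hcauchy m n t ht))
  have hmeas : ∀ n k, AEStronglyMeasurable (fun t => e n t k) (volume.restrict (Icc 0 T)) :=
    fun n k => by
      obtain ⟨h, hgal, -⟩ := he n _ le_rfl
      exact hgal.aestronglyMeasurable k
  have hvn2 : ∀ n, ∫⁻ t in Icc 0 T, sobNormSq (s + 1 / 2) (v t - e n t) ≤ C₁ * (4 * δ n) :=
    fun n => by
      calc _ ≤ ∫⁻ t in Icc 0 T, liminf (fun m => sobNormSq (s + 1 / 2) (e m t - e n t)) atTop :=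
            setLIntegral_mono' measurableSet_Icc fun t ht => hlim1 n t ht _
        _ ≤ liminf (fun m => ∫⁻ t in Icc 0 T, sobNormSq (s + 1 / 2) (e m t - e n t)) atTop :=
            lintegral_liminf_le' fun m => aemeasurable_sobNormSq
              (fun k => (hmeas m k).sub (hmeas n k)) _
        _ ≤ _ := by
            rw [← (hlimn n).liminf_eq]
            exact liminf_le_liminf (Eventually.of_forall fun m =>
              le_add_self.trans (hcauchy m n 0 ⟨le_rfl, hT.le⟩))
  refine ⟨v, fun ρ hρ => ?_⟩
  have h1 : Tendsto (fun n => C₁ * (4 * δ n)) atTop (𝓝 0) := by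
    have : Tendsto (fun n => C₁ * (4 * δ n)) atTop (𝓝 (C₁ * (4 * 0))) :=
      ENNReal.Tendsto.const_mul (ENNReal.Tendsto.const_mul hδlim
        (Or.inr ENNReal.ofNat_ne_top)) (Or.inr hC₁t)
    simpa using this
  obtain ⟨n, hn1, hn2⟩ := ((h1.eventually_le_const hρ).and (hδlim.eventually_le_const hρ)).exists
  refine ⟨N n, e n, fun t ht => (hvn n t ht).trans hn1, (hvn2 n).trans hn1, (he0 n).trans hn2,
    fun M hM => ?_⟩
  obtain ⟨h, hgal, hh⟩ := he n M hM
  exact ⟨h, hgal, hh.trans hn2⟩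

/-- The a priori estimate for limits. -/
lemma IsLimit.estimate (hr : Rapid α) (hα : Herm α) (hμ : 0 < meanSq α) (s : ℝ) :
    ∃ C : ℝ, 0 ≤ C ∧ ∀ (T : ℝ) (v₀ : ℤ → ℂ) (g v : ℝ → ℤ → ℂ), 0 < T → MemL2 (s - 1 / 2) T g →
      IsLimit α s T v₀ g v → (∀ k, ContinuousOn (fun t => v t k) (Icc 0 T)) → ∀ t ∈ Icc 0 T,
      sobNormSq s (v t) + ∫⁻ τ in Icc 0 T, sobNormSq (s + 1 / 2) (v τ) ≤
        ENNReal.ofReal (C * Real.exp (C * T)) *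
          (sobNormSq s v₀ + ∫⁻ τ in Icc 0 T, sobNormSq (s - 1 / 2) (g τ)) := by
  obtain ⟨C, hC, hen⟩ := energy_estimate hr hα hμ s
  -- The inequality ‖x + y‖² ≤ 2‖x‖² + 2‖y‖² is used twice, for the data and for the solution; this
  -- avoids square roots and costs 4.
  refine ⟨4 * C, by positivity, fun T v₀ g v hT hg hl hv t ht => ?_⟩
  set C₁ := ENNReal.ofReal (C * Real.exp (C * T)) with hC₁
  have hC₁' : 4 * C₁ ≤ ENNReal.ofReal (4 * C * Real.exp (4 * C * T)) := by
    rw [hC₁, ← ENNReal.ofReal_ofNat 4, ← ENNReal.ofReal_mul (by norm_num), ← mul_assoc]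
    apply ENNReal.ofReal_le_ofReal
    have : C * T ≤ 4 * C * T := by nlinarith
    gcongr
  set V := sobNormSq s v₀
  set Gn := ∫⁻ τ in Icc 0 T, sobNormSq (s - 1 / 2) (g τ)
  refine le_trans ?_ (mul_le_mul_left hC₁' _)
  refine le_of_forall_le_add_mul (c := 4 + 8 * C₁) (by finiteness) fun ρ hρ => ?_
  obtain ⟨N, e, h1, h2, h3, h4⟩ := hl ρ hρ
  obtain ⟨h, hgal, hh⟩ := h4 N le_rfl
  have i1 := hen _ T e h hgal t ht
  have i2 : sobNormSq s (e 0) ≤ 2 * ρ + 2 * V := by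
    have := sobNormSq_add_le s (e 0 - v₀) v₀
    rw [sub_add_cancel] at this
    exact this.trans (by gcongr)
  have zero_int : ∀ (p : ℝ) (u : ℝ → ℤ → ℂ), ∫⁻ τ in Icc 0 T, sobNormSq p (u τ - 0) =
      ∫⁻ τ in Icc 0 T, sobNormSq p (u τ) := fun p u => by simp only [sub_zero]
  have i3 : ∫⁻ τ in Icc 0 T, sobNormSq (s - 1 / 2) (h τ) ≤ 2 * ρ + 2 * Gn := by
    have := lintegral_sobNormSq_sub_le (v := fun _ => 0) hgal.aestronglyMeasurable_forcing hg.1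
      (s - 1 / 2)
    rw [zero_int, zero_int] at this
    exact this.trans (by gcongr)
  have i4 : sobNormSq s (v t) ≤ 2 * ρ + 2 * sobNormSq s (e t) := by
    have := sobNormSq_add_le s (v t - e t) (e t)
    rw [sub_add_cancel] at this
    exact this.trans (by gcongr; exact h1 t ht)
  have i5 : ∫⁻ τ in Icc 0 T, sobNormSq (s + 1 / 2) (v τ) ≤ 2 * ρ +
      2 * ∫⁻ τ in Icc 0 T, sobNormSq (s + 1 / 2) (e τ) := by
    have := lintegral_sobNormSq_sub_le (v := fun _ => 0)
      (fun k => (hv k).aestronglyMeasurable measurableSet_Icc) hgal.aestronglyMeasurable (s + 1 / 2)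
    rw [zero_int, zero_int] at this
    exact this.trans (by gcongr)
  calc _ ≤ (2 * ρ + 2 * sobNormSq s (e t)) + (2 * ρ +
        2 * ∫⁻ τ in Icc 0 T, sobNormSq (s + 1 / 2) (e τ)) := add_le_add i4 i5
    _ = 4 * ρ + 2 * (sobNormSq s (e t) + ∫⁻ τ in Icc 0 T, sobNormSq (s + 1 / 2) (e τ)) := by ring
    _ ≤ 4 * ρ + 2 * (C₁ * ((2 * ρ + 2 * V) + (2 * ρ + 2 * Gn))) := by
        gcongr
        exact i1.trans (by gcongr)
    _ = _ := by ring

end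

section

/-! ### Continuity in time -/

/-- Continuity expressed with squared norms, the form in which all estimates are available. -/
lemma memC_iff {σ T : ℝ} {v : ℝ → ℤ → ℂ} : MemC σ T v ↔ (∀ t ∈ Icc 0 T, MemH0 σ (v t)) ∧
    ∀ t₀ ∈ Icc 0 T, Tendsto (fun t => sobNormSq σ (v t - v t₀)) (𝓝[Icc 0 T] t₀) (𝓝 0) := by
  refine and_congr_right fun _ => forall₂_congr fun t₀ _ => ⟨fun h => ?_, fun h => ?_⟩
  · have h2 := ((ENNReal.continuous_pow 2).tendsto 0).comp h
    simpa [Function.comp_def, sobNorm_sq] using h2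
  · have h2 := h.ennrpow_const (1 / 2)
    simpa [sobNorm] using h2

lemma IsOrd.enorm_kapp_sq_le {p : ℝ} {K : ℤ → ℤ → ℂ} (hK : IsOrd p K) (r : ℝ) (k : ℤ) :
    ∃ C : ℝ≥0∞, C ≠ ⊤ ∧ ∀ u, ‖kapp K u k‖ₑ ^ 2 ≤ C * sobNormSq r u := by
  obtain ⟨C, hC⟩ := hK.sobNormSq_kapp_le (r - 2 * p)
  refine ⟨ENNReal.ofReal (jap k ^ (-(r - 2 * p))) * C,
    ENNReal.mul_ne_top ENNReal.ofReal_ne_top ENNReal.coe_ne_top, fun u => ?_⟩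
  have h := hC u
  rw [sub_add_cancel] at h
  rw [mul_assoc]
  exact (enorm_sq_le_sobNormSq _ _ k).trans (by gcongr)

lemma tendsto_of_enorm_sq_le {X : Type*} {l : Filter X} {f : X → ℂ} {z : ℂ} {b : X → ℝ≥0∞}
    {C : ℝ≥0∞} (hC : C ≠ ⊤) (hb : Tendsto b l (𝓝 0)) (h : ∀ᶠ x in l, ‖f x - z‖ₑ ^ 2 ≤ C * b x) :
    Tendsto f l (𝓝 z) := by
  rw [tendsto_iff_edist_tendsto_0]
  have h1 : Tendsto (fun x => C * b x) l (𝓝 (C * 0)) := ENNReal.Tendsto.const_mul hb (Or.inr hC)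
  have h2 := h1.ennrpow_const (1 / 2)
  rw [mul_zero, ENNReal.zero_rpow_of_pos (by norm_num)] at h2
  refine tendsto_of_tendsto_of_tendsto_of_le_of_le' tendsto_const_nhds h2
    (Eventually.of_forall fun _ => zero_le) (h.mono fun x hx => ?_)
  have h3 : ‖f x - z‖ₑ = (‖f x - z‖ₑ ^ 2) ^ (1 / 2 : ℝ) := by
    rw [← ENNReal.rpow_natCast, ← ENNReal.rpow_mul]; norm_num
  rw [edist_eq_enorm_sub, h3]
  exact ENNReal.rpow_le_rpow hx (by norm_num)

lemma IsOrd.kapp_sub {p r : ℝ} {K : ℤ → ℤ → ℂ} (hK : IsOrd p K) {u v : ℤ → ℂ}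
    (hu : sobNormSq r u < ⊤) (hv : sobNormSq r v < ⊤) (k : ℤ) :
    kapp K (u - v) k = kapp K u k - kapp K v k := by
  simp only [kapp, Pi.sub_apply, mul_sub]
  exact (hK.summable_kapp' hu k).tsum_sub (hK.summable_kapp' hv k)

lemma MemC.continuousOn {r T : ℝ} {v : ℝ → ℤ → ℂ} (hv : MemC r T v) (k : ℤ) :
    ContinuousOn (fun t => v t k) (Icc 0 T) := fun t₀ ht₀ =>
  tendsto_of_enorm_sq_le (C := ENNReal.ofReal (jap k ^ (-r))) ENNReal.ofReal_ne_top
    ((memC_iff.1 hv).2 t₀ ht₀)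
    (Eventually.of_forall fun t => enorm_sq_le_sobNormSq r (v t - v t₀) k)

lemma MemC.continuousOn_kapp {p r T : ℝ} {K : ℤ → ℤ → ℂ} (hK : IsOrd p K) {v : ℝ → ℤ → ℂ}
    (hv : MemC r T v) (k : ℤ) : ContinuousOn (fun t => kapp K (v t) k) (Icc 0 T) := by
  intro t₀ ht₀
  obtain ⟨C, hC, h⟩ := hK.enorm_kapp_sq_le r k
  refine tendsto_of_enorm_sq_le hC ((memC_iff.1 hv).2 t₀ ht₀) ?_
  filter_upwards [self_mem_nhdsWithin] with t ht
  rw [← hK.kapp_sub (hv.1 t ht).2 (hv.1 t₀ ht₀).2]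
  exact h _

lemma MemC.sub {r T : ℝ} {v w : ℝ → ℤ → ℂ} (hv : MemC r T v) (hw : MemC r T w) :
    MemC r T (fun t => v t - w t) := by
  rw [memC_iff] at *
  refine ⟨fun t ht => ⟨by simp [(hv.1 t ht).1, (hw.1 t ht).1], ?_⟩, fun t₀ ht₀ => ?_⟩
  · refine (sobNormSq_sub_le r _ _).trans_lt ?_
    have h1 := (hv.1 t ht).2
    have h2 := (hw.1 t ht).2
    finiteness
  · have h1 : Tendsto (fun t => 2 * sobNormSq r (v t - v t₀) + 2 * sobNormSq r (w t - w t₀))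
        (𝓝[Icc 0 T] t₀) (𝓝 (2 * 0 + 2 * 0)) :=
      (ENNReal.Tendsto.const_mul (hv.2 t₀ ht₀) (Or.inr ENNReal.ofNat_ne_top)).add
        (ENNReal.Tendsto.const_mul (hw.2 t₀ ht₀) (Or.inr ENNReal.ofNat_ne_top))
    rw [mul_zero, add_zero] at h1
    refine tendsto_of_tendsto_of_tendsto_of_le_of_le tendsto_const_nhds h1 (fun _ => zero_le)
      fun t => ?_
    rw [sub_sub_sub_comm]
    exact sobNormSq_sub_le r _ _

lemma MemC.mono {r r' T : ℝ} (h : r' ≤ r) {v : ℝ → ℤ → ℂ} (hv : MemC r T v) : MemC r' T v := by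
  rw [memC_iff] at *
  refine ⟨fun t ht => ⟨(hv.1 t ht).1, (sobNormSq_mono h _).trans_lt (hv.1 t ht).2⟩,
    fun t₀ ht₀ => ?_⟩
  exact tendsto_of_tendsto_of_tendsto_of_le_of_le tendsto_const_nhds (hv.2 t₀ ht₀)
    (fun _ => zero_le) fun t => sobNormSq_mono h _

/-- Compactness of the time interval, continuity giving a local bound near each time. -/
lemma MemC.exists_bound {r T : ℝ} {v : ℝ → ℤ → ℂ} (hv : MemC r T v) :
    ∃ B : ℝ≥0∞, B < ⊤ ∧ ∀ t ∈ Icc 0 T, sobNormSq r (v t) ≤ B := by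
  refine isCompact_Icc.induction_on (p := fun S => ∃ B : ℝ≥0∞, B < ⊤ ∧ ∀ t ∈ S,
    sobNormSq r (v t) ≤ B) ⟨0, ENNReal.zero_lt_top, by simp⟩ ?_ ?_ ?_
  · rintro S S' hS ⟨B, hB, h⟩
    exact ⟨B, hB, fun t ht => h t (hS ht)⟩
  · rintro S S' ⟨B, hB, h⟩ ⟨B', hB', h'⟩
    refine ⟨max B B', max_lt hB hB', fun t ht => ?_⟩
    rcases ht with ht | ht
    · exact (h t ht).trans (le_max_left _ _)
    · exact (h' t ht).trans (le_max_right _ _)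
  · intro t₀ ht₀
    have h1 := ((memC_iff.1 hv).2 t₀ ht₀).eventually_le_const zero_lt_one
    refine ⟨_, h1, 2 * 1 + 2 * sobNormSq r (v t₀), ?_, fun t ht => ?_⟩
    · have h2 := (hv.1 t₀ ht₀).2
      finiteness
    · have h2 := sobNormSq_add_le r (v t - v t₀) (v t₀)
      rw [sub_add_cancel] at h2
      exact h2.trans (by gcongr; exact ht)

variable {α : ℤ → ℂ}

/-! ### Uniqueness -/

/-- Uniqueness for the homogeneous equation with vanishing initial value. -/
lemma eq_zero_of_integral_eq (hr : Rapid α) (hα : Herm α) (hμ : 0 < meanSq α) {r T : ℝ}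
    {d : ℝ → ℤ → ℂ} (hd : MemC r T d)
    (heq : ∀ t ∈ Icc 0 T, ∀ k, d t k = -∫ τ in (0 : ℝ)..t, kapp (aKer α) (d τ) k) :
    ∀ t ∈ Icc 0 T, ∀ k, d t k = 0 := by
  intro t ht k
  have hT : 0 ≤ T := ht.1.trans ht.2
  have hord := isOrd_aKer hr
  -- The generator costs two derivatives and the rate 1/N one more, so the truncation error is small
  -- in H^{r-3} = H^{σ-1/2} with σ = r - 5/2.
  obtain ⟨C, hC, hen⟩ := energy_estimate hr hα hμ (r - 5 / 2)
  obtain ⟨A, hA⟩ := hord.sobNormSq_kapp_le (r - 3)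
  obtain ⟨B, hB, hdB⟩ := hd.exists_bound
  have hkc := fun k => hd.continuousOn_kapp hord k
  have key : ∀ N : ℕ, 0 < N → k ∈ modes N → sobNormSq (r - 5 / 2)
      (fun k => if k ∈ modes N then d t k else 0) ≤
      ENNReal.ofReal (C * Real.exp (C * T)) * (A * (ENNReal.ofReal (1 / N) * B) *
        ENNReal.ofReal T) := by
    intro N hN _
    set e : ℝ → ℤ → ℂ := fun t k => if k ∈ modes N then d t k else 0 with he
    -- With Π the truncation and A the generator, Πd solves the truncated problem with forcing -ΠA(1
    -- - Π)d.
    set h : ℝ → ℤ → ℂ := fun t k => if k ∈ modes N then -kapp (aKer α) (d t - e t) k else 0 with hh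
    have hes : ∀ t, ∀ k ∉ modes N, e t k = 0 := fun t k hk => if_neg hk
    have hsplit : ∀ t ∈ Icc 0 T, ∀ k, kapp (aKer α) (d t - e t) k =
        kapp (aKer α) (d t) k - fapp (aKer α) (modes N) (e t) k := fun t ht k => by
      rw [hord.kapp_sub (hd.1 t ht).2 (sobNormSq_finite_lt_top (hes t) r), kapp_eq_fapp _ (hes t)]
    have hec : ∀ k, ContinuousOn (fun t => e t k) (Icc 0 T) := fun k => by
      by_cases hk : k ∈ modes N
      · simpa only [he, hk, if_true] using hd.continuousOn k
      · simpa only [he, hk, if_false] using continuousOn_const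
    have hgal : IsGalerkin α (modes N) T e h := by
      refine ⟨hes, fun t k hk => if_neg hk, hec, fun k => ?_, fun k hk t ht => ?_⟩
      · by_cases hk : k ∈ modes N
        · simp only [hh, hk, if_true]
          refine ContinuousOn.neg (ContinuousOn.congr (f := fun t => kapp (aKer α) (d t) k -
            fapp (aKer α) (modes N) (e t) k) ?_ fun t ht => hsplit t ht k)
          exact (hkc k).sub (continuousOn_finsetSum _ fun j _ => continuousOn_const.mul (hec j))
        · simpa only [hh, hk, if_false] using continuousOn_const
      · have htI := Ioo_subset_Icc_self ht
        have hnh : Icc 0 T ∈ 𝓝 t := Icc_mem_nhds ht.1 ht.2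
        simp only [he, hh, hk, if_true]
        rw [hsplit t htI, neg_sub, sub_sub_cancel_left]
        have h1 : HasDerivAt (fun t => -∫ τ in (0 : ℝ)..t, kapp (aKer α) (d τ) k)
            (-kapp (aKer α) (d t) k) t :=
          (intervalIntegral.integral_hasDerivAt_right
            ((hkc k).mono (uIcc_subset_Icc ⟨le_rfl, hT⟩ htI)).intervalIntegrable
            (((hkc k).mono Ioo_subset_Icc_self).stronglyMeasurableAtFilter isOpen_Ioo t ht)
            ((hkc k).continuousAt hnh)).neg
        refine h1.congr_of_eventuallyEq ?_
        filter_upwards [hnh] with τ hτ using heq τ hτ k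
    have h0 : e 0 = 0 := by
      funext k
      by_cases hk : k ∈ modes N
      · simp only [he, hk, if_true]
        rw [heq 0 ⟨le_rfl, hT⟩]; simp
      · exact hes 0 k hk
    have h1 := hen _ T e h hgal t ht
    rw [h0, sobNormSq_zero, zero_add] at h1
    refine le_self_add.trans (h1.trans ?_)
    gcongr
    calc _ ≤ ∫⁻ _ in Icc 0 T, A * (ENNReal.ofReal (1 / N) * B) :=
          setLIntegral_mono measurable_const fun τ hτ => ?_
      _ = _ := by simp
    have h2 : sobNormSq (r - 3) (h τ) ≤ sobNormSq (r - 3) (kapp (aKer α) (d τ - e τ)) :=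
      sobNormSq_le_of_norm_le fun k => by
        simp only [hh]; split_ifs <;> simp
    have h3 := hA (d τ - e τ)
    have h4 : sobNormSq (r - 3 + 2 * 1) (d τ - e τ) ≤ ENNReal.ofReal (1 / N) * B := by
      refine (sobNormSq_tail_le hN _ (v := d τ) (fun k hk => ?_) fun k => ?_).trans ?_
      · simp [he, mem_modes, hk]
      · simp only [he, Pi.sub_apply]; split_ifs <;> simp
      · rw [show r - 3 + 2 * 1 + 1 = r by ring]
        gcongr
        exact hdB τ hτ
    rw [show r - 5 / 2 - 1 / 2 = r - 3 by ring]
    exact h2.trans (h3.trans (by gcongr))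
  set W := ENNReal.ofReal (jap k ^ (-(r - 5 / 2)))
  set K := W * (ENNReal.ofReal (C * Real.exp (C * T)) * (A * B * ENNReal.ofReal T)) with hK
  have hbound : ∀ N : ℕ, k.natAbs + 1 ≤ N → ‖d t k‖ₑ ^ 2 ≤ K * (N : ℝ≥0∞)⁻¹ := by
    intro N hN
    have hkN : k ∈ modes N := by
      rw [mem_modes, Int.abs_eq_natAbs]; exact_mod_cast (by omega : k.natAbs ≤ N)
    have h1 := (enorm_sq_le_sobNormSq (r - 5 / 2) (fun k => if k ∈ modes N then d t k else 0) k).trans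
      (mul_le_mul_right (key N (by omega) hkN) _)
    simp only [hkN, if_true] at h1
    refine h1.trans (le_of_eq ?_)
    rw [one_div, ENNReal.ofReal_inv_of_pos (by exact_mod_cast (by omega : 0 < N)),
      ENNReal.ofReal_natCast, hK]
    ring
  have hlim : Tendsto (fun N : ℕ => K * (N : ℝ≥0∞)⁻¹) atTop (𝓝 (K * 0)) :=
    ENNReal.Tendsto.const_mul ENNReal.tendsto_inv_nat_nhds_zero (Or.inr (by finiteness))
  rw [mul_zero] at hlim
  have h0 := ge_of_tendsto hlim ((eventually_ge_atTop _).mono hbound)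
  simpa using h0

/-! ### The integrated equation -/

lemma lintegral_enorm_le_sqrt {T : ℝ} {ν : Measure ℝ} (hν : ν ≤ volume.restrict (Icc 0 T))
    {f : ℝ → ℂ} (hf : AEStronglyMeasurable f ν) :
    ∫⁻ t, ‖f t‖ₑ ∂ν ≤ (∫⁻ t, ‖f t‖ₑ ^ 2 ∂ν) ^ (1 / 2 : ℝ) * ENNReal.ofReal T ^ (1 / 2 : ℝ) := by
  have h := ENNReal.lintegral_mul_le_Lp_mul_Lq ν (p := 2) (q := 2) (by constructor <;> norm_num)
    (f := fun t => ‖f t‖ₑ) (g := fun _ => 1) hf.enorm aemeasurable_const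
  simp only [Pi.mul_apply, mul_one, ENNReal.one_rpow, lintegral_const, one_mul] at h
  refine h.trans ?_
  have e3 : ∀ t : ℝ≥0∞, t ^ (2 : ℝ) = t ^ 2 := fun t => by
    rw [← ENNReal.rpow_natCast]; norm_num
  simp only [e3]
  gcongr
  refine (hν univ).trans ?_
  simp

lemma MemL2.lintegral_enorm_sq_ne_top {p T : ℝ} {g : ℝ → ℤ → ℂ} (hg : MemL2 p T g) (k : ℤ) :
    ∫⁻ t in Icc 0 T, ‖g t k‖ₑ ^ 2 ≠ ⊤ := by
  refine ne_top_of_le_ne_top (ENNReal.mul_ne_top (ENNReal.ofReal_ne_top (r := jap k ^ (-p)))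
    (lintegral_sq_lt_top hg)) ?_
  rw [← lintegral_const_mul' _ _ ENNReal.ofReal_ne_top]
  exact lintegral_mono fun t => enorm_sq_le_sobNormSq p (g t) k

lemma restrict_Ioc_le {T t : ℝ} (ht : t ≤ T) :
    (volume.restrict (Ioc 0 t) : Measure ℝ) ≤ volume.restrict (Icc 0 T) :=
  Measure.restrict_mono (Ioc_subset_Icc_self.trans (Icc_subset_Icc_right ht)) le_rfl

lemma MemL2.intervalIntegrable {p T : ℝ} {g : ℝ → ℤ → ℂ} (hg : MemL2 p T g) (k : ℤ) {t : ℝ}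
    (ht : t ∈ Icc 0 T) : IntervalIntegrable (fun τ => g τ k) volume 0 t := by
  rw [intervalIntegrable_iff_integrableOn_Ioc_of_le ht.1]
  have h : IntegrableOn (fun τ => g τ k) (Icc 0 T) := by
    refine ⟨hg.1 k, (lintegral_enorm_le_sqrt le_rfl (hg.1 k)).trans_lt ?_⟩
    have := hg.lintegral_enorm_sq_ne_top k
    exact ENNReal.mul_lt_top (ENNReal.rpow_lt_top_of_nonneg (by norm_num) this)
      (ENNReal.rpow_lt_top_of_nonneg (by norm_num) ENNReal.ofReal_ne_top)
  exact h.mono_set (Ioc_subset_Icc_self.trans (Icc_subset_Icc_right ht.2))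

/-! ### Regularity of limits and the equation they satisfy -/

lemma IsLimit.sobNormSq_lt_top {s T : ℝ} {v₀ : ℤ → ℂ} {g v : ℝ → ℤ → ℂ}
    (hl : IsLimit α s T v₀ g v) {t : ℝ} (ht : t ∈ Icc 0 T) : sobNormSq s (v t) < ⊤ := by
  obtain ⟨N, e, h1, -, -, h4⟩ := hl 1 one_pos
  obtain ⟨h, hgal, -⟩ := h4 N le_rfl
  have := sobNormSq_add_le s (v t - e t) (e t)
  rw [sub_add_cancel] at this
  refine this.trans_lt ?_
  have h2 := sobNormSq_finite_lt_top (hgal.supp t) s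
  have h3 := (h1 t ht).trans_lt ENNReal.one_lt_top
  finiteness

lemma IsLimit.tendsto {s T : ℝ} {v₀ : ℤ → ℂ} {g v : ℝ → ℤ → ℂ}
    (hl : IsLimit α s T v₀ g v) {t₀ : ℝ} (ht₀ : t₀ ∈ Icc 0 T) :
    Tendsto (fun t => sobNormSq s (v t - v t₀)) (𝓝[Icc 0 T] t₀) (𝓝 0) := by
  rw [ENNReal.tendsto_nhds_zero]
  intro ε hε
  obtain ⟨N, e, h1, -, -, h4⟩ := hl (ε / 12) (ENNReal.div_pos hε.ne' ENNReal.ofNat_ne_top)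
  obtain ⟨h, hgal, -⟩ := h4 N le_rfl
  have hc : Tendsto (fun t => sobNormSq s (e t - e t₀)) (𝓝[Icc 0 T] t₀) (𝓝 0) := by
    have h5 := continuousOn_nsq (e := fun t => e t - e t₀) (fun k => (hgal.cont k).sub
      (continuousOn_const (c := e t₀ k))) s (modes N) t₀ ht₀
    have h6 := (ENNReal.continuous_ofReal.tendsto _).comp (h5.tendsto.const_mul (2 * Real.pi))
    have h7 : nsq s (modes N) (e t₀ - e t₀) = 0 := by simp [nsq]
    rw [h7, mul_zero, ENNReal.ofReal_zero] at h6
    refine h6.congr fun t => ?_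
    exact (sobNormSq_finite (fun k hk => by simp [hgal.supp _ k hk]) s).symm
  have h8 := hc.eventually_le_const
    (show 0 < ε / 8 from ENNReal.div_pos hε.ne' ENNReal.ofNat_ne_top)
  filter_upwards [h8, self_mem_nhdsWithin] with t h9 ht
  have i1 := sobNormSq_add_le s (v t - e t) (e t - v t₀)
  have i2 := sobNormSq_add_le s (e t - e t₀) (e t₀ - v t₀)
  rw [sub_add_sub_cancel] at i1 i2
  have i3 := h1 t₀ ht₀
  rw [sobNormSq_sub_comm] at i3
  calc _ ≤ 2 * (ε / 12) + 2 * (2 * (ε / 8) + 2 * (ε / 12)) := by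
        refine i1.trans ?_
        gcongr
        · exact h1 t ht
        · exact i2.trans (by gcongr)
    _ = ε * ((2 / 12 + 4 / 8 + 4 / 12 : ℝ≥0∞)) := by
        simp only [div_eq_mul_inv]; ring
    _ = ε := by
        have : ((2 / 12 + 4 / 8 + 4 / 12 : ℝ≥0∞)) = 1 := by
          rw [← ENNReal.toReal_eq_toReal_iff' (by finiteness) (by finiteness)]
          rw [ENNReal.toReal_add (by finiteness) (by finiteness),
            ENNReal.toReal_add (by finiteness) (by finiteness)]
          simp only [ENNReal.toReal_div, ENNReal.toReal_ofNat, ENNReal.toReal_one]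
          norm_num
        rw [this, mul_one]

lemma IsLimit.continuousOn_kapp {s T : ℝ} {v₀ : ℤ → ℂ} {g v : ℝ → ℤ → ℂ} {p : ℝ}
    {K : ℤ → ℤ → ℂ} (hK : IsOrd p K) (hl : IsLimit α s T v₀ g v) (k : ℤ) :
    ContinuousOn (fun t => kapp K (v t) k) (Icc 0 T) := by
  intro t₀ ht₀
  obtain ⟨C, hC, h⟩ := hK.enorm_kapp_sq_le s k
  refine tendsto_of_enorm_sq_le hC (hl.tendsto ht₀) ?_
  filter_upwards [self_mem_nhdsWithin] with t ht
  rw [← hK.kapp_sub (hl.sobNormSq_lt_top ht) (hl.sobNormSq_lt_top ht₀)]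
  exact h _

lemma enorm_add_sq_le (x y : ℂ) : ‖x + y‖ₑ ^ 2 ≤ 2 * ‖x‖ₑ ^ 2 + 2 * ‖y‖ₑ ^ 2 := by
  have h : ‖x + y‖ ^ 2 ≤ 2 * ‖x‖ ^ 2 + 2 * ‖y‖ ^ 2 := by
    have := norm_add_le x y
    nlinarith [norm_nonneg (x + y), sq_nonneg (‖x‖ - ‖y‖)]
  have h2 := ENNReal.ofReal_le_ofReal h
  rwa [ENNReal.ofReal_add (by positivity) (by positivity), ENNReal.ofReal_mul two_pos.le,
    ENNReal.ofReal_mul two_pos.le, ENNReal.ofReal_pow (norm_nonneg _),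
    ENNReal.ofReal_pow (norm_nonneg _), ENNReal.ofReal_pow (norm_nonneg _), ofReal_norm,
    ofReal_norm, ofReal_norm, ENNReal.ofReal_ofNat] at h2

lemma enorm_le_of_sq_le {x : ℂ} {c ρ : ℝ≥0∞} (h : ‖x‖ₑ ^ 2 ≤ c * ρ ^ 2) :
    ‖x‖ₑ ≤ c ^ (1 / 2 : ℝ) * ρ := by
  have e : ∀ y : ℝ≥0∞, (y ^ 2) ^ (1 / 2 : ℝ) = y := fun y => by
    rw [← ENNReal.rpow_natCast, ← ENNReal.rpow_mul]; norm_num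
  have h1 := ENNReal.rpow_le_rpow h (z := 1 / 2) (by norm_num)
  rwa [e, ENNReal.mul_rpow_of_nonneg _ _ (by norm_num), e] at h1

/-- Limits satisfy the integrated equation. -/
lemma IsLimit.integral_eq (hr : Rapid α) {s T : ℝ} {v₀ : ℤ → ℂ} {g v : ℝ → ℤ → ℂ}
    (hg : MemL2 (s - 1 / 2) T g) (hl : IsLimit α s T v₀ g v) {t : ℝ} (ht : t ∈ Icc 0 T) (k : ℤ) :
    v t k = v₀ k + ∫ τ in (0 : ℝ)..t, (g τ k - kapp (aKer α) (v τ) k) := by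
  have hT : 0 ≤ T := ht.1.trans ht.2
  have hord := isOrd_aKer hr
  obtain ⟨C, hC, hCk⟩ := hord.enorm_kapp_sq_le s k
  have hvc := hl.continuousOn_kapp hord k
  have hint : ∀ {f : ℝ → ℂ}, ContinuousOn f (Icc 0 T) → IntervalIntegrable f volume 0 t :=
    fun hf => (hf.mono (uIcc_subset_Icc ⟨le_rfl, hT⟩ ht)).intervalIntegrable
  set W₁ := ENNReal.ofReal (jap k ^ (-s))
  set W₂ := ENNReal.ofReal (jap k ^ (-(s - 1 / 2)))
  set K := 2 * W₂ + 2 * C * ENNReal.ofReal T with hK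
  rw [← sub_eq_zero, ← enorm_eq_zero]
  refine eq_zero_of_forall_le_mul (c := W₁ ^ (1 / 2 : ℝ) + W₁ ^ (1 / 2 : ℝ) +
    K ^ (1 / 2 : ℝ) * ENNReal.ofReal T ^ (1 / 2 : ℝ)) ?_ fun ρ hρ => ?_
  · have : K ≠ ⊤ := by finiteness
    have h1 : W₁ ≠ ⊤ := ENNReal.ofReal_ne_top
    have e : ∀ y : ℝ≥0∞, y ≠ ⊤ → y ^ (1 / 2 : ℝ) ≠ ⊤ := fun y hy =>
      (ENNReal.rpow_lt_top_of_nonneg (by norm_num) hy).ne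
    have := e _ this
    have := e _ h1
    have := e _ (ENNReal.ofReal_ne_top (r := T))
    finiteness
  -- Tolerance ρ² for squared norms, so that the final error is linear in ρ. The truncation is also
  -- enlarged to contain the mode `k`.
  obtain ⟨N, e, h1, -, h3, h4⟩ := hl (ρ ^ 2) (by positivity)
  obtain ⟨h, hgal, hh⟩ := h4 (max N k.natAbs) (le_max_left _ _)
  set I := modes (max N k.natAbs)
  have hk : k ∈ I := by
    rw [mem_modes, Int.abs_eq_natAbs]; exact_mod_cast le_max_right _ _
  have hec : ContinuousOn (fun τ => h τ k - kapp (aKer α) (e τ) k) (Icc 0 T) := by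
    refine (hgal.cont_forcing k).sub ?_
    simp only [fun τ => kapp_eq_fapp (aKer α) (hgal.supp τ)]
    exact continuousOn_finsetSum _ fun j _ => continuousOn_const.mul (hgal.cont j)
  have hftc : ∫ τ in (0 : ℝ)..t, (h τ k - kapp (aKer α) (e τ) k) = e t k - e 0 k := by
    refine intervalIntegral.integral_eq_sub_of_hasDerivAt_of_le ht.1
      ((hgal.cont k).mono (Icc_subset_Icc_right ht.2)) (fun τ hτ => ?_) (hint hec)
    rw [kapp_eq_fapp (aKer α) (hgal.supp τ)]
    exact hgal.hasDerivAt k hk τ ⟨hτ.1, hτ.2.trans_le ht.2⟩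
  have hgi : IntervalIntegrable (fun τ => g τ k - kapp (aKer α) (v τ) k) volume 0 t :=
    (hg.intervalIntegrable k ht).sub (hint hvc)
  have hdec : v t k - (v₀ k + ∫ τ in (0 : ℝ)..t, (g τ k - kapp (aKer α) (v τ) k)) =
      (v t k - e t k) + (e 0 k - v₀ k) + ∫ τ in (0 : ℝ)..t,
        ((h τ k - kapp (aKer α) (e τ) k) - (g τ k - kapp (aKer α) (v τ) k)) := by
    rw [intervalIntegral.integral_sub (hint hec) hgi, hftc]; ring
  have b1 : ‖v t k - e t k‖ₑ ≤ W₁ ^ (1 / 2 : ℝ) * ρ :=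
    enorm_le_of_sq_le ((enorm_sq_le_sobNormSq s (v t - e t) k).trans (by gcongr; exact h1 t ht))
  have b2 : ‖e 0 k - v₀ k‖ₑ ≤ W₁ ^ (1 / 2 : ℝ) * ρ :=
    enorm_le_of_sq_le ((enorm_sq_le_sobNormSq s (e 0 - v₀) k).trans (by gcongr))
  have b3 : ∫⁻ τ in Icc 0 T, ‖(h τ k - kapp (aKer α) (e τ) k) - (g τ k - kapp (aKer α) (v τ) k)‖ₑ ^ 2
      ≤ K * ρ ^ 2 := by
    calc _ ≤ ∫⁻ τ in Icc 0 T, (2 * (W₂ * sobNormSq (s - 1 / 2) (h τ - g τ)) +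
          2 * (C * ρ ^ 2)) := by
          refine setLIntegral_mono' measurableSet_Icc fun τ hτ => ?_
          have e1 : (h τ k - kapp (aKer α) (e τ) k) - (g τ k - kapp (aKer α) (v τ) k) =
              (h τ - g τ) k + kapp (aKer α) (v τ - e τ) k := by
            rw [hord.kapp_sub (hl.sobNormSq_lt_top hτ) (sobNormSq_finite_lt_top (hgal.supp τ) s),
              Pi.sub_apply]
            ring
          rw [e1]
          refine (enorm_add_sq_le _ _).trans ?_
          gcongr
          · exact enorm_sq_le_sobNormSq _ _ k
          · exact (hCk _).trans (by gcongr; exact h1 τ hτ)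
      _ = 2 * (W₂ * ∫⁻ τ in Icc 0 T, sobNormSq (s - 1 / 2) (h τ - g τ)) +
          2 * (C * ρ ^ 2) * ENNReal.ofReal T := by
          rw [lintegral_add_right _ measurable_const, lintegral_const_mul' _ _ ENNReal.ofNat_ne_top,
            lintegral_const_mul' _ _ ENNReal.ofReal_ne_top, lintegral_const,
            Measure.restrict_apply_univ, Real.volume_Icc, sub_zero]
      _ ≤ 2 * (W₂ * ρ ^ 2) + 2 * (C * ρ ^ 2) * ENNReal.ofReal T := by gcongr
      _ = _ := by rw [hK]; ring
  have b4 : ‖∫ τ in (0 : ℝ)..t,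
      ((h τ k - kapp (aKer α) (e τ) k) - (g τ k - kapp (aKer α) (v τ) k))‖ₑ ≤
      K ^ (1 / 2 : ℝ) * ρ * ENNReal.ofReal T ^ (1 / 2 : ℝ) := by
    rw [intervalIntegral.integral_of_le ht.1]
    refine (enorm_integral_le_lintegral_enorm _).trans ((lintegral_enorm_le_sqrt
      (restrict_Ioc_le ht.2) ((hint hec).sub hgi).1.aestronglyMeasurable).trans ?_)
    gcongr
    have e2 : K ^ (1 / 2 : ℝ) * ρ = (K * ρ ^ 2) ^ (1 / 2 : ℝ) := by
      rw [ENNReal.mul_rpow_of_nonneg _ _ (by norm_num), ← ENNReal.rpow_natCast, ← ENNReal.rpow_mul]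
      norm_num
    rw [e2]
    refine ENNReal.rpow_le_rpow (le_trans ?_ b3) (by norm_num)
    exact lintegral_mono' (restrict_Ioc_le ht.2) le_rfl
  rw [hdec]
  calc _ ≤ ‖v t k - e t k‖ₑ + ‖e 0 k - v₀ k‖ₑ + ‖∫ τ in (0 : ℝ)..t,
        ((h τ k - kapp (aKer α) (e τ) k) - (g τ k - kapp (aKer α) (v τ) k))‖ₑ :=
        (enorm_add_le _ _).trans (by gcongr; exact enorm_add_le _ _)
    _ ≤ W₁ ^ (1 / 2 : ℝ) * ρ + W₁ ^ (1 / 2 : ℝ) * ρ +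
        K ^ (1 / 2 : ℝ) * ρ * ENNReal.ofReal T ^ (1 / 2 : ℝ) := by gcongr
    _ = _ := by ring

end

section

/-! ### Fourier coefficients of smooth periodic functions -/

lemma coeff_deriv {f : ℝ → ℝ} (hf : ContDiff ℝ ∞ f) (hp : Function.Periodic f (2 * Real.pi))
    (k : ℤ) : coeff (deriv f) k = Complex.I * k * coeff f k := by
  have hd : ∀ x, HasDerivAt (fun x => (f x : ℂ)) ((deriv f x : ℝ) : ℂ) x := fun x =>
    ((hf.differentiable (by simp)) x).hasDerivAt.ofReal_comp
  have he : ∀ x : ℝ, HasDerivAt (fun x : ℝ => Complex.exp (-(Complex.I * k * x)))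
      (-(Complex.I * k) * Complex.exp (-(Complex.I * k * x))) x := fun x => by
    have h1 : HasDerivAt (fun x : ℝ => -(Complex.I * k * x)) (-(Complex.I * k)) x := by
      have := (Complex.ofRealCLM.hasDerivAt (x := x)).const_mul (Complex.I * k)
      simpa using this.fun_neg
    convert h1.cexp using 1
    ring
  have hdc : Continuous (deriv f) := hf.continuous_deriv (by simp)
  have hparts := intervalIntegral.integral_deriv_mul_eq_sub
    (a := 0) (b := 2 * Real.pi) (u := fun x => (f x : ℂ)) (u' := fun x => ((deriv f x : ℝ) : ℂ))
    (v := fun x : ℝ => Complex.exp (-(Complex.I * k * x)))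
    (v' := fun x : ℝ => -(Complex.I * k) * Complex.exp (-(Complex.I * k * x)))
    (fun x _ => hd x) (fun x _ => he x)
    ((Complex.continuous_ofReal.comp hdc).intervalIntegrable _ _)
    ((by fun_prop : Continuous fun x : ℝ => -(Complex.I * k) *
      Complex.exp (-(Complex.I * k * x))).intervalIntegrable _ _)
  have hfc : Continuous f := hf.continuous
  have hper : f (2 * Real.pi) = f 0 := by simpa using hp 0
  have hexp : Complex.exp (-(Complex.I * k * ((2 * Real.pi : ℝ) : ℂ))) = 1 := by
    rw [show -(Complex.I * k * ((2 * Real.pi : ℝ) : ℂ)) = ((-k : ℤ) : ℂ) * (2 * Real.pi * Complex.I) by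
      push_cast; ring]
    exact Complex.exp_int_mul_two_pi_mul_I _
  rw [intervalIntegral.integral_add] at hparts
  · rw [hexp, hper] at hparts
    simp only [Complex.ofReal_zero, mul_zero, neg_zero, Complex.exp_zero, sub_self] at hparts
    have e : (∫ x in (0 : ℝ)..(2 * Real.pi), (f x : ℂ) * (-(Complex.I * k) *
        Complex.exp (-(Complex.I * k * x)))) = -(Complex.I * k) *
        ∫ x in (0 : ℝ)..(2 * Real.pi), (f x : ℂ) * Complex.exp (-(Complex.I * k * x)) := by
      rw [← intervalIntegral.integral_const_mul]
      exact intervalIntegral.integral_congr fun x _ => by ring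
    rw [e] at hparts
    rw [coeff, coeff]
    linear_combination (1 / (2 * Real.pi) : ℂ) * hparts
  · exact Continuous.intervalIntegrable (by fun_prop) _ _
  · exact Continuous.intervalIntegrable (by fun_prop) _ _

lemma norm_coeff_le (f : ℝ → ℝ) (k : ℤ) :
    ‖coeff f k‖ ≤ 1 / (2 * Real.pi) * ∫ x in (0 : ℝ)..(2 * Real.pi), |f x| := by
  rw [coeff, norm_mul]
  have h1 : ‖(1 / (2 * Real.pi) : ℂ)‖ = 1 / (2 * Real.pi) := by
    have : (1 / (2 * Real.pi) : ℂ) = ((1 / (2 * Real.pi) : ℝ) : ℂ) := by push_cast; rfl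
    rw [this, Complex.norm_real, Real.norm_of_nonneg (by positivity)]
  rw [h1]
  gcongr
  refine (intervalIntegral.norm_integral_le_integral_norm (by positivity)).trans (le_of_eq ?_)
  refine intervalIntegral.integral_congr fun x _ => ?_
  have : Complex.exp (-(Complex.I * k * x)) = Complex.exp (((-(k * x) : ℝ) : ℂ) * Complex.I) := by
    congr 1; push_cast; ring
  simp only [norm_mul, this, Complex.norm_exp_ofReal_mul_I, mul_one, Complex.norm_real,
    Real.norm_eq_abs]

/-- Each integration by parts gains a factor |k|, and the derivative is again smooth and periodic.
-/
lemma pow_mul_norm_coeff_le (n : ℕ) : ∀ f : ℝ → ℝ, ContDiff ℝ ∞ f →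
    Function.Periodic f (2 * Real.pi) → ∃ C : ℝ, ∀ k : ℤ, |(k : ℝ)| ^ n * ‖coeff f k‖ ≤ C := by
  induction n with
  | zero => exact fun f _ _ => ⟨_, fun k => by simpa using norm_coeff_le f k⟩
  | succ n ih =>
    intro f hf hp
    have hp' : Function.Periodic (deriv f) (2 * Real.pi) := fun x => by
      rw [← deriv_comp_add_const]
      congr 1
      exact funext hp
    obtain ⟨C, h⟩ := ih (deriv f) (contDiff_infty_iff_deriv.1 hf).2 hp'
    refine ⟨C, fun k => ?_⟩
    have h1 := h k
    rw [coeff_deriv hf hp, norm_mul, norm_mul, Complex.norm_I, one_mul, Complex.norm_intCast] at h1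
    rwa [pow_succ, mul_assoc]

lemma rapid_coeff {f : ℝ → ℝ} (hf : ContDiff ℝ ∞ f) (hp : Function.Periodic f (2 * Real.pi)) :
    Rapid (coeff f) := by
  intro M
  obtain ⟨n, hn⟩ := exists_nat_ge M
  obtain ⟨C₀, h₀⟩ := pow_mul_norm_coeff_le 0 f hf hp
  obtain ⟨C₁, h₁⟩ := pow_mul_norm_coeff_le (2 * n) f hf hp
  have hC₀ : 0 ≤ C₀ := le_trans (by positivity) (h₀ 0)
  have hC₁ : 0 ≤ C₁ := le_trans (by positivity) (h₁ 0)
  refine ⟨2 ^ n * (C₀ + C₁), by positivity, fun k => ?_⟩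
  have h2 : jap k ^ M ≤ 2 ^ n * (1 + |(k : ℝ)| ^ (2 * n)) := by
    calc jap k ^ M ≤ jap k ^ (n : ℝ) := jap_rpow_mono k hn
      _ = (1 + (k : ℝ) ^ 2) ^ n := by rw [Real.rpow_natCast, jap]
      _ ≤ 2 ^ (n - 1) * (1 ^ n + ((k : ℝ) ^ 2) ^ n) :=
          add_pow_le zero_le_one (sq_nonneg _) n
      _ ≤ 2 ^ n * (1 + |(k : ℝ)| ^ (2 * n)) := by
          rw [one_pow, pow_mul, sq_abs]
          gcongr
          · norm_num
          · omega
  have h3 : jap k ^ M * jap k ^ (-M) = 1 := by rw [← jap_rpow_add]; simp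
  have h4 := jap_rpow_nonneg k (-M)
  have h0 := h₀ k
  have h1 := h₁ k
  rw [pow_zero, one_mul] at h0
  calc ‖coeff f k‖ = (jap k ^ M * ‖coeff f k‖) * jap k ^ (-M) := by
        rw [mul_right_comm, h3, one_mul]
    _ ≤ (2 ^ n * (1 + |(k : ℝ)| ^ (2 * n)) * ‖coeff f k‖) * jap k ^ (-M) := by gcongr
    _ = 2 ^ n * (‖coeff f k‖ + |(k : ℝ)| ^ (2 * n) * ‖coeff f k‖) * jap k ^ (-M) := by ring
    _ ≤ _ := by gcongr

lemma herm_coeff (f : ℝ → ℝ) : Herm (coeff f) := by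
  intro k
  rw [coeff, coeff, map_mul, ← intervalIntegral.intervalIntegral_conj]
  congr 1
  · simp [map_ofNat]
  · refine intervalIntegral.integral_congr fun x _ => ?_
    simp only [map_mul, Complex.conj_ofReal, ← Complex.exp_conj, map_neg, Complex.conj_I,
      map_intCast]
    push_cast
    ring_nf

lemma coeff_zero (f : ℝ → ℝ) :
    coeff f 0 = ((1 / (2 * Real.pi) * ∫ x in (0 : ℝ)..(2 * Real.pi), f x : ℝ) : ℂ) := by
  rw [coeff, Complex.ofReal_mul, ← intervalIntegral.integral_ofReal]
  simp

/-! ### Reflection -/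

variable {α : ℤ → ℂ}

/-- The coefficients of the complex conjugate function. -/
noncomputable def cconj (u : ℤ → ℂ) (k : ℤ) : ℂ := conj (u (-k))

lemma sobNormSq_cconj (σ : ℝ) (u : ℤ → ℂ) : sobNormSq σ (cconj u) = sobNormSq σ u := by
  rw [sobNormSq_eq, sobNormSq_eq]
  congr 1
  rw [← (Equiv.neg ℤ).tsum_eq]
  refine tsum_congr fun k => ?_
  simp [cconj, jap_neg, ← ofReal_norm]

/-- The generator maps real functions to real functions: i k|k| is invariant under k ↦ -k combined
with conjugation, and so are G and D. -/
lemma aKer_reflect (hα : Herm α) (k j : ℤ) : conj (aKer α (-k) (-j)) = aKer α k j := by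
  have e : ∀ k, conj (α k) = α (-k) := fun k => (hα k).symm
  have hg : ∀ k j, conj (gKer α (-k) (-j)) = gKer α k j := fun k j => by
    simp only [gKer, map_sub, map_mul, e, map_ofNat, Complex.conj_ofReal]
    ring_nf
  have hs : conj (sKer α (-k) (-j)) = sKer α k j := by
    rw [sKer, sKer, Complex.conj_tsum, ← (Equiv.neg ℤ).tsum_eq]
    refine tsum_congr fun m => ?_
    simp only [Equiv.neg_apply, dgKer, map_mul, hg, abs_neg, map_intCast]
  rw [aKer, aKer, map_add, hs]
  congr 1
  by_cases h : k = j
  · simp [h]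
  · simp [h]

lemma kapp_aKer_cconj (hα : Herm α) (u : ℤ → ℂ) (k : ℤ) :
    kapp (aKer α) (cconj u) k = conj (kapp (aKer α) u (-k)) := by
  rw [kapp, kapp, Complex.conj_tsum, ← (Equiv.neg ℤ).tsum_eq]
  refine tsum_congr fun j => ?_
  rw [map_mul, Equiv.neg_apply, ← aKer_reflect hα k, neg_neg, cconj, neg_neg]

lemma MemC.cconj {r T : ℝ} {v : ℝ → ℤ → ℂ} (hv : MemC r T v) :
    MemC r T (fun t => cconj (v t)) := by
  rw [memC_iff] at *
  refine ⟨fun t ht => ⟨by simp [BenjaminOno.cconj, (hv.1 t ht).1], ?_⟩, fun t₀ ht₀ => ?_⟩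
  · rw [sobNormSq_cconj]; exact (hv.1 t ht).2
  · refine (hv.2 t₀ ht₀).congr fun t => ?_
    rw [← sobNormSq_cconj]
    congr 1
    funext k
    simp [BenjaminOno.cconj]

/-! ### Solutions -/

variable {a : ℝ → ℝ}

lemma integral_generator_eq {T r : ℝ} (hr : Rapid (coeff a)) {g v : ℝ → ℤ → ℂ}
    (hv : ∀ t ∈ Icc 0 T, sobNormSq r (v t) < ⊤) {t : ℝ} (ht : t ∈ Icc 0 T) (k : ℤ) :
    ∫ τ in (0 : ℝ)..t, (g τ k - hilbert (deriv1 (deriv1 (v τ))) k - opG a (absD (opG a (v τ))) k) =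
      ∫ τ in (0 : ℝ)..t, (g τ k - kapp (aKer (coeff a)) (v τ) k) := by
  refine intervalIntegral.integral_congr fun τ hτ => ?_
  rw [uIcc_of_le ht.1] at hτ
  simp only [← generator_eq_kapp hr (hv τ ⟨hτ.1, hτ.2.trans ht.2⟩) k, sub_sub]

lemma IsSolution.unique (hr : Rapid (coeff a)) (hμ : 0 < meanSq (coeff a)) {T p : ℝ} {v₀ : ℤ → ℂ}
    {g v w : ℝ → ℤ → ℂ} (hg : MemL2 p T g) (hv : IsSolution a T v₀ g v)
    (hw : IsSolution a T v₀ g w) {t : ℝ} (ht : t ∈ Icc 0 T) : w t = v t := by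
  obtain ⟨⟨r₁, hv₁⟩, hv⟩ := hv
  obtain ⟨⟨r₂, hw₁⟩, hw⟩ := hw
  have hv₂ := hv₁.mono (min_le_left r₁ r₂)
  have hw₂ := hw₁.mono (min_le_right r₁ r₂)
  have hord := isOrd_aKer hr
  have h := eq_zero_of_integral_eq hr (herm_coeff a) hμ (hw₂.sub hv₂) fun t ht k => by
    have hint : ∀ {u : ℝ → ℤ → ℂ}, MemC (min r₁ r₂) T u → IntervalIntegrable
        (fun τ => g τ k - kapp (aKer (coeff a)) (u τ) k) volume 0 t := fun hu =>
      (hg.intervalIntegrable k ht).sub (((hu.continuousOn_kapp hord k).mono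
        (uIcc_subset_Icc ⟨le_rfl, ht.1.trans ht.2⟩ ht)).intervalIntegrable)
    rw [Pi.sub_apply, hv t ht, hw t ht, integral_generator_eq hr (fun t ht => (hv₂.1 t ht).2) ht,
      integral_generator_eq hr (fun t ht => (hw₂.1 t ht).2) ht, add_sub_add_left_eq_sub,
      ← intervalIntegral.integral_sub (hint hw₂) (hint hv₂), ← intervalIntegral.integral_neg]
    refine intervalIntegral.integral_congr fun τ hτ => ?_
    rw [uIcc_of_le ht.1] at hτ
    have hτ' : τ ∈ Icc 0 T := ⟨hτ.1, hτ.2.trans ht.2⟩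
    simp only [hord.kapp_sub (hw₂.1 τ hτ').2 (hv₂.1 τ hτ').2]
    ring
  funext k
  exact sub_eq_zero.1 (h t ht k)

/-- The complex conjugate of a solution for real-valued data is a solution. -/
lemma IsSolution.cconj (hr : Rapid (coeff a)) {T : ℝ} {v₀ : ℤ → ℂ} {g v : ℝ → ℤ → ℂ}
    (hv : IsSolution a T v₀ g v) (hv₀ : IsRealValued v₀)
    (hgr : ∀ᵐ t ∂volume.restrict (Icc 0 T), IsRealValued (g t)) :
    IsSolution a T v₀ g (fun t => cconj (v t)) := by
  obtain ⟨⟨r, hv₁⟩, hv⟩ := hv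
  refine ⟨⟨r, hv₁.cconj⟩, fun t ht k => ?_⟩
  rw [integral_generator_eq hr (fun t ht => (hv₁.cconj.1 t ht).2) ht]
  change conj (v t (-k)) = _
  rw [hv t ht,
    integral_generator_eq hr (fun t ht => (hv₁.1 t ht).2) ht, map_add, hv₀ k,
    ← intervalIntegral.intervalIntegral_conj]
  congr 1
  · simp
  · refine intervalIntegral.integral_congr_ae ?_
    have h1 := ae_restrict_of_ae_restrict_of_subset
      (Ioc_subset_Icc_self.trans (Icc_subset_Icc_right ht.2) : Ioc 0 t ⊆ Icc 0 T) hgr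
    rw [ae_restrict_iff' measurableSet_Ioc] at h1
    filter_upwards [h1] with τ h2 hτ
    rw [uIoc_of_le ht.1] at hτ
    rw [map_sub, kapp_aKer_cconj (herm_coeff a), h2 hτ k]
    simp

/-- Conservation of the mean: since â₀ = 1/(2π), the mode 0 of Gu cancels for every u, the
dispersive term has none, and g is mean-free for almost every time. -/
lemma IsLimit.memC (hr : Rapid (coeff a)) (h0 : coeff a 0 = 1 / (2 * Real.pi)) {s T : ℝ}
    {v₀ : ℤ → ℂ} {g v : ℝ → ℤ → ℂ} (hv₀ : v₀ 0 = 0) (hg : MemL2 (s - 1 / 2) T g)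
    (hl : IsLimit (coeff a) s T v₀ g v) : MemC s T v := by
  refine memC_iff.2 ⟨fun t ht => ⟨?_, hl.sobNormSq_lt_top ht⟩, fun t₀ ht₀ => hl.tendsto ht₀⟩
  rw [hl.integral_eq hr hg ht 0, hv₀, zero_add,
    ← integral_generator_eq hr (fun t ht => hl.sobNormSq_lt_top ht) ht]
  refine intervalIntegral.integral_zero_ae ?_
  have h1 := ae_restrict_of_ae_restrict_of_subset
    (Ioc_subset_Icc_self.trans (Icc_subset_Icc_right ht.2) : Ioc 0 t ⊆ Icc 0 T) hg.2.1
  rw [ae_restrict_iff' measurableSet_Ioc] at h1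
  filter_upwards [h1] with τ h2 hτ
  rw [uIoc_of_le ht.1] at hτ
  have hπ : (Real.pi : ℂ) ≠ 0 := by exact_mod_cast Real.pi_ne_zero
  rw [(h2 hτ).1, opG, h0, hilbert]
  simp only [Int.sign_zero, Int.cast_zero, mul_zero, zero_mul, sub_zero, zero_sub, neg_eq_zero]
  field_simp
  ring

end

end BenjaminOno

/-! ### Conclusion -/

theorem proposition2p16 (a : ℝ → ℝ) (ha : ContDiff ℝ ∞ a)
    (ha_per : Function.Periodic a (2 * Real.pi)) (ha_nonneg : ∀ x, 0 ≤ a x)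
    (ha_int : ∫ x in (0 : ℝ)..(2 * Real.pi), a x = 1) (s : ℝ) (hs : 0 ≤ s) :
    ∃ C : ℝ → ℝ≥0, MonotoneOn C (Ioi 0) ∧
      ∀ T : ℝ, 0 < T → ∀ (v₀ : ℤ → ℂ) (g : ℝ → ℤ → ℂ),
        BenjaminOno.MemH0 s v₀ → BenjaminOno.MemL2 (s - 1 / 2) T g →
        ∃ v : ℝ → ℤ → ℂ,
          BenjaminOno.IsSolution a T v₀ g v ∧
          (∀ w, BenjaminOno.IsSolution a T v₀ g w → ∀ t ∈ Icc 0 T, w t = v t) ∧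
          BenjaminOno.MemZ s T v ∧
          BenjaminOno.normZ s T v ≤
            C T * (BenjaminOno.sobNorm s v₀ + BenjaminOno.normL2 (s - 1 / 2) T g) ∧
          (BenjaminOno.IsRealValued v₀ →
            (∀ᵐ t ∂volume.restrict (Icc 0 T), BenjaminOno.IsRealValued (g t)) →
            ∀ t ∈ Icc 0 T, BenjaminOno.IsRealValued (v t)) := by
  open BenjaminOno in
  have hr := rapid_coeff ha ha_per
  have hα := herm_coeff a
  have h0 : coeff a 0 = 1 / (2 * Real.pi) := by
    rw [coeff_zero, ha_int]; push_cast; ring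
  have hμ : 0 < meanSq (coeff a) := meanSq_pos hr (by
    have hπ : (Real.pi : ℂ) ≠ 0 := by exact_mod_cast Real.pi_ne_zero
    rw [h0]; simp [hπ])
  obtain ⟨C, hC, hest⟩ := IsLimit.estimate hr hα hμ s
  -- The square root returns from squared norms to norms; the 2 is there because each of the two
  -- summands of the Z norm obeys the same bound.
  refine ⟨fun T => 2 * (C * Real.exp (C * T)).toNNReal ^ (1 / 2 : ℝ), fun T _ T' _ hTT' => ?_,
    fun T hT v₀ g hv₀ hg => ?_⟩
  · have : C * T ≤ C * T' := by gcongr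
    dsimp only
    gcongr
  obtain ⟨v, hl⟩ := exists_isLimit hr hα hμ hT hv₀.2 hg
  have hvC : MemC s T v := hl.memC hr h0 hv₀.1 hg
  have hsol : IsSolution a T v₀ g v := ⟨⟨s, hvC⟩, fun t ht k => by
    rw [integral_generator_eq hr (fun t ht => (hvC.1 t ht).2) ht]
    exact hl.integral_eq hr hg ht k⟩
  have hE := hest T v₀ g v hT hg hl hvC.continuousOn
  set C₁ := ENNReal.ofReal (C * Real.exp (C * T)) with hC₁
  set V := sobNormSq s v₀
  set Γ := ∫⁻ τ in Icc 0 T, sobNormSq (s - 1 / 2) (g τ)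
  have hVΓ : C₁ * (V + Γ) < ⊤ := by
    have h1 : V < ⊤ := hv₀.2
    have h2 : Γ ≠ ⊤ := lintegral_sq_lt_top hg
    finiteness
  have hmeas : ∀ k, AEStronglyMeasurable (fun t => v t k) (volume.restrict (Icc 0 T)) := fun k =>
    (hvC.continuousOn k).aestronglyMeasurable measurableSet_Icc
  have hint : ∫⁻ τ in Icc 0 T, sobNormSq (s + 1 / 2) (v τ) ≤ C₁ * (V + Γ) :=
    le_add_self.trans (hE 0 ⟨le_rfl, hT.le⟩)
  refine ⟨v, hsol, fun w hw t ht => hsol.unique hr hμ hg hw ht, ⟨hvC, hmeas, ?_, ?_⟩, ?_, ?_⟩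
  · have h1 := ae_lt_top' (aemeasurable_sobNormSq hmeas (s + 1 / 2)) (hint.trans_lt hVΓ).ne
    filter_upwards [h1, ae_restrict_mem measurableSet_Icc] with t h2 ht
    exact ⟨(hvC.1 t ht).1, h2⟩
  · exact ENNReal.rpow_lt_top_of_nonneg (by norm_num) (hint.trans_lt hVΓ).ne
  · have hroot : (C₁ * (V + Γ)) ^ (1 / 2 : ℝ) ≤
        C₁ ^ (1 / 2 : ℝ) * (V ^ (1 / 2 : ℝ) + Γ ^ (1 / 2 : ℝ)) := by
      rw [ENNReal.mul_rpow_of_nonneg _ _ (by norm_num)]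
      gcongr
      exact ENNReal.rpow_add_le_add_rpow _ _ (by norm_num) (by norm_num)
    have h1 : (⨆ t ∈ Icc 0 T, sobNorm s (v t)) ≤ (C₁ * (V + Γ)) ^ (1 / 2 : ℝ) :=
      iSup₂_le fun t ht => ENNReal.rpow_le_rpow (le_self_add.trans (hE t ht)) (by norm_num)
    have h2 : normL2 (s + 1 / 2) T v ≤ (C₁ * (V + Γ)) ^ (1 / 2 : ℝ) :=
      ENNReal.rpow_le_rpow hint (by norm_num)
    have e : ((2 * (C * Real.exp (C * T)).toNNReal ^ (1 / 2 : ℝ) : ℝ≥0) : ℝ≥0∞) =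
        2 * C₁ ^ (1 / 2 : ℝ) := by
      rw [ENNReal.coe_mul, ENNReal.coe_rpow_of_nonneg _ (by norm_num), hC₁]
      rfl
    rw [e, mul_assoc, two_mul]
    exact add_le_add (h1.trans hroot) (h2.trans hroot)
  · intro hvr hgr t ht k
    have h1 := hsol.unique hr hμ hg (hsol.cconj hr hvr hgr) ht
    have h2 := congrFun h1 (-k)
    rw [cconj, neg_neg] at h2
    exact h2.symm
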